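/- All logarithms are to base 2, all alphabets are finite and all quantum systems finite-dimensional. For operators put $\|A\|_1=\mathrm{Tr}\sqrt{A^\dagger A}$, $D(\rho,\sigma)=\tfrac12\|\rho-\sigma\|_1$, $F(\rho,\sigma)=\|\sqrt\rho\sqrt\sigma\|_1$, $P(\rho,\sigma)=\sqrt{1-F(\rho,\sigma)^2}$, and let $B_\epsilon(\rho)$ be the set of all $\bar\rho\ge 0$ with $\mathrm{Tr}\,\bar\rho\le 1$ and $P(\rho,\bar\rho)\le\epsilon$. With maxima over density operators $\sigma^B$, let $$H_{\min}(A|B)_\rho=\max_{\sigma^B}\bigl(-\log\min\{\lambda:\rho^{AB}\le\lambda\,\mathbb 1^A\otimes\sigma^B\}\bigr),\qquad H_{\max}(A|B)_\rho=\max_{\sigma^B}2\log F(\rho^{AB},\mathbb 1^A\otimes\sigma^B),$$ $$H_{\min}^{\epsilon}(A|B)_\rho=\max_{\bar\rho\in B_\epsilon(\rho^{AB})}H_{\min}(A|B)_{\bar\rho},\qquad H_{\max}^{\epsilon}(A|B)_\rho=\min_{\bar\rho\in B_\epsilon(\rho^{AB})}H_{\max}(A|B)_{\bar\rho}.$$ Let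 $\psi^{XBE}=\sum_x p_x|x\rangle\langle x|^X\otimes\varphi_x^{BE}$ be a classical-quantum state. In a one-way key distillation protocol Alice computes a key $K_A\in\{0,1\}^n$ and a public message $C$ from $X$, and Bob obtains $K_B\in\{0,1\}^n$ by a measurement of $B$ that may depend on $C$. The protocol is $\epsilon$-good if its output state satisfies $D(\rho^{K_AK_BCE},\kappa^{K_AK_B}\otimes\rho^{CE})\le\epsilon$, where $\kappa^{K_AK_B}=2^{-n}\sum_k|k\rangle\langle k|\otimes|k\rangle\langle k|$. Let $\ell^{\epsilon}_{\rm secr}(X;B|E)_\psi$ be the supremum of all $n$ for which an $\epsilon$-good protocol exists. Let $\sup_{(U,V)\leftarrow X}$ denote the supremum over all classical $U,V$ with finite alphabets that Alice can compute from $X$. Then for all $\epsilon_1,\epsilon_1',\epsilon_2\ge 0$, with $\epsilon=\epsilon_1+\epsilon_2$ and $\epsilon'=\epsilon_1'+\epsilon_2$, $$\ell_{\rm secr}^{\epsilon+\epsilon'}(X;B|E)_\psi\ \ge\ \sup_{(U,V)\leftarrow X}\bigl[H_{\min}^{\epsilon_1'}(U|EV)_\psi-H_{\max}^{\epsilon_1}(U|BV)_\psi\bigr]-4\log\tfrac1{\epsilon_2}-3$$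 (for $\epsilon_2=0$ the right-hand side is read as $-\infty$), and for all $\epsilon\ge 0$ $$\ell_{\rm secr}^{\epsilon}(X;B|E)_\psi\ \le\ \sup_{(U,V)\leftarrow X}\bigl[H_{\min}^{\sqrt{2\epsilon}}(U|EV)_\psi-H_{\max}^{\sqrt{2\epsilon}}(U|BV)_\psi\bigr].$$ Both bounds hold under either convention for what Alice can compute from $X$, used both for the protocols and for the suprema: functions of $X$ only, or arbitrary stochastic maps (local randomness). Common-randomness distillation is the special case of a trivial system $E$. -/

import Mathlib

open scoped Kronecker ComplexOrder MatrixOrder ENNReal NNReal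

namespace SKD

noncomputable section

/-! ## Finite-dimensional states

Operators on a finite-dimensional Hilbert space are complex matrices indexed by an orthonormal
basis; a tensor product of systems is indexed by the product of the index types. -/

/-- Density operators: positive semidefinite with trace one. -/
def IsDensity {d : Type*} [Fintype d] (ρ : Matrix d d ℂ) : Prop :=
  ρ.PosSemidef ∧ ρ.trace = 1

/-- Possibly subnormalized states: positive semidefinite with trace at most one. -/
def IsSubnormalized {d : Type*} [Fintype d] (ρ : Matrix d d ℂ) : Prop :=
  ρ.PosSemidef ∧ ρ.trace.re ≤ 1

/-- Partial trace over the first tensor factor. -/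
def traceLeft {a b : Type*} [Fintype a] (ρ : Matrix (a × b) (a × b) ℂ) : Matrix b b ℂ :=
  Matrix.of fun j j' => ∑ i, ρ (i, j) (i, j')

/-- Partial trace over the second tensor factor. -/
def traceRight {a b : Type*} [Fintype b] (ρ : Matrix (a × b) (a × b) ℂ) : Matrix a a ℂ :=
  Matrix.of fun i i' => ∑ j, ρ (i, j) (i', j)

/-- The projector `|i⟩⟨i|` onto a basis vector. -/
def ketbra {d : Type*} [DecidableEq d] (i : d) : Matrix d d ℂ := Matrix.single i i 1

/-- The trace norm `‖A‖₁ = tr √(A† A)`. -/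
def traceNorm {d : Type*} [Fintype d] [DecidableEq d] (A : Matrix d d ℂ) : ℝ :=
  (CFC.sqrt (A.conjTranspose * A)).trace.re

/-- The trace distance `D(ρ, σ) = ½ ‖ρ - σ‖₁`. -/
def traceDist {d : Type*} [Fintype d] [DecidableEq d] (ρ σ : Matrix d d ℂ) : ℝ :=
  traceNorm (ρ - σ) / 2

/-- The fidelity `F(ρ, σ) = ‖√ρ √σ‖₁`. -/
def fidelity {d : Type*} [Fintype d] [DecidableEq d] (ρ σ : Matrix d d ℂ) : ℝ :=
  traceNorm (CFC.sqrt ρ * CFC.sqrt σ)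

/-- The purification distance `P(ρ, σ) = √(1 - F(ρ, σ)²)`. -/
def purifDist {d : Type*} [Fintype d] [DecidableEq d] (ρ σ : Matrix d d ℂ) : ℝ :=
  Real.sqrt (1 - fidelity ρ σ ^ 2)

/-- The ball of possibly subnormalized states within purification distance `ε` of `ρ`. -/
def ball {d : Type*} [Fintype d] [DecidableEq d] (ε : ℝ) (ρ : Matrix d d ℂ) :
    Set (Matrix d d ℂ) :=
  {ρ' | IsSubnormalized ρ' ∧ purifDist ρ ρ' ≤ ε}

/-! ## Min- and max-entropy -/

/-- Base-two logarithm with values in the extended reals: `log 0 = -∞`, `log ∞ = ∞`. -/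
def log2 (x : ℝ≥0∞) : EReal := ENNReal.log x / ((Real.log 2 : ℝ) : EReal)

/-- `H_max(A|B)_ρ = max_σ 2 log F(ρ^{AB}, 1^A ⊗ σ^B)` over normalized states `σ^B`. -/
def hMax {a b : Type*} [Fintype a] [DecidableEq a] [Fintype b] [DecidableEq b]
    (ρ : Matrix (a × b) (a × b) ℂ) : EReal :=
  ⨆ (σ : Matrix b b ℂ) (_ : IsDensity σ),
    2 * log2 (ENNReal.ofReal (fidelity ρ ((1 : Matrix a a ℂ) ⊗ₖ σ)))

/-- The least `t ≥ 0` with `ρ^{AB} ≤ t (1^A ⊗ σ^B)`; it is `∞` if there is none. -/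
def lambdaMin {a b : Type*} [Fintype a] [DecidableEq a] [Fintype b]
    (ρ : Matrix (a × b) (a × b) ℂ) (σ : Matrix b b ℂ) : ℝ≥0∞ :=
  ⨅ (t : ℝ≥0) (_ : (((t : ℝ) : ℂ) • ((1 : Matrix a a ℂ) ⊗ₖ σ) - ρ).PosSemidef), (t : ℝ≥0∞)

/-- `H_min(A|B)_ρ = max_σ (- log λ_min(ρ^{AB}, σ^B))` over normalized states `σ^B`. -/
def hMin {a b : Type*} [Fintype a] [DecidableEq a] [Fintype b]
    (ρ : Matrix (a × b) (a × b) ℂ) : EReal :=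
  ⨆ (σ : Matrix b b ℂ) (_ : IsDensity σ), -log2 (lambdaMin ρ σ)

/-- The smooth min-entropy `H_min^ε(A|B)_ρ`. -/
def hMinSmooth {a b : Type*} [Fintype a] [DecidableEq a] [Fintype b] [DecidableEq b]
    (ε : ℝ) (ρ : Matrix (a × b) (a × b) ℂ) : EReal :=
  ⨆ ρ' ∈ ball ε ρ, hMin ρ'

/-- The smooth max-entropy `H_max^ε(A|B)_ρ`. -/
def hMaxSmooth {a b : Type*} [Fintype a] [DecidableEq a] [Fintype b] [DecidableEq b]
    (ε : ℝ) (ρ : Matrix (a × b) (a × b) ℂ) : EReal :=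
  ⨅ ρ' ∈ ball ε ρ, hMax ρ'

/-! ## Classical-quantum states and classical processing of the classical part -/

/-- The ensemble `{p_x, φ_x}` defining the cq state `∑_x p_x |x⟩⟨x| ⊗ φ_x`. -/
structure CQState (X d : Type*) [Fintype X] [Fintype d] where
  /-- the distribution of the classical variable -/
  prob : X → ℝ
  prob_nonneg : ∀ x, 0 ≤ prob x
  prob_sum : ∑ x, prob x = 1
  /-- the conditional states of the quantum system -/
  state : X → Matrix d d ℂ
  state_isDensity : ∀ x, IsDensity (state x)

/-- Alice's local classical processing: either by functions only, or by arbitrary stochastic maps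
(using local randomness). -/
inductive Processing
  | deterministic
  | randomized

/-- `W x y`, the probability of the output `y` on input `x`, is a map of the given class. -/
def Processing.Allows {X Y : Type*} [Fintype Y] [DecidableEq Y] :
    Processing → (X → Y → ℝ) → Prop
  | .deterministic, W => ∃ f : X → Y, ∀ x y, W x y = if y = f x then 1 else 0
  | .randomized, W => (∀ x y, 0 ≤ W x y) ∧ ∀ x, ∑ y, W x y = 1

variable {X B E U V : Type*} [Fintype X] [Fintype B] [Fintype E] [Fintype U] [Fintype V]
  [DecidableEq U] [DecidableEq V]

/-- The state `ψ^{U(BV)}` after Alice computed `(U, V)` from `X` by `W`. -/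
def stateBob (ψ : CQState X (B × E)) (W : X → U × V → ℝ) :
    Matrix (U × (B × V)) (U × (B × V)) ℂ :=
  ∑ x, ∑ u, ∑ v, ((ψ.prob x * W x (u, v) : ℝ) : ℂ) •
    (ketbra u ⊗ₖ (traceRight (ψ.state x) ⊗ₖ ketbra v))

/-- The state `ψ^{U(EV)}` after Alice computed `(U, V)` from `X` by `W`. -/
def stateEve (ψ : CQState X (B × E)) (W : X → U × V → ℝ) :
    Matrix (U × (E × V)) (U × (E × V)) ℂ :=
  ∑ x, ∑ u, ∑ v, ((ψ.prob x * W x (u, v) : ℝ) : ℂ) •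
    (ketbra u ⊗ₖ (traceLeft (ψ.state x) ⊗ₖ ketbra v))

/-- `sup_{(U,V) ← X} [H_min^{εmin}(U|EV)_ψ - H_max^{εmax}(U|BV)_ψ]`, over all finite alphabets of
`U` and `V` and all maps of the given class. -/
def entropyGap [DecidableEq B] [DecidableEq E] (r : Processing) (εmin εmax : ℝ)
    (ψ : CQState X (B × E)) : EReal :=
  ⨆ (k : ℕ) (l : ℕ) (W : X → Fin k × Fin l → ℝ) (_ : r.Allows W),
    hMinSmooth εmin (stateEve ψ W) - hMaxSmooth εmax (stateBob ψ W)

/-! ## Secret key distillation with one-way public communication -/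

/-- A protocol distilling a key in `K` with public message in `C`: Alice computes her key and the
message from `X`; Bob measures `B` with a POVM that depends on the message, the outcome being
his key. -/
structure Protocol (r : Processing) (X B K C : Type*) [Fintype B] [DecidableEq B]
    [Fintype K] [DecidableEq K] [Fintype C] [DecidableEq C] where
  alice : X → K × C → ℝ
  alice_allowed : r.Allows alice
  bob : C → K → Matrix B B ℂ
  bob_posSemidef : ∀ c k, (bob c k).PosSemidef
  bob_sum : ∀ c, ∑ k, bob c k = 1

variable {K C : Type*} [Fintype K] [DecidableEq K] [Fintype C] [DecidableEq C]

/-- The output state `ρ^{K_A K_B C E}` of a protocol. -/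
def Protocol.output [DecidableEq B] [DecidableEq E] {r : Processing} (Q : Protocol r X B K C)
    (ψ : CQState X (B × E)) : Matrix ((K × K) × (C × E)) ((K × K) × (C × E)) ℂ :=
  ∑ x, ∑ k, ∑ c, ∑ k', ((ψ.prob x * Q.alice x (k, c) : ℝ) : ℂ) •
    ((ketbra k ⊗ₖ ketbra k') ⊗ₖ
      (ketbra c ⊗ₖ traceLeft ((Q.bob c k' ⊗ₖ (1 : Matrix E E ℂ)) * ψ.state x)))

/-- The perfect key `κ = |K|⁻¹ ∑_k |k⟩⟨k| ⊗ |k⟩⟨k|`. -/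
def idealKey (K : Type*) [Fintype K] [DecidableEq K] : Matrix (K × K) (K × K) ℂ :=
  ((Fintype.card K : ℂ)⁻¹) • ∑ k : K, ketbra k ⊗ₖ ketbra k

/-- `ρ^{K_A K_B C E}` is an `ε`-good secret key: `D(ρ^{K_A K_B C E}, κ ⊗ ρ^{C E}) ≤ ε`. -/
def IsGoodKey {D : Type*} [Fintype D] [DecidableEq D] (ε : ℝ)
    (ρ : Matrix ((K × K) × D) ((K × K) × D) ℂ) : Prop :=
  traceDist ρ (idealKey K ⊗ₖ traceLeft ρ) ≤ ε

/-- `ℓ_secr^ε(X;B|E)_ψ`, the largest number `n` of `ε`-good secret key bits that can be distilled;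
it is `∞` if arbitrarily long keys can be distilled. -/
def keyLength [DecidableEq B] [DecidableEq E] (r : Processing) (ε : ℝ)
    (ψ : CQState X (B × E)) : EReal :=
  ⨆ (n : ℕ) (m : ℕ) (Q : Protocol r X B (Fin n → Bool) (Fin m)) (_ : IsGoodKey ε (Q.output ψ)),
    ((n : ℝ) : EReal)

end

end SKD

/-!
The lower bound combines two random hash functions of `U`: one, published together with `V`, lets
Bob recover `U`; the other is the key. The upper bound takes for `(U, V)` the key and the message
of a good protocol.

*Bob.* For unnormalized states `ω u` with sum `τ`, the projector onto the positive part of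
`√(ω u) - √(c τ)` separates `ω u` from `c τ` with total error at most `√c tr (√(ω u) √τ)`
(`exists_test`). Feeding these projectors into the square-root measurement, bounded by the
Hayashi–Nagaoka inequality `hayashi_nagaoka`, and averaging over a random function to `M` values
gives a decoder with error about `2 √(2 / M) ∑ u, tr (√(ω u) √τ)` (`exists_hash_decoder`), where the
sum is bounded by the fidelity that defines the max-entropy. To smooth this estimate, Uhlmann's
theorem is used for the nearby state `ρ'`: writing `ρ u = R u (R u)†` for the blocks of the actual
state, there are operators `S u` whose overlap `∑ u, tr ((R u)† S u)` is the fidelity, with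
`ω u = S u (S u)†` below the blocks of `ρ'` (`exists_blocks_of_fidelity`). Cauchy–Schwarz then shows
that the measurement errs on the actual state with a probability larger by at most the purification
distance `ε₁` (`sum_test_le_of_overlap`).

*Eve.* Uhlmann operators `S u` for Eve's state are used for privacy amplification
(`exists_extractor`): with `F` the overlap, the operators `F R u (S u)†` differ from the ensemble
`R u (R u)†` by at most `√(1 - F²)` in trace norm, while their second moment relative to `σ` is
bounded through `S u (S u)† ≤ t σ`, which is the bound on the min-entropy. For a random key function
the second moments of the deviation from a uniform key add up, as the values at distinct points are
independent. The published hash is a further index of the deviation, so that Cauchy–Schwarz costs a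
factor `2 ^ n M` and a key of `n` bits is secret when `2 ^ n M t < 4 ε₂²`. With `M` of order
`h / ε₂²`, where `h` bounds the squared fidelity for Bob, this is the claimed length
(`exists_protocol_of_mem_ball`).

*Upper bound.* Let `U` be Alice's key and `V` the message of an `ε`-good protocol. By pinching,
`ψ^{UEV}` has trace distance at most `ε` from a state with a uniform and independent key, whose
min-entropy is `n` (`Protocol.logb_card_le_hMinSmooth`). Bob's measurement defines an operator `L`
with `tr (L ρ) ≥ 1 - ε`, and the state `√L ρ √L` has fidelity at least `1 - ε` with `ρ` and fidelity
at most one with every `1 ⊗ σ`, hence a max-entropy that is not positive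
(`Protocol.hMaxSmooth_nonpos`). Fidelity `1 - ε` means purification distance at most `√(2 ε)`.

All states involved are classical on `U`, `V`, the key and the message, and are handled as families
of blocks. For `ε₁ + ε₁' + 2 ε₂ ≥ 1`, where the lower bound may be `∞`, constant keys of any length
are good enough (`keyLength_eq_top`).
-/

namespace SKD

open Matrix

/-! ### Hilbert–Schmidt norm, square roots and trace norm -/

section Trace

variable {d m n : Type*} [Fintype d] [Fintype m] [Fintype n]

theorem PosSemidef.trace_re_nonneg {A : Matrix d d ℂ} (h : A.PosSemidef) : 0 ≤ A.trace.re :=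
  (Complex.le_def.mp h.trace_nonneg).1

theorem PosSemidef.trace_eq_re {A : Matrix d d ℂ} (h : A.PosSemidef) :
    A.trace = (A.trace.re : ℂ) :=
  Complex.ext rfl (by simpa using ((Complex.le_def.mp h.trace_nonneg).2).symm)

/-- The squared Hilbert–Schmidt norm `tr (A† A)`. -/
noncomputable def hs (A : Matrix m n ℂ) : ℝ := (Aᴴ * A).trace.re

theorem hs_eq_sum (A : Matrix m n ℂ) : hs A = ∑ j, ∑ i, ‖A i j‖ ^ 2 := by
  simp only [hs, trace, diag_apply, mul_apply, conjTranspose_apply, Complex.re_sum]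
  refine Finset.sum_congr rfl fun j _ => Finset.sum_congr rfl fun i _ => ?_
  rw [← Complex.normSq_eq_norm_sq, Complex.normSq_apply]
  simp

theorem hs_nonneg (A : Matrix m n ℂ) : 0 ≤ hs A :=
  PosSemidef.trace_re_nonneg (posSemidef_conjTranspose_mul_self A)

theorem hs_eq_trace_mul_conjTranspose (A : Matrix m n ℂ) : hs A = (A * Aᴴ).trace.re := by
  rw [hs, trace_mul_comm]

theorem hs_conjTranspose (A : Matrix m n ℂ) : hs Aᴴ = hs A := by
  rw [hs_eq_trace_mul_conjTranspose A, hs, conjTranspose_conjTranspose]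

theorem re_trace_conjTranspose_mul_comm (A B : Matrix m n ℂ) :
    (Bᴴ * A).trace.re = (Aᴴ * B).trace.re := by
  have h : Bᴴ * A = (Aᴴ * B)ᴴ := by simp
  rw [h, trace_conjTranspose]
  simp

theorem hs_sub (A B : Matrix m n ℂ) :
    hs (A - B) = hs A - 2 * (Aᴴ * B).trace.re + hs B := by
  simp only [hs, conjTranspose_sub, Matrix.sub_mul, Matrix.mul_sub, trace_sub, Complex.sub_re]
  rw [re_trace_conjTranspose_mul_comm A B]
  ring

theorem hs_smul (c : ℝ) (A : Matrix m n ℂ) : hs ((c : ℂ) • A) = c ^ 2 * hs A := by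
  simp only [hs_eq_sum, Matrix.smul_apply, smul_eq_mul, norm_mul, mul_pow, Finset.mul_sum,
    Complex.norm_real, Real.norm_eq_abs, sq_abs]

/-- Cauchy–Schwarz for the Hilbert–Schmidt inner product. -/
theorem re_trace_mul_le_sqrt_hs (A B : Matrix m n ℂ) :
    (Aᴴ * B).trace.re ≤ √(hs A) * √(hs B) := by
  have key : ∀ c : ℝ, 0 ≤ hs B * (c * c) + (-2 * (Aᴴ * B).trace.re) * c + hs A := fun c => by
    have h := hs_nonneg (A - (c : ℂ) • B)
    rw [hs_sub, hs_smul, Matrix.mul_smul, trace_smul, smul_eq_mul, Complex.re_ofReal_mul] at h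
    nlinarith
  have h := discrim_le_zero key
  rw [discrim] at h
  rw [← Real.sqrt_mul (hs_nonneg A)]
  exact Real.le_sqrt_of_sq_le (by nlinarith)

/-- Cauchy–Schwarz for families of matrices. -/
theorem sum_re_trace_mul_le_sqrt_hs {ι : Type*} (s : Finset ι) (A B : ι → Matrix m n ℂ) :
    ∑ i ∈ s, ((A i)ᴴ * B i).trace.re ≤ √(∑ i ∈ s, hs (A i)) * √(∑ i ∈ s, hs (B i)) :=
  (Finset.sum_le_sum fun i _ => re_trace_mul_le_sqrt_hs (A i) (B i)).trans
    (Real.sum_sqrt_mul_sqrt_le s (fun _ => hs_nonneg _) (fun _ => hs_nonneg _))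

theorem re_trace_mono {A B : Matrix d d ℂ} (h : A ≤ B) : A.trace.re ≤ B.trace.re := by
  have := PosSemidef.trace_re_nonneg (le_iff.mp h)
  rw [trace_sub, Complex.sub_re] at this
  linarith

theorem conj_mono {A B : Matrix d d ℂ} (h : A ≤ B) (C : Matrix m d ℂ) :
    C * A * Cᴴ ≤ C * B * Cᴴ := by
  rw [le_iff] at h ⊢
  rw [← Matrix.sub_mul, ← Matrix.mul_sub]
  exact h.mul_mul_conjTranspose_same C

variable [DecidableEq d]

theorem hs_mul_le_of_contraction (A : Matrix m d ℂ) {T : Matrix d d ℂ} (hT : T * Tᴴ ≤ 1) :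
    hs (A * T) ≤ hs A := by
  rw [hs_eq_trace_mul_conjTranspose, hs_eq_trace_mul_conjTranspose]
  have h := re_trace_mono (conj_mono hT A)
  rw [conjTranspose_mul]
  simpa [Matrix.mul_assoc] using h

theorem sqrt_posSemidef (A : Matrix d d ℂ) : (CFC.sqrt A).PosSemidef :=
  nonneg_iff_posSemidef.mp (CFC.sqrt_nonneg A)

theorem sqrt_mul_sqrt {A : Matrix d d ℂ} (h : A.PosSemidef) : CFC.sqrt A * CFC.sqrt A = A :=
  CFC.sqrt_mul_sqrt_self A (nonneg_iff_posSemidef.mpr h)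

theorem sqrt_conjTranspose (A : Matrix d d ℂ) : (CFC.sqrt A)ᴴ = CFC.sqrt A :=
  (sqrt_posSemidef A).isHermitian

theorem hs_sqrt {A : Matrix d d ℂ} (h : A.PosSemidef) : hs (CFC.sqrt A) = A.trace.re := by
  rw [hs, sqrt_conjTranspose, sqrt_mul_sqrt h]

open scoped Matrix.Norms.L2Operator in
theorem sqrt_mono {A B : Matrix d d ℂ} (h : A ≤ B) : CFC.sqrt A ≤ CFC.sqrt B :=
  CFC.sqrt_le_sqrt A B h

theorem re_trace_mul_nonneg {A B : Matrix d d ℂ} (hA : A.PosSemidef) (hB : B.PosSemidef) :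
    0 ≤ (A * B).trace.re := by
  have h := PosSemidef.trace_re_nonneg (hB.mul_mul_conjTranspose_same (CFC.sqrt A))
  rwa [trace_mul_comm, ← Matrix.mul_assoc, sqrt_conjTranspose, sqrt_mul_sqrt hA] at h

theorem re_trace_mul_mono {A B C : Matrix d d ℂ} (hC : C.PosSemidef) (h : A ≤ B) :
    (C * A).trace.re ≤ (C * B).trace.re := by
  have := re_trace_mul_nonneg hC (le_iff.mp h)
  rw [Matrix.mul_sub, trace_sub, Complex.sub_re] at this
  linarith

theorem conjTranspose_mul_self_le_of_mul_conjTranspose_self_le [DecidableEq m] [DecidableEq n]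
    {A : Matrix m n ℂ} {t : ℝ}
    (ht : 0 < t) (h : A * Aᴴ ≤ (t : ℂ) • 1) : Aᴴ * A ≤ (t : ℂ) • 1 := by
  have htc : (0 : ℂ) < t := by exact_mod_cast ht
  have hm : ((t : ℂ) • (1 : Matrix m m ℂ)).PosDef := PosDef.one.smul htc
  have hn : (1 : Matrix n n ℂ).PosDef := PosDef.one
  have inv_m : ((t : ℂ) • (1 : Matrix m m ℂ))⁻¹ = ((t : ℂ)⁻¹) • 1 := by
    refine inv_eq_left_inv ?_
    rw [Matrix.smul_mul, Matrix.one_mul, smul_smul, inv_mul_cancel₀ htc.ne', one_smul]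
  have := hm.isUnit.invertible
  have := hn.isUnit.invertible
  -- Both inequalities say that the block matrix with off-diagonal block `A` and diagonal blocks
  -- `t`, `1` is positive.
  have h1 := (PosDef.fromBlocks₂₂ ((t : ℂ) • (1 : Matrix m m ℂ)) A hn).mpr (by
    simpa [le_iff] using h)
  have h2 := ((PosDef.fromBlocks₁₁ A (1 : Matrix n n ℂ) hm).mp h1).smul htc.le
  have h3 : (t : ℂ) • ((1 : Matrix n n ℂ) - Aᴴ * ((t : ℂ) • (1 : Matrix m m ℂ))⁻¹ * A) =
      (t : ℂ) • 1 - Aᴴ * A := by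
    rw [inv_m, smul_sub, Matrix.mul_smul, Matrix.mul_one, Matrix.smul_mul, smul_smul,
      mul_inv_cancel₀ htc.ne', one_smul]
  rw [le_iff, ← h3]
  exact h2

end Trace

section TraceNorm

variable {d : Type*} [Fintype d] [DecidableEq d]

theorem continuousOn_spectrum (A : Matrix d d ℂ) (f : ℝ → ℝ) :
    ContinuousOn f (spectrum ℝ A) := by
  rw [continuousOn_iff_continuous_domRestrict]; fun_prop

theorem cfc_mul_cfc (A : Matrix d d ℂ) (f g : ℝ → ℝ) :
    cfc f A * cfc g A = cfc (fun x => f x * g x) A :=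
  (cfc_mul f g A (continuousOn_spectrum A f) (continuousOn_spectrum A g)).symm

theorem cfc_conjTranspose (A : Matrix d d ℂ) (f : ℝ → ℝ) : (cfc f A)ᴴ = cfc f A :=
  (cfc_predicate f A : IsSelfAdjoint (cfc f A))

theorem cfc_re_le {A : Matrix d d ℂ} {f g : ℝ → ℝ} (h : ∀ x ∈ spectrum ℝ A, f x ≤ g x) :
    cfc f A ≤ cfc g A :=
  cfc_mono h (continuousOn_spectrum A f) (continuousOn_spectrum A g)

theorem nonneg_of_mem_spectrum {A : Matrix d d ℂ} (hA : A.PosSemidef) {x : ℝ}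
    (hx : x ∈ spectrum ℝ A) : 0 ≤ x :=
  spectrum_nonneg_of_nonneg (nonneg_iff_posSemidef.mpr hA) hx

/-- Polar decomposition: `A = T† |A|` for a contraction `T` with `tr (T A) = ‖A‖₁`. -/
theorem exists_polar (A : Matrix d d ℂ) : ∃ T : Matrix d d ℂ, T * Tᴴ ≤ 1 ∧
    T * A = CFC.sqrt (Aᴴ * A) ∧ A = Tᴴ * CFC.sqrt (Aᴴ * A) := by
  have hH : (Aᴴ * A).PosSemidef := posSemidef_conjTranspose_mul_self A
  set H := Aᴴ * A with hHdef
  have hHs : IsSelfAdjoint H := hH.isHermitian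
  -- the pseudo-inverse of `√H`; the junk value `0⁻¹ = 0` is what is wanted on the kernel
  set G := cfc (fun x : ℝ => (√x)⁻¹) H with hG
  have hid : H = cfc (fun x : ℝ => x) H := (cfc_id' ℝ H hHs).symm
  have hone : (1 : Matrix d d ℂ) = cfc (fun _ : ℝ => 1) H := (cfc_const_one ℝ H hHs).symm
  have hsq : CFC.sqrt H = cfc Real.sqrt H := by
    rw [CFC.sqrt_eq_real_sqrt H (nonneg_iff_posSemidef.mpr hH),
      cfcₙ_eq_cfc (hf := Set.Finite.continuousOn (by
        rw [quasispectrum_eq_spectrum_union_zero]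
        exact (Matrix.finite_real_spectrum).union (Set.finite_singleton 0)) _)
        (hf0 := Real.sqrt_zero)]
  have hGs : Gᴴ = G := cfc_conjTranspose H _
  have hGH : G * H = CFC.sqrt H := by
    have h1 := cfc_mul_cfc H (fun x : ℝ => (√x)⁻¹) (fun x => x)
    rw [← hid, ← hG] at h1
    rw [h1, hsq]
    refine cfc_congr fun x hx => ?_
    have h0 := nonneg_of_mem_spectrum hH hx
    rcases h0.eq_or_lt with rfl | h0
    · simp
    · have := Real.sqrt_pos.mpr h0
      field_simp
      exact (Real.sq_sqrt h0.le).symm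
  have hsG : CFC.sqrt H * G = cfc (fun x : ℝ => √x * (√x)⁻¹) H := by
    rw [hsq, hG, cfc_mul_cfc]
  have hGsH : G * CFC.sqrt H = cfc (fun x : ℝ => (√x)⁻¹ * √x) H := by
    rw [hsq, hG, cfc_mul_cfc]
  refine ⟨G * Aᴴ, ?_, ?_, ?_⟩
  · have : G * Aᴴ * (G * Aᴴ)ᴴ = CFC.sqrt H * G := by
      rw [conjTranspose_mul, conjTranspose_conjTranspose, hGs, ← hGH, hHdef]
      simp only [Matrix.mul_assoc]
    rw [this, hsG, hone]
    refine cfc_re_le fun x _ => ?_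
    rcases eq_or_ne (√x) 0 with h | h
    · simp [h]
    · simp [h]
  · rw [Matrix.mul_assoc, ← hHdef, hGH]
  · rw [conjTranspose_mul, conjTranspose_conjTranspose, hGs, Matrix.mul_assoc, hGsH]
    set Q := cfc (fun x : ℝ => (√x)⁻¹ * √x) H with hQ
    have hQs : Qᴴ = Q := cfc_conjTranspose H _
    have hHQ : H * Q = H := by
      have h1 := cfc_mul_cfc H (fun x => x) (fun x : ℝ => (√x)⁻¹ * √x)
      rw [← hid, ← hQ] at h1
      rw [h1]
      conv_rhs => rw [hid]
      refine cfc_congr fun x hx => ?_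
      have h0 := nonneg_of_mem_spectrum hH hx
      rcases h0.eq_or_lt with rfl | h0
      · simp
      · have := Real.sqrt_pos.mpr h0
        field_simp
    have hz : (A - A * Q)ᴴ * (A - A * Q) = 0 := by
      have : (A - A * Q)ᴴ * (A - A * Q) = (H - H * Q) - Q * (H - H * Q) := by
        rw [conjTranspose_sub, conjTranspose_mul, hQs, hHdef]
        noncomm_ring
      rw [this, hHQ]
      simp
    exact sub_eq_zero.mp (conjTranspose_mul_self_eq_zero.mp hz)

/-- One half of the variational characterization of the trace norm. -/
theorem re_trace_mul_le_traceNorm (A : Matrix d d ℂ) {S : Matrix d d ℂ} (hS : S * Sᴴ ≤ 1) :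
    (S * A).trace.re ≤ traceNorm A := by
  obtain ⟨T, hT, -, hA⟩ := exists_polar A
  set P := CFC.sqrt (Aᴴ * A) with hP
  have hPpos : P.PosSemidef := sqrt_posSemidef _
  set Q := CFC.sqrt P
  have hQ : Q * Q = P := sqrt_mul_sqrt hPpos
  have hQs : Qᴴ = Q := sqrt_conjTranspose P
  have h1 : (S * A).trace = ((Q * S)ᴴᴴ * (Tᴴ * Q)).trace := by
    rw [conjTranspose_conjTranspose, hA, ← hQ]
    simp only [← Matrix.mul_assoc]
    rw [trace_mul_comm]
    simp only [← Matrix.mul_assoc]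
  have hQtr : hs Q = traceNorm A := by rw [hs, hQs, hQ]; rfl
  have h2 : hs (Q * S)ᴴ ≤ traceNorm A := by
    rw [hs_conjTranspose, ← hQtr]
    exact hs_mul_le_of_contraction Q hS
  have h3 : hs (Tᴴ * Q) ≤ traceNorm A := by
    rw [← hs_conjTranspose, conjTranspose_mul, conjTranspose_conjTranspose, hQs, ← hQtr]
    exact hs_mul_le_of_contraction Q hT
  have h0 : 0 ≤ traceNorm A := hQtr ▸ hs_nonneg Q
  rw [h1]
  calc _ ≤ _ := re_trace_mul_le_sqrt_hs _ _
    _ ≤ √(traceNorm A) * √(traceNorm A) := by gcongr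
    _ = traceNorm A := Real.mul_self_sqrt h0

theorem re_trace_le_traceNorm (A : Matrix d d ℂ) : A.trace.re ≤ traceNorm A := by
  have h := re_trace_mul_le_traceNorm A (S := 1) (by simp)
  rwa [Matrix.one_mul] at h

theorem traceNorm_nonneg (A : Matrix d d ℂ) : 0 ≤ traceNorm A :=
  PosSemidef.trace_re_nonneg (sqrt_posSemidef _)

/-- The other half of the variational characterization: the supremum is attained. -/
theorem exists_contraction_trace_eq (A : Matrix d d ℂ) : ∃ T : Matrix d d ℂ, T * Tᴴ ≤ 1 ∧
    (T * A).trace = (traceNorm A : ℂ) := by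
  obtain ⟨T, hT, hA, -⟩ := exists_polar A
  exact ⟨T, hT, by rw [hA]; exact PosSemidef.trace_eq_re (sqrt_posSemidef _)⟩

theorem traceNorm_le_of_forall {A : Matrix d d ℂ} {c : ℝ}
    (h : ∀ T : Matrix d d ℂ, T * Tᴴ ≤ 1 → (T * A).trace.re ≤ c) : traceNorm A ≤ c := by
  obtain ⟨T, hT, hA⟩ := exists_contraction_trace_eq A
  have := h T hT
  rwa [hA, Complex.ofReal_re] at this

theorem traceNorm_add_le (A B : Matrix d d ℂ) :
    traceNorm (A + B) ≤ traceNorm A + traceNorm B :=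
  traceNorm_le_of_forall fun T hT => by
    rw [Matrix.mul_add, trace_add, Complex.add_re]
    exact add_le_add (re_trace_mul_le_traceNorm A hT) (re_trace_mul_le_traceNorm B hT)

theorem traceNorm_zero : traceNorm (0 : Matrix d d ℂ) = 0 :=
  le_antisymm (traceNorm_le_of_forall fun T _ => by simp) (traceNorm_nonneg _)

theorem traceNorm_sum_le {ι : Type*} (s : Finset ι) (A : ι → Matrix d d ℂ) :
    traceNorm (∑ i ∈ s, A i) ≤ ∑ i ∈ s, traceNorm (A i) :=
  Finset.le_sum_of_subadditive _ traceNorm_zero.le traceNorm_add_le s A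

theorem traceNorm_neg (A : Matrix d d ℂ) : traceNorm (-A) = traceNorm A := by
  simp [traceNorm]

theorem traceNorm_sub_le (A B : Matrix d d ℂ) :
    traceNorm (A - B) ≤ traceNorm A + traceNorm B := by
  rw [sub_eq_add_neg, ← traceNorm_neg B]
  exact traceNorm_add_le A (-B)

theorem traceNorm_smul_le {c : ℝ} (hc : 0 ≤ c) (A : Matrix d d ℂ) :
    traceNorm ((c : ℂ) • A) ≤ c * traceNorm A :=
  traceNorm_le_of_forall fun T hT => by
    rw [Matrix.mul_smul, trace_smul, smul_eq_mul, Complex.re_ofReal_mul]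
    exact mul_le_mul_of_nonneg_left (re_trace_mul_le_traceNorm A hT) hc

theorem traceNorm_posSemidef {A : Matrix d d ℂ} (h : A.PosSemidef) :
    traceNorm A = A.trace.re := by
  rw [traceNorm, h.isHermitian.eq, CFC.sqrt_mul_self A (nonneg_iff_posSemidef.mpr h)]

theorem traceNorm_mul_le (A B : Matrix d d ℂ) : traceNorm (A * B) ≤ √(hs A) * √(hs B) :=
  traceNorm_le_of_forall fun T hT => by
    have h1 : (T * (A * B)).trace = (Aᴴᴴ * (B * T)).trace := by
      rw [conjTranspose_conjTranspose, trace_mul_comm, Matrix.mul_assoc]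
    rw [h1]
    refine (re_trace_mul_le_sqrt_hs _ _).trans ?_
    rw [hs_conjTranspose]
    gcongr
    exact hs_mul_le_of_contraction B hT

/-- The trace norm of `A` depends on `A† A` only. -/
theorem traceNorm_congr {A B : Matrix d d ℂ} (h : Aᴴ * A = Bᴴ * B) :
    traceNorm A = traceNorm B := by
  rw [traceNorm, traceNorm, h]

end TraceNorm

/-! ### Block-diagonal operators and fidelity -/

section Blocks

variable {a b : Type*}

/-- The block `(⟨i| ⊗ 1) M (|i⟩ ⊗ 1)` of an operator on a tensor product. -/
def diagBlock (M : Matrix (a × b) (a × b) ℂ) (i : a) : Matrix b b ℂ :=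
  M.submatrix (Prod.mk i) (Prod.mk i)

/-- The operator `∑ i, |i⟩⟨i| ⊗ A i`. -/
def blockDiag [DecidableEq a] (A : a → Matrix b b ℂ) : Matrix (a × b) (a × b) ℂ :=
  of fun p q => if p.1 = q.1 then A p.1 p.2 q.2 else 0

theorem blockDiag_apply [DecidableEq a] (A : a → Matrix b b ℂ) (p q : a × b) :
    blockDiag A p q = if p.1 = q.1 then A p.1 p.2 q.2 else 0 := rfl

theorem diagBlock_apply (M : Matrix (a × b) (a × b) ℂ) (i : a) (x y : b) :
    diagBlock M i x y = M (i, x) (i, y) := rfl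

theorem diagBlock_blockDiag [DecidableEq a] (A : a → Matrix b b ℂ) (i : a) :
    diagBlock (blockDiag A) i = A i := by
  ext x y; simp [diagBlock_apply, blockDiag_apply]

theorem diagBlock_conjTranspose (M : Matrix (a × b) (a × b) ℂ) (i : a) :
    diagBlock Mᴴ i = (diagBlock M i)ᴴ := rfl

theorem blockDiag_conjTranspose [DecidableEq a] (A : a → Matrix b b ℂ) :
    (blockDiag A)ᴴ = blockDiag fun i => (A i)ᴴ := by
  ext p q
  simp only [conjTranspose_apply, blockDiag_apply, eq_comm (a := q.1)]
  split_ifs with h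
  · rw [h]
  · simp

theorem blockDiag_one [DecidableEq a] [DecidableEq b] :
    blockDiag (fun _ : a => (1 : Matrix b b ℂ)) = 1 := by
  ext p q
  simp only [blockDiag_apply, one_apply, Prod.ext_iff]
  split_ifs <;> simp_all

theorem one_kronecker_eq_blockDiag [DecidableEq a] (τ : Matrix b b ℂ) :
    (1 : Matrix a a ℂ) ⊗ₖ τ = blockDiag fun _ => τ := by
  ext p q
  simp [blockDiag_apply, one_apply]

theorem diagBlock_mono {M N : Matrix (a × b) (a × b) ℂ} (h : M ≤ N) (i : a) :
    diagBlock M i ≤ diagBlock N i := by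
  rw [le_iff] at h ⊢
  exact h.submatrix (Prod.mk i)

theorem diagBlock_posSemidef {M : Matrix (a × b) (a × b) ℂ} (h : M.PosSemidef) (i : a) :
    (diagBlock M i).PosSemidef := h.submatrix (Prod.mk i)

theorem diagBlock_one [DecidableEq a] [DecidableEq b] (i : a) :
    diagBlock (1 : Matrix (a × b) (a × b) ℂ) i = 1 := by
  rw [← blockDiag_one, diagBlock_blockDiag]

theorem blockDiag_sub [DecidableEq a] (A B : a → Matrix b b ℂ) :
    blockDiag A - blockDiag B = blockDiag fun i => A i - B i := by
  ext p q
  simp only [Matrix.sub_apply, blockDiag_apply]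
  split_ifs <;> simp

theorem traceLeft_eq_sum_diagBlock [Fintype a] (M : Matrix (a × b) (a × b) ℂ) :
    traceLeft M = ∑ i, diagBlock M i := by
  ext x y
  simp [traceLeft, diagBlock_apply, Matrix.sum_apply]

variable [Fintype a] [Fintype b]

theorem trace_eq_sum_diagBlock (M : Matrix (a × b) (a × b) ℂ) :
    M.trace = ∑ i, (diagBlock M i).trace := by
  simp [trace, diagBlock_apply, Fintype.sum_prod_type]

variable [DecidableEq a]

theorem diagBlock_blockDiag_mul (A : a → Matrix b b ℂ) (M : Matrix (a × b) (a × b) ℂ) (i : a) :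
    diagBlock (blockDiag A * M) i = A i * diagBlock M i := by
  ext x y
  simp [diagBlock_apply, mul_apply, blockDiag_apply, Fintype.sum_prod_type]

theorem diagBlock_mul_blockDiag (A : a → Matrix b b ℂ) (M : Matrix (a × b) (a × b) ℂ) (i : a) :
    diagBlock (M * blockDiag A) i = diagBlock M i * A i := by
  ext x y
  simp only [diagBlock_apply, mul_apply, blockDiag_apply, Fintype.sum_prod_type]
  rw [Finset.sum_eq_single i (fun j _ hj => by simp [hj]) (by simp)]
  simp

theorem blockDiag_mul (A B : a → Matrix b b ℂ) :
    blockDiag A * blockDiag B = blockDiag fun i => A i * B i := by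
  ext p q
  simp only [mul_apply, blockDiag_apply, Fintype.sum_prod_type]
  by_cases h : p.1 = q.1
  · simp [h]
  · simp [h]

theorem trace_blockDiag_mul (A : a → Matrix b b ℂ) (M : Matrix (a × b) (a × b) ℂ) :
    (blockDiag A * M).trace = ∑ i, (A i * diagBlock M i).trace := by
  rw [trace_eq_sum_diagBlock]
  simp only [diagBlock_blockDiag_mul]

theorem blockDiag_posSemidef [DecidableEq b] {A : a → Matrix b b ℂ}
    (h : ∀ i, (A i).PosSemidef) : (blockDiag A).PosSemidef := by
  have : blockDiag A =
      (blockDiag fun i => CFC.sqrt (A i))ᴴ * blockDiag fun i => CFC.sqrt (A i) := by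
    rw [blockDiag_conjTranspose, blockDiag_mul]
    congr 1
    funext i
    rw [sqrt_conjTranspose, sqrt_mul_sqrt (h i)]
  rw [this]
  exact posSemidef_conjTranspose_mul_self _

theorem sqrt_blockDiag [DecidableEq b] {A : a → Matrix b b ℂ} (h : ∀ i, (A i).PosSemidef) :
    CFC.sqrt (blockDiag A) = blockDiag fun i => CFC.sqrt (A i) := by
  refine CFC.sqrt_unique ?_ (nonneg_iff_posSemidef.mpr ?_)
  · rw [blockDiag_mul]
    congr 1
    funext i
    exact sqrt_mul_sqrt (h i)
  · exact blockDiag_posSemidef fun i => sqrt_posSemidef _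

theorem blockDiag_mono [DecidableEq b] {A B : a → Matrix b b ℂ} (h : ∀ i, A i ≤ B i) :
    blockDiag A ≤ blockDiag B := by
  rw [le_iff, blockDiag_sub]
  exact blockDiag_posSemidef h

/-- The other blocks of the `i`-th row of `S` only add positive terms to the right-hand side. -/
theorem diagBlock_mul_conjTranspose_le (S : Matrix (a × b) (a × b) ℂ) (i : a) :
    diagBlock S i * (diagBlock S i)ᴴ ≤ diagBlock (S * Sᴴ) i := by
  rw [le_iff]
  have : diagBlock (S * Sᴴ) i - diagBlock S i * (diagBlock S i)ᴴ =
      ∑ j ∈ Finset.univ.erase i, S.submatrix (Prod.mk i) (Prod.mk j) *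
        (S.submatrix (Prod.mk i) (Prod.mk j))ᴴ := by
    rw [sub_eq_iff_eq_add, add_comm]
    have h2 : diagBlock (S * Sᴴ) i = ∑ j, S.submatrix (Prod.mk i) (Prod.mk j) *
        (S.submatrix (Prod.mk i) (Prod.mk j))ᴴ := by
      ext x y
      simp [diagBlock_apply, mul_apply, Fintype.sum_prod_type, Matrix.sum_apply]
    rw [h2, ← Finset.add_sum_erase _ _ (Finset.mem_univ i)]
    rfl
  rw [this]
  exact posSemidef_sum _ fun j _ => posSemidef_self_mul_conjTranspose _

variable [DecidableEq b]

theorem traceNorm_blockDiag_le (A : a → Matrix b b ℂ) :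
    traceNorm (blockDiag A) ≤ ∑ i, traceNorm (A i) :=
  traceNorm_le_of_forall fun T hT => by
    rw [trace_mul_comm, trace_blockDiag_mul, Complex.re_sum]
    refine Finset.sum_le_sum fun i _ => ?_
    rw [trace_mul_comm]
    refine re_trace_mul_le_traceNorm _ ?_
    calc _ ≤ _ := diagBlock_mul_conjTranspose_le T i
      _ ≤ _ := diagBlock_mono hT i
      _ = 1 := diagBlock_one i

/-- Pinching does not increase the trace norm. -/
theorem sum_traceNorm_diagBlock_le (M : Matrix (a × b) (a × b) ℂ) :
    ∑ i, traceNorm (diagBlock M i) ≤ traceNorm M := by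
  choose T hT hM using fun i => exists_contraction_trace_eq (diagBlock M i)
  have h1 : blockDiag T * (blockDiag T)ᴴ ≤ 1 := by
    rw [blockDiag_conjTranspose, blockDiag_mul, ← blockDiag_one]
    exact blockDiag_mono hT
  refine le_trans (le_of_eq ?_) (re_trace_mul_le_traceNorm M h1)
  rw [trace_blockDiag_mul, Complex.re_sum]
  exact Finset.sum_congr rfl fun i _ => by rw [hM, Complex.ofReal_re]

end Blocks

section Fidelity

variable {d : Type*} [Fintype d] [DecidableEq d]

theorem conjTranspose_mul_self_le_one {T : Matrix d d ℂ} (hT : T * Tᴴ ≤ 1) : Tᴴ * T ≤ 1 := by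
  simpa using conjTranspose_mul_self_le_of_mul_conjTranspose_self_le (A := T) (t := 1) one_pos
    (by simpa using hT)

theorem traceNorm_conjTranspose_mul_le (A : Matrix d d ℂ) {T : Matrix d d ℂ} (hT : T * Tᴴ ≤ 1) :
    traceNorm (Tᴴ * A) ≤ traceNorm A :=
  traceNorm_le_of_forall fun R hR => by
    rw [← Matrix.mul_assoc]
    refine re_trace_mul_le_traceNorm A ?_
    rw [conjTranspose_mul, conjTranspose_conjTranspose]
    calc R * Tᴴ * (T * Rᴴ) = R * (Tᴴ * T) * Rᴴ := by simp only [Matrix.mul_assoc]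
      _ ≤ R * 1 * Rᴴ := conj_mono (conjTranspose_mul_self_le_one hT) R
      _ ≤ 1 := by simpa using hR

/-- The fidelity may be computed from any square root `X` of the first argument. -/
theorem traceNorm_conjTranspose_mul_sqrt (X τ : Matrix d d ℂ) :
    traceNorm (Xᴴ * CFC.sqrt τ) = fidelity (X * Xᴴ) τ := by
  refine traceNorm_congr ?_
  simp only [conjTranspose_mul, conjTranspose_conjTranspose, sqrt_conjTranspose]
  have h := sqrt_mul_sqrt (posSemidef_self_mul_conjTranspose X)
  calc CFC.sqrt τ * X * (Xᴴ * CFC.sqrt τ) = CFC.sqrt τ * (X * Xᴴ) * CFC.sqrt τ := by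
        simp only [Matrix.mul_assoc]
    _ = _ := by
        conv_lhs => rw [← h]
        simp only [Matrix.mul_assoc]

theorem re_trace_sqrt_mul_sqrt_le_fidelity (ρ σ : Matrix d d ℂ) :
    (CFC.sqrt ρ * CFC.sqrt σ).trace.re ≤ fidelity ρ σ :=
  re_trace_le_traceNorm _

theorem one_sub_fidelity_sq_le {ε : ℝ} {ρ σ : Matrix d d ℂ} (h : purifDist ρ σ ≤ ε) :
    1 - fidelity ρ σ ^ 2 ≤ ε ^ 2 := by
  have h0 : 0 ≤ ε := (Real.sqrt_nonneg _).trans h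
  exact (Real.sqrt_le_left h0).mp h

variable {a b : Type*} [Fintype a] [Fintype b] [DecidableEq a] [DecidableEq b]

/-- Uhlmann's theorem for a state `ρ = ∑ u, |u⟩⟨u| ⊗ ρ u` that is classical on the first factor:
an arbitrary state `ρ'` can be replaced by the blocks `S u (S u)†`. They are dominated by the blocks
of `ρ'`, the overlap of `S` with the square root of `ρ` is the fidelity of `ρ` and `ρ'`, and their
overlap with `1 ⊗ τ` is at most the fidelity of `ρ'` and `1 ⊗ τ`. -/
theorem exists_blocks_of_fidelity {ρ : a → Matrix b b ℂ} (hρ : ∀ u, (ρ u).PosSemidef)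
    {ρ' : Matrix (a × b) (a × b) ℂ} (hρ' : IsSubnormalized ρ') :
    ∃ S : a → Matrix b b ℂ,
      ∑ u, (CFC.sqrt (ρ u) * S u).trace.re = fidelity (blockDiag ρ) ρ' ∧
      ∑ u, hs (S u) ≤ 1 ∧
      (∀ u, S u * (S u)ᴴ ≤ diagBlock ρ' u) ∧
      ∀ τ : Matrix b b ℂ, τ.PosSemidef →
        ∑ u, (CFC.sqrt (S u * (S u)ᴴ) * CFC.sqrt τ).trace.re
          ≤ fidelity ρ' ((1 : Matrix a a ℂ) ⊗ₖ τ) := by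
  obtain ⟨T, hT, htr⟩ := exists_contraction_trace_eq (CFC.sqrt (blockDiag ρ) * CFC.sqrt ρ')
  set S := CFC.sqrt ρ' * T with hS
  have hSS : S * Sᴴ ≤ ρ' := by
    rw [hS, conjTranspose_mul, sqrt_conjTranspose]
    calc CFC.sqrt ρ' * T * (Tᴴ * CFC.sqrt ρ')
        = CFC.sqrt ρ' * (T * Tᴴ) * (CFC.sqrt ρ')ᴴ := by
          rw [sqrt_conjTranspose]; simp only [Matrix.mul_assoc]
      _ ≤ CFC.sqrt ρ' * 1 * (CFC.sqrt ρ')ᴴ := conj_mono hT _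
      _ = ρ' := by rw [Matrix.mul_one, sqrt_conjTranspose, sqrt_mul_sqrt hρ'.1]
  have hblock : ∀ u, diagBlock S u * (diagBlock S u)ᴴ ≤ diagBlock ρ' u := fun u =>
    (diagBlock_mul_conjTranspose_le S u).trans (diagBlock_mono hSS u)
  refine ⟨diagBlock S, ?_, ?_, hblock, fun τ hτ => ?_⟩
  · rw [← Complex.re_sum, ← trace_blockDiag_mul, ← sqrt_blockDiag hρ, hS, ← Matrix.mul_assoc,
      trace_mul_comm, htr, Complex.ofReal_re]
    rfl
  · calc ∑ u, hs (diagBlock S u) ≤ ∑ u, (diagBlock ρ' u).trace.re :=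
        Finset.sum_le_sum fun u _ => by
          rw [hs_eq_trace_mul_conjTranspose]
          exact re_trace_mono (hblock u)
      _ = ρ'.trace.re := by rw [trace_eq_sum_diagBlock, Complex.re_sum]
      _ ≤ 1 := hρ'.2
  · have h1 : CFC.sqrt ((1 : Matrix a a ℂ) ⊗ₖ τ) = blockDiag fun _ => CFC.sqrt τ := by
      rw [one_kronecker_eq_blockDiag, sqrt_blockDiag fun _ => hτ]
    calc ∑ u, (CFC.sqrt (diagBlock S u * (diagBlock S u)ᴴ) * CFC.sqrt τ).trace.re
        ≤ ∑ u, traceNorm ((diagBlock S u)ᴴ * CFC.sqrt τ) :=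
          Finset.sum_le_sum fun u _ => by
            rw [traceNorm_conjTranspose_mul_sqrt]
            exact re_trace_sqrt_mul_sqrt_le_fidelity _ _
      _ = ∑ u, traceNorm (diagBlock (Sᴴ * CFC.sqrt ((1 : Matrix a a ℂ) ⊗ₖ τ)) u) :=
          Finset.sum_congr rfl fun u _ => by
            rw [h1, diagBlock_mul_blockDiag, diagBlock_conjTranspose]
      _ ≤ traceNorm (Sᴴ * CFC.sqrt ((1 : Matrix a a ℂ) ⊗ₖ τ)) := sum_traceNorm_diagBlock_le _
      _ ≤ fidelity ρ' ((1 : Matrix a a ℂ) ⊗ₖ τ) := by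
          rw [hS, conjTranspose_mul, sqrt_conjTranspose, Matrix.mul_assoc]
          exact traceNorm_conjTranspose_mul_le _ hT

end Fidelity

/-! ### Tests and operator inequalities -/

section Tests

variable {d : Type*} [Fintype d] [DecidableEq d]

theorem mul_self_le_self {P : Matrix d d ℂ} (h0 : P.PosSemidef) (h1 : P ≤ 1) : P * P ≤ P := by
  have h := conj_mono h1 (CFC.sqrt P)
  rw [Matrix.mul_one, sqrt_conjTranspose, sqrt_mul_sqrt h0] at h
  calc P * P = CFC.sqrt P * (CFC.sqrt P * CFC.sqrt P) * CFC.sqrt P := by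
        conv_lhs => rw [← sqrt_mul_sqrt h0]
        simp only [Matrix.mul_assoc]
    _ ≤ P := by rwa [sqrt_mul_sqrt h0]

/-- The projector onto the positive part of `√ρ - √ω` tests `ρ` against `ω` with total error at
most `tr (√ρ √ω)`. -/
theorem exists_test {ρ ω : Matrix d d ℂ} (hρ : ρ.PosSemidef) (hω : ω.PosSemidef) :
    ∃ P : Matrix d d ℂ, P.PosSemidef ∧ P ≤ 1 ∧
      (ρ * (1 - P)).trace.re + (ω * P).trace.re ≤ (CFC.sqrt ρ * CFC.sqrt ω).trace.re := by
  set A := CFC.sqrt ρ with hA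
  set B := CFC.sqrt ω with hB
  have hAp : A.PosSemidef := sqrt_posSemidef ρ
  have hBp : B.PosSemidef := sqrt_posSemidef ω
  have hAA : A * A = ρ := sqrt_mul_sqrt hρ
  have hBB : B * B = ω := sqrt_mul_sqrt hω
  set D := A - B with hD
  have hDs : IsSelfAdjoint D := hAp.isHermitian.sub hBp.isHermitian
  set P := cfc (fun x : ℝ => if 0 < x then (1 : ℝ) else 0) D with hP
  set N := cfc (fun x : ℝ => max x 0) D with hN
  set N' := cfc (fun x : ℝ => max (-x) 0) D with hN'
  have hid : D = cfc (fun x : ℝ => x) D := (cfc_id' ℝ D hDs).symm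
  have hone : (1 : Matrix d d ℂ) = cfc (fun _ : ℝ => 1) D := (cfc_const_one ℝ D hDs).symm
  have hNp : N.PosSemidef :=
    nonneg_iff_posSemidef.mp (cfc_nonneg fun x _ => le_max_right x 0)
  have hNp' : N'.PosSemidef :=
    nonneg_iff_posSemidef.mp (cfc_nonneg fun x _ => le_max_right (-x) 0)
  have hDP : D * P = N := by
    have h1 := cfc_mul_cfc D (fun x => x) (fun x : ℝ => if 0 < x then (1 : ℝ) else 0)
    rw [← hid, ← hP] at h1
    rw [h1, hN]
    refine cfc_congr fun x _ => ?_
    split_ifs with h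
    · rw [max_eq_left h.le, mul_one]
    · rw [max_eq_right (not_lt.mp h), mul_zero]
  have hPD : P * D = N := by
    have h1 := cfc_mul_cfc D (fun x : ℝ => if 0 < x then (1 : ℝ) else 0) (fun x => x)
    rw [← hid, ← hP] at h1
    rw [h1, hN]
    refine cfc_congr fun x _ => ?_
    split_ifs with h
    · rw [max_eq_left h.le, one_mul]
    · rw [max_eq_right (not_lt.mp h), zero_mul]
  have hNN : D = N - N' := by
    have h1 := cfc_sub (fun x : ℝ => max x 0) (fun x : ℝ => max (-x) 0) D
      (continuousOn_spectrum D _) (continuousOn_spectrum D _)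
    rw [← hN, ← hN'] at h1
    rw [← h1]
    conv_lhs => rw [hid]
    refine cfc_congr fun x _ => ?_
    rcases le_total 0 x with h | h
    · simp [h]
    · simp [h]
  refine ⟨P, nonneg_iff_posSemidef.mp (cfc_nonneg fun x _ => ?_), ?_, ?_⟩
  · split_ifs <;> norm_num
  · rw [hone]
    refine cfc_re_le fun x _ => ?_
    split_ifs <;> norm_num
  · -- the difference of the two sides is `-(tr A N' + tr B N)`
    have e1 : ρ * (1 - P) + ω * P = A * B - A * N' - D * B * P := by
      have e2 : N' = D * P - D := by rw [hDP, hNN]; abel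
      have e3 : D = A - B := rfl
      rw [e2, ← hAA, ← hBB, e3]
      noncomm_ring
    have e3 := congrArg (fun M => (Matrix.trace M).re) e1
    simp only [trace_add, trace_sub, Complex.add_re, Complex.sub_re] at e3
    rw [trace_mul_comm (D * B), ← Matrix.mul_assoc, hPD] at e3
    have h1 := re_trace_mul_nonneg hAp hNp'
    have h2 := re_trace_mul_nonneg hNp hBp
    linarith

/-- A test distinguishes two operators of equal trace by at most their trace distance. -/
theorem re_trace_mul_sub_le_traceDist {ρ σ P : Matrix d d ℂ} (h : ρ.trace = σ.trace)
    (h0 : P.PosSemidef) (h1 : P ≤ 1) : (P * (ρ - σ)).trace.re ≤ traceDist ρ σ := by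
  have hc : ((2 : ℂ) • P - 1) * ((2 : ℂ) • P - 1)ᴴ ≤ 1 := by
    have hs : ((2 : ℂ) • P - 1)ᴴ = (2 : ℂ) • P - 1 := by
      simp [conjTranspose_smul, h0.isHermitian.eq]
    rw [hs, le_iff]
    have := (le_iff.mp (mul_self_le_self h0 h1)).smul (a := (4 : ℂ)) (by norm_num)
    convert this using 1
    simp only [Matrix.sub_mul, Matrix.mul_sub, Matrix.smul_mul, Matrix.mul_smul, Matrix.one_mul,
      Matrix.mul_one]
    module
  have := re_trace_mul_le_traceNorm (ρ - σ) hc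
  rw [Matrix.sub_mul, trace_sub, smul_mul, trace_smul, Matrix.one_mul, trace_sub ρ, h, sub_self,
    sub_zero, smul_eq_mul, show (2 : ℂ) = ((2 : ℝ) : ℂ) by norm_num, Complex.re_ofReal_mul] at this
  rw [traceDist]
  linarith

/-- One of the Fuchs–van de Graaf inequalities. -/
theorem one_sub_traceDist_le_fidelity {ρ σ : Matrix d d ℂ} (hρ : IsDensity ρ)
    (hσ : IsDensity σ) : 1 - traceDist ρ σ ≤ fidelity ρ σ := by
  obtain ⟨P, h0, h1, h⟩ := exists_test hρ.1 hσ.1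
  have h2 := re_trace_mul_sub_le_traceDist (hρ.2.trans hσ.2.symm) h0 h1
  have h3 := re_trace_sqrt_mul_sqrt_le_fidelity ρ σ
  rw [Matrix.mul_sub, trace_sub, Complex.sub_re, trace_mul_comm P, trace_mul_comm P] at h2
  rw [Matrix.mul_sub, trace_sub, Complex.sub_re, Matrix.mul_one, hρ.2, Complex.one_re] at h
  linarith

theorem purifDist_le_sqrt_two_mul {ρ σ : Matrix d d ℂ} {ε : ℝ} (h : 1 - ε ≤ fidelity ρ σ) :
    purifDist ρ σ ≤ √(2 * ε) := by
  refine Real.sqrt_le_sqrt ?_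
  nlinarith [sq_nonneg (1 - fidelity ρ σ)]

theorem inv_sqrt_identities {D : Matrix d d ℂ} (hD : D.PosDef) :
    ((CFC.sqrt D)⁻¹)ᴴ = (CFC.sqrt D)⁻¹ ∧ CFC.sqrt D * (CFC.sqrt D)⁻¹ = 1 ∧
      (CFC.sqrt D)⁻¹ * D = CFC.sqrt D ∧ D * (CFC.sqrt D)⁻¹ = CFC.sqrt D := by
  set Y := CFC.sqrt D with hY
  have hYY : Y * Y = D := sqrt_mul_sqrt hD.posSemidef
  have hYu : IsUnit Y.det := by
    have : IsUnit (Y.det * Y.det) := by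
      rw [← det_mul, hYY, ← isUnit_iff_isUnit_det]
      exact hD.isUnit
    exact isUnit_of_mul_isUnit_left this
  have hXY : Y⁻¹ * Y = 1 := nonsing_inv_mul Y hYu
  have hYX : Y * Y⁻¹ = 1 := mul_nonsing_inv Y hYu
  refine ⟨by rw [conjTranspose_nonsing_inv, hY, sqrt_conjTranspose], hYX, ?_, ?_⟩
  · rw [← hYY, ← Matrix.mul_assoc, hXY, Matrix.one_mul]
  · rw [← hYY, Matrix.mul_assoc, hYX, Matrix.mul_one]

/-- The Hayashi–Nagaoka operator inequality, for an invertible sum `P + T`. -/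
theorem hayashi_nagaoka {P T : Matrix d d ℂ} (hP : P.PosSemidef) (hP1 : P ≤ 1)
    (hT : T.PosDef) :
    1 - (CFC.sqrt (P + T))⁻¹ * P * (CFC.sqrt (P + T))⁻¹ ≤ (2 : ℂ) • (1 - P) + (4 : ℂ) • T := by
  have hD : (P + T).PosDef := hT.posSemidef_add hP
  set D := P + T with hDdef
  obtain ⟨hXs, hYX, hXD, hDX⟩ := inv_sqrt_identities hD
  set Y := CFC.sqrt D with hY
  set X := Y⁻¹ with hX
  have hPY : P ≤ Y := by
    have h1 : P * P ≤ D := (mul_self_le_self hP hP1).trans (by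
      rw [le_iff, hDdef, add_sub_cancel_left]; exact hT.posSemidef)
    have h2 := sqrt_mono h1
    rwa [CFC.sqrt_mul_self P (nonneg_iff_posSemidef.mpr hP)] at h2
  -- the sum of the positive operators `(X - 2) T (X - 2)`, `2 (X - 1) P (X - 1)` and `4 (√D - P)`
  have p1 : ((X - (2 : ℂ) • 1) * T * (X - (2 : ℂ) • 1)ᴴ).PosSemidef :=
    hT.posSemidef.mul_mul_conjTranspose_same _
  have p2 : ((2 : ℂ) • ((X - 1) * P * (X - 1)ᴴ)).PosSemidef :=
    (hP.mul_mul_conjTranspose_same _).smul (by norm_num)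
  have p3 : ((4 : ℂ) • (Y - P)).PosSemidef := (le_iff.mp hPY).smul (by norm_num)
  have p := (p1.add p2).add p3
  have hT' : T = D - P := by rw [hDdef, add_sub_cancel_left]
  have e1 : (X - (2 : ℂ) • (1 : Matrix d d ℂ))ᴴ = X - (2 : ℂ) • 1 := by
    simp [conjTranspose_smul, hXs]
  have e2 : (X - (1 : Matrix d d ℂ))ᴴ = X - 1 := by simp [hXs]
  have key : (2 : ℂ) • (1 - P) + (4 : ℂ) • T - (1 - X * P * X) =
      (X - (2 : ℂ) • 1) * T * (X - (2 : ℂ) • 1)ᴴ + (2 : ℂ) • ((X - 1) * P * (X - 1)ᴴ)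
        + (4 : ℂ) • (Y - P) := by
    rw [e1, e2, hT']
    simp only [Matrix.sub_mul, Matrix.mul_sub, Matrix.smul_mul, Matrix.mul_smul, Matrix.one_mul,
      Matrix.mul_one, hYX, hXD, hDX]
    module
  rw [le_iff, key]
  exact p

end Tests

section Smoothing

/-- If the binary distributions `(p, 1 - p)` and `(q, 1 - q)` have Bhattacharyya coefficient at
least `F`, then `p` and `q` differ by at most `√(1 - F²)`. -/
theorem sub_le_of_bhattacharyya {p q F e : ℝ} (hp0 : 0 ≤ p) (hp1 : p ≤ 1) (hq0 : 0 ≤ q)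
    (hq1 : q ≤ 1) (hF : 0 ≤ F) (h : F ≤ √p * √q + √(1 - p) * √(1 - q)) (he : 0 ≤ e)
    (hFe : 1 - F ^ 2 ≤ e ^ 2) : p - q ≤ e := by
  have hp := Real.sq_sqrt hp0
  have hq := Real.sq_sqrt hq0
  have hp' := Real.sq_sqrt (sub_nonneg.mpr hp1)
  have hq' := Real.sq_sqrt (sub_nonneg.mpr hq1)
  have n1 := Real.sqrt_nonneg p
  have n2 := Real.sqrt_nonneg q
  have n3 := Real.sqrt_nonneg (1 - p)
  have n4 := Real.sqrt_nonneg (1 - q)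
  generalize √p = a at *
  generalize √q = b at *
  generalize √(1 - p) = c at *
  generalize √(1 - q) = d at *
  -- `p - q = x y` with `x² ≤ 1 - F²` and `y ≤ 1`
  have hx : (a * d - c * b) ^ 2 ≤ e ^ 2 := by
    have e1 : (a * b + c * d) ^ 2 + (a * d - c * b) ^ 2 = (a ^ 2 + c ^ 2) * (b ^ 2 + d ^ 2) := by
      ring
    rw [hp, hq, hp', hq'] at e1
    have : F ^ 2 ≤ (a * b + c * d) ^ 2 := pow_le_pow_left₀ hF h 2
    nlinarith
  have hy : a * d + c * b ≤ 1 := by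
    nlinarith [sq_nonneg (a - d), sq_nonneg (c - b)]
  have hxy : p - q = (a * d - c * b) * (a * d + c * b) := by
    have : (a * d - c * b) * (a * d + c * b) = a ^ 2 * d ^ 2 - c ^ 2 * b ^ 2 := by ring
    rw [this, hp, hq, hp', hq']; ring
  have hx' : a * d - c * b ≤ e := (abs_le_of_sq_le_sq' hx he).2
  have hy0 : 0 ≤ a * d + c * b := by positivity
  rw [hxy]
  nlinarith

variable {a b : Type*} [Fintype a] [Fintype b] [DecidableEq b]

/-- A test accepts the ensemble `R u (R u)†` with almost the probability with which it accepts
`S u (S u)†`, if the overlap of the two purifications is close to one. -/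
theorem sum_test_le_of_overlap {R S P : a → Matrix b b ℂ} {e : ℝ} (he : 0 ≤ e)
    (hR : ∑ u, hs (R u) = 1) (hS : ∑ u, hs (S u) ≤ 1)
    (hF0 : 0 ≤ ∑ u, ((R u)ᴴ * S u).trace.re)
    (hF : 1 - (∑ u, ((R u)ᴴ * S u).trace.re) ^ 2 ≤ e ^ 2)
    (hP0 : ∀ u, (P u).PosSemidef) (hP1 : ∀ u, P u ≤ 1) :
    ∑ u, (R u * (R u)ᴴ * P u).trace.re ≤ ∑ u, (S u * (S u)ᴴ * P u).trace.re + e := by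
  have hP1' : ∀ u, (1 - P u).PosSemidef := hP1
  have hsq : ∀ (Q : Matrix b b ℂ), Q.PosSemidef → ∀ A B : Matrix b b ℂ,
      (CFC.sqrt Q * A)ᴴ * (CFC.sqrt Q * B) = Aᴴ * Q * B := fun Q hQ A B => by
    rw [conjTranspose_mul, sqrt_conjTranspose]
    conv_rhs => rw [← sqrt_mul_sqrt hQ]
    simp only [Matrix.mul_assoc]
  have hhs : ∀ (Q : Matrix b b ℂ), Q.PosSemidef → ∀ A : Matrix b b ℂ,
      hs (CFC.sqrt Q * A) = (A * Aᴴ * Q).trace.re := fun Q hQ A => by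
    rw [hs, hsq Q hQ, Matrix.mul_assoc, trace_mul_comm, Matrix.mul_assoc, trace_mul_comm]
  set p := ∑ u, (R u * (R u)ᴴ * P u).trace.re with hp
  set q := ∑ u, (S u * (S u)ᴴ * P u).trace.re with hq
  have hcompl : ∀ A : a → Matrix b b ℂ, ∑ u, hs (CFC.sqrt (1 - P u) * A u) =
      ∑ u, hs (A u) - ∑ u, (A u * (A u)ᴴ * P u).trace.re := fun A => by
    rw [← Finset.sum_sub_distrib]
    refine Finset.sum_congr rfl fun u _ => ?_
    rw [hhs _ (hP1' u), Matrix.mul_sub, trace_sub, Complex.sub_re, Matrix.mul_one,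
      hs_eq_trace_mul_conjTranspose]
  have hp' : ∑ u, hs (CFC.sqrt (P u) * R u) = p :=
    Finset.sum_congr rfl fun u _ => hhs _ (hP0 u) _
  have hq' : ∑ u, hs (CFC.sqrt (P u) * S u) = q :=
    Finset.sum_congr rfl fun u _ => hhs _ (hP0 u) _
  have hpc := hcompl R
  have hqc := hcompl S
  rw [← hp, hR] at hpc
  rw [← hq] at hqc
  have hp0 : 0 ≤ p := hp' ▸ Finset.sum_nonneg fun u _ => hs_nonneg _
  have hq0 : 0 ≤ q := hq' ▸ Finset.sum_nonneg fun u _ => hs_nonneg _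
  have hp1 : 0 ≤ 1 - p := hpc ▸ Finset.sum_nonneg fun u _ => hs_nonneg _
  have hq1 : 0 ≤ ∑ u, hs (S u) - q := hqc ▸ Finset.sum_nonneg fun u _ => hs_nonneg _
  have hcs : ∑ u, ((R u)ᴴ * S u).trace.re ≤ √p * √q + √(1 - p) * √(1 - q) := by
    have h1 := sum_re_trace_mul_le_sqrt_hs Finset.univ (fun u => CFC.sqrt (P u) * R u)
      (fun u => CFC.sqrt (P u) * S u)
    have h2 := sum_re_trace_mul_le_sqrt_hs Finset.univ (fun u => CFC.sqrt (1 - P u) * R u)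
      (fun u => CFC.sqrt (1 - P u) * S u)
    rw [hp', hq'] at h1
    rw [hpc, hqc] at h2
    have h3 : √(∑ u, hs (S u) - q) ≤ √(1 - q) := Real.sqrt_le_sqrt (by linarith)
    have h4 : ∑ u, ((R u)ᴴ * S u).trace.re =
        ∑ u, ((CFC.sqrt (P u) * R u)ᴴ * (CFC.sqrt (P u) * S u)).trace.re +
        ∑ u, ((CFC.sqrt (1 - P u) * R u)ᴴ * (CFC.sqrt (1 - P u) * S u)).trace.re := by
      rw [← Finset.sum_add_distrib]
      refine Finset.sum_congr rfl fun u _ => ?_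
      rw [hsq _ (hP0 u), hsq _ (hP1' u), ← Complex.add_re, ← trace_add]
      congr 2
      noncomm_ring
    rw [h4]
    refine add_le_add h1 (h2.trans ?_)
    gcongr
  have := sub_le_of_bhattacharyya hp0 (by linarith) hq0 (by linarith) hF0 hcs he hF
  linarith

end Smoothing

/-! ### Random hashing with quantum side information -/

section RandomFunctions

variable {U α : Type*} [Fintype U] [DecidableEq U] [Fintype α]

/-- The values of a uniformly random function at two distinct points are independent. -/
theorem sum_functions_mul [Nonempty α] {u u' : U} (h : u ≠ u') (φ χ : α → ℝ) :
    ∑ f : U → α, φ (f u) * χ (f u') =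
      Fintype.card (U → α) * ((∑ x, φ x) / Fintype.card α * ((∑ x, χ x) / Fintype.card α)) := by
  have hc : (Fintype.card α : ℝ) ≠ 0 := by exact_mod_cast Fintype.card_ne_zero
  set ψ : U → α → ℝ := fun w x => (if w = u then φ x else 1) * (if w = u' then χ x else 1)
  have h1 : ∀ f : U → α, ∏ w, ψ w (f w) = φ (f u) * χ (f u') := fun f => by
    simp only [ψ, Finset.prod_mul_distrib, Finset.prod_ite_eq', Finset.mem_univ, if_true]
  have h2 : ∀ w, ∑ x, ψ w x = Fintype.card α * ((if w = u then (∑ x, φ x) / Fintype.card α else 1) *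
      (if w = u' then (∑ x, χ x) / Fintype.card α else 1)) := fun w => by
    by_cases hu : w = u
    · have hu' : w ≠ u' := hu ▸ h
      simp only [ψ, if_pos hu, if_neg hu', mul_one]
      field_simp
    · by_cases hu' : w = u'
      · simp only [ψ, if_neg hu, if_pos hu', one_mul]
        field_simp
      · simp [ψ, if_neg hu, if_neg hu']
  have h3 := Finset.prod_univ_sum (fun _ : U => (Finset.univ : Finset α)) ψ
  rw [Fintype.piFinset_univ] at h3
  simp only [h1, h2] at h3
  rw [← h3, Finset.prod_mul_distrib, Finset.prod_mul_distrib]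
  simp

/-- Two distinct points collide under a random function with probability `1 / |α|`. -/
theorem sum_functions_collision [DecidableEq α] [Nonempty α] {u u' : U} (h : u ≠ u') :
    ∑ f : U → α, (if f u' = f u then (1 : ℝ) else 0) =
      Fintype.card (U → α) * (1 / Fintype.card α) := by
  have hc : (Fintype.card α : ℝ) ≠ 0 := by exact_mod_cast Fintype.card_ne_zero
  have h1 : ∀ f : U → α, (if f u' = f u then (1 : ℝ) else 0) =
      ∑ c, (if f u = c then (1 : ℝ) else 0) * (if f u' = c then 1 else 0) := fun f => by
    simp [eq_comm]
  simp only [h1]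
  rw [Finset.sum_comm]
  have h2 : ∀ c : α, ∑ x : α, (if x = c then (1 : ℝ) else 0) = 1 := fun c => by simp
  have h3 : ∀ c : α, ∑ f : U → α, (if f u = c then (1 : ℝ) else 0) * (if f u' = c then 1 else 0) =
      Fintype.card (U → α) * (1 / Fintype.card α * (1 / Fintype.card α)) := fun c => by
    rw [sum_functions_mul h (fun x => if x = c then (1 : ℝ) else 0)
      (fun x => if x = c then (1 : ℝ) else 0), h2]
  simp only [h3, Finset.sum_const, Finset.card_univ, nsmul_eq_mul]
  field_simp

theorem exists_le_of_sum_le_card_mul {ι : Type*} [Fintype ι] [Nonempty ι] {G : ι → ℝ} {c : ℝ}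
    (h : ∑ f, G f ≤ Fintype.card ι * c) : ∃ f, G f ≤ c := by
  obtain ⟨f, -, hf⟩ := Finset.exists_le_of_sum_le (s := Finset.univ) (f := G) (g := fun _ => c)
    Finset.univ_nonempty (by simpa using h)
  exact ⟨f, hf⟩

end RandomFunctions

section Compression

variable {U b : Type*} [Fintype U] [DecidableEq U] [Fintype b] [DecidableEq b]

theorem sqrt_smul {τ : Matrix b b ℂ} (hτ : τ.PosSemidef) {c : ℝ} (hc : 0 ≤ c) :
    CFC.sqrt ((c : ℂ) • τ) = ((√c : ℝ) : ℂ) • CFC.sqrt τ := by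
  refine CFC.sqrt_unique ?_ (nonneg_iff_posSemidef.mpr ((sqrt_posSemidef τ).smul ?_))
  · rw [Matrix.smul_mul, Matrix.mul_smul, smul_smul, sqrt_mul_sqrt hτ, ← Complex.ofReal_mul,
      Real.mul_self_sqrt hc]
  · exact_mod_cast Real.sqrt_nonneg c

/-- Compression with quantum side information: if `u` is hashed by a random function to one of `M`
values, it can be recovered from the hash and the side information `ρ u`, up to a small error. -/
theorem exists_hash_decoder {ρ : U → Matrix b b ℂ} (hρ : ∀ u, (ρ u).PosSemidef) (M : ℕ)
    [NeZero M] {δ : ℝ} (hδ : 0 < δ) :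
    ∃ (f : U → Fin M) (D : Fin M → U → Matrix b b ℂ), (∀ c u, (D c u).PosSemidef) ∧
      (∀ c, ∑ u, D c u ≤ 1) ∧
      ∑ u, (ρ u * (1 - D (f u) u)).trace.re ≤
        2 * √(2 / M) * ∑ u, (CFC.sqrt (ρ u) * CFC.sqrt (∑ u', ρ u')).trace.re
          + 4 * δ * ∑ u, (ρ u).trace.re := by
  set τ := ∑ u', ρ u' with hτdef
  have hτ : τ.PosSemidef := posSemidef_sum _ fun u _ => hρ u
  have hM : (0 : ℝ) < M := by exact_mod_cast Nat.pos_of_ne_zero (NeZero.ne M)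
  have hM2 : (0 : ℝ) ≤ 2 / M := by positivity
  have hω : ((((2 / M : ℝ)) : ℂ) • τ).PosSemidef := hτ.smul (by exact_mod_cast hM2)
  -- the factor `2 / M` balances the weights `2` and `4 / M` of the two errors in `havg` below
  choose P hP0 hP1 hP using fun u => exists_test (hρ u) hω
  have hδc : (0 : ℂ) < (δ : ℂ) := by exact_mod_cast hδ
  have hδ1 : ((δ : ℂ) • (1 : Matrix b b ℂ)).PosDef := PosDef.one.smul hδc
  -- the unnormalized measurement operators compatible with the hash `c`, regularized by `δ`
  set N : (U → Fin M) → Fin M → Matrix b b ℂ := fun f c =>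
    ∑ u ∈ Finset.univ.filter (fun u => f u = c), P u + (δ : ℂ) • 1 with hN
  have hNpos : ∀ f c, (N f c).PosDef := fun f c =>
    hδ1.posSemidef_add (posSemidef_sum _ fun u _ => hP0 u)
  set X : (U → Fin M) → Fin M → Matrix b b ℂ := fun f c => (CFC.sqrt (N f c))⁻¹ with hX
  set D : (U → Fin M) → Fin M → U → Matrix b b ℂ := fun f c u =>
    if f u = c then X f c * P u * X f c else 0 with hD
  have hXs : ∀ f c, (X f c)ᴴ = X f c := fun f c => (inv_sqrt_identities (hNpos f c)).1
  have hD0 : ∀ f c u, (D f c u).PosSemidef := fun f c u => by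
    simp only [hD]
    split_ifs
    · have := (hP0 u).mul_mul_conjTranspose_same (X f c)
      rwa [hXs] at this
    · exact PosSemidef.zero
  have hD1 : ∀ f c, ∑ u, D f c u ≤ 1 := fun f c => by
    have h1 : ∑ u, D f c u =
        X f c * (∑ u ∈ Finset.univ.filter (fun u => f u = c), P u) * (X f c)ᴴ := by
      rw [hXs, Matrix.mul_sum, Matrix.sum_mul, Finset.sum_filter]
    have h2 : (∑ u ∈ Finset.univ.filter (fun u => f u = c), P u) ≤ N f c := by
      rw [le_iff, hN, add_sub_cancel_left]
      exact hδ1.posSemidef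
    rw [h1]
    refine (conj_mono h2 _).trans (le_of_eq ?_)
    obtain ⟨-, h3, h4, -⟩ := inv_sqrt_identities (hNpos f c)
    rw [hXs]
    simp only [hX]
    rw [h4, h3]
  -- the error of a fixed hash function
  set y : U → U → ℝ := fun u u' => (ρ u * P u').trace.re with hy
  have hy0 : ∀ u u', 0 ≤ y u u' := fun u u' => re_trace_mul_nonneg (hρ u) (hP0 u')
  have herr : ∀ f u, (ρ u * (1 - D f (f u) u)).trace.re ≤
      2 * (ρ u * (1 - P u)).trace.re +
        4 * ∑ u' ∈ Finset.univ.erase u, (if f u' = f u then 1 else 0) * y u u' +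
        4 * δ * (ρ u).trace.re := fun f u => by
    set T : Matrix b b ℂ := ∑ u' ∈ Finset.univ.erase u, (if f u' = f u then P u' else 0) +
      (δ : ℂ) • 1 with hT
    have hTpos : T.PosDef := hδ1.posSemidef_add (posSemidef_sum _ fun u' _ => by
      split_ifs
      · exact hP0 u'
      · exact PosSemidef.zero)
    have hPT : P u + T = N f (f u) := by
      rw [hT, ← add_assoc]
      simp only [hN]
      rw [Finset.sum_filter, ← Finset.add_sum_erase _ _ (Finset.mem_univ u),
        if_pos rfl]
    have h1 := hayashi_nagaoka (hP0 u) (hP1 u) hTpos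
    rw [hPT] at h1
    have h2 := re_trace_mul_mono (hρ u) h1
    have h3 : D f (f u) u = (CFC.sqrt (N f (f u)))⁻¹ * P u * (CFC.sqrt (N f (f u)))⁻¹ := by
      simp [hD, hX]
    rw [h3]
    refine h2.trans (le_of_eq ?_)
    have h4 : (ρ u * T).trace.re =
        ∑ u' ∈ Finset.univ.erase u, (if f u' = f u then 1 else 0) * y u u' +
          δ * (ρ u).trace.re := by
      rw [hT, Matrix.mul_add, trace_add, Complex.add_re, Matrix.mul_sum, trace_sum, Complex.re_sum,
        Matrix.mul_smul, trace_smul, Matrix.mul_one, smul_eq_mul, Complex.re_ofReal_mul]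
      congr 1
      refine Finset.sum_congr rfl fun u' _ => ?_
      split_ifs <;> simp [hy]
    rw [Matrix.mul_add, Matrix.mul_smul, Matrix.mul_smul, trace_add, trace_smul, trace_smul,
      Complex.add_re, smul_eq_mul, smul_eq_mul, show (2 : ℂ) = ((2 : ℝ) : ℂ) by norm_num,
      show (4 : ℂ) = ((4 : ℝ) : ℂ) by norm_num, Complex.re_ofReal_mul, Complex.re_ofReal_mul, h4]
    ring
  -- averaging over the hash function
  have havg : ∑ f : U → Fin M, ∑ u, (ρ u * (1 - D f (f u) u)).trace.re ≤
      (Fintype.card (U → Fin M) : ℝ) *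
        (2 * √(2 / M) * ∑ u, (CFC.sqrt (ρ u) * CFC.sqrt τ).trace.re
          + 4 * δ * ∑ u, (ρ u).trace.re) := by
    set C : ℝ := (Fintype.card (U → Fin M) : ℝ) with hC
    have hC0 : 0 ≤ C := Nat.cast_nonneg _
    calc _ ≤ ∑ f : U → Fin M, ∑ u, (2 * (ρ u * (1 - P u)).trace.re +
          4 * ∑ u' ∈ Finset.univ.erase u, (if f u' = f u then 1 else 0) * y u u' +
          4 * δ * (ρ u).trace.re) :=
          Finset.sum_le_sum fun f _ => Finset.sum_le_sum fun u _ => herr f u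
      _ = ∑ u, C * (2 * (ρ u * (1 - P u)).trace.re +
          4 * ∑ u' ∈ Finset.univ.erase u, 1 / M * y u u' + 4 * δ * (ρ u).trace.re) := by
          rw [Finset.sum_comm]
          refine Finset.sum_congr rfl fun u _ => ?_
          rw [Finset.sum_add_distrib, Finset.sum_add_distrib, ← Finset.mul_sum Finset.univ _ 4,
            Finset.sum_comm]
          have : ∀ u' ∈ Finset.univ.erase u,
              ∑ f : U → Fin M, (if f u' = f u then (1 : ℝ) else 0) * y u u' =
                C * (1 / M * y u u') := fun u' hu' => by
            rw [← Finset.sum_mul, sum_functions_collision (Finset.ne_of_mem_erase hu').symm,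
              Fintype.card_fin, mul_assoc]
          rw [Finset.sum_congr rfl this, ← Finset.mul_sum _ _ C]
          simp only [Finset.sum_const, Finset.card_univ, nsmul_eq_mul, ← hC]
          ring
      _ ≤ ∑ u, C * (2 * (ρ u * (1 - P u)).trace.re + 4 * ∑ u', 1 / M * y u u' +
          4 * δ * (ρ u).trace.re) := by
          refine Finset.sum_le_sum fun u _ => mul_le_mul_of_nonneg_left ?_ hC0
          have : ∑ u' ∈ Finset.univ.erase u, 1 / M * y u u' ≤ ∑ u', 1 / M * y u u' :=
            Finset.sum_le_sum_of_subset_of_nonneg (Finset.erase_subset _ _)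
              fun u' _ _ => mul_nonneg (by positivity) (hy0 u u')
          linarith
      _ = C * (2 * ∑ u, ((ρ u * (1 - P u)).trace.re +
            ((((2 / M : ℝ)) : ℂ) • τ * P u).trace.re) + 4 * δ * ∑ u, (ρ u).trace.re) := by
          have h1 : ∑ u, ((((2 / M : ℝ)) : ℂ) • τ * P u).trace.re =
              2 / M * ∑ u, ∑ u', y u u' := by
            rw [Finset.sum_comm, Finset.mul_sum]
            refine Finset.sum_congr rfl fun u _ => ?_
            rw [Matrix.smul_mul, trace_smul, smul_eq_mul, Complex.re_ofReal_mul, hτdef,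
              Matrix.sum_mul, trace_sum, Complex.re_sum]
          have h2 : ∑ u, 4 * ∑ u', 1 / M * y u u' = 4 / M * ∑ u, ∑ u', y u u' := by
            simp only [Finset.mul_sum]
            refine Finset.sum_congr rfl fun u _ => Finset.sum_congr rfl fun u' _ => ?_
            ring
          rw [← Finset.mul_sum, Finset.sum_add_distrib, Finset.sum_add_distrib,
            Finset.sum_add_distrib, h1, h2, ← Finset.mul_sum, ← Finset.mul_sum]
          ring
      _ ≤ _ := by
          refine mul_le_mul_of_nonneg_left ?_ hC0
          refine add_le_add_left ?_ _
          rw [mul_assoc]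
          refine mul_le_mul_of_nonneg_left ?_ zero_le_two
          rw [Finset.mul_sum]
          refine Finset.sum_le_sum fun u _ => (hP u).trans (le_of_eq ?_)
          rw [sqrt_smul hτ hM2, Matrix.mul_smul, trace_smul, smul_eq_mul, Complex.re_ofReal_mul]
  obtain ⟨f, hf⟩ := exists_le_of_sum_le_card_mul havg
  exact ⟨f, D f, hD0 f, hD1 f, hf⟩

end Compression

/-! ### Privacy amplification -/

section Amplification

variable {U K C b : Type*} [Fintype U] [Fintype K] [DecidableEq C]

theorem hs_sum_smul [Fintype b] (c : U → ℝ) (B : U → Matrix b b ℂ) :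
    hs (∑ u, (c u : ℂ) • B u) = ∑ u, ∑ u', c u * c u' * ((B u)ᴴ * B u').trace.re := by
  rw [hs, conjTranspose_sum, Matrix.sum_mul, trace_sum, Complex.re_sum]
  simp only [Matrix.mul_sum, trace_sum, Complex.re_sum]
  refine Finset.sum_congr rfl fun u _ => Finset.sum_congr rfl fun u' _ => ?_
  rw [conjTranspose_smul, Matrix.smul_mul, Matrix.mul_smul, trace_smul, trace_smul, smul_eq_mul,
    smul_eq_mul, Complex.star_def, Complex.conj_ofReal, Complex.re_ofReal_mul,
    Complex.re_ofReal_mul]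
  ring

/-- Independent centred coefficients make the cross terms of the second moment vanish. -/
theorem sum_functions_hs [DecidableEq U] [Nonempty K] [Fintype b] {φ : K → ℝ}
    (hφ : ∑ x, φ x = 0) (B : U → Matrix b b ℂ) :
    ∑ g : U → K, hs (∑ u, (φ (g u) : ℂ) • B u) = ∑ g : U → K, ∑ u, φ (g u) ^ 2 * hs (B u) := by
  have h : ∀ u u' : U, ∑ g : U → K, φ (g u) * φ (g u') * ((B u)ᴴ * B u').trace.re =
      if u = u' then ∑ g : U → K, φ (g u) ^ 2 * hs (B u) else 0 := fun u u' => by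
    split_ifs with h
    · subst h
      refine Finset.sum_congr rfl fun g _ => ?_
      rw [← sq, hs]
    · rw [← Finset.sum_mul, sum_functions_mul h, hφ]
      simp
  simp only [hs_sum_smul]
  rw [Finset.sum_comm]
  calc _ = ∑ u, ∑ u', ∑ g : U → K, φ (g u) * φ (g u') * ((B u)ᴴ * B u').trace.re :=
        Finset.sum_congr rfl fun u _ => Finset.sum_comm
    _ = ∑ u, ∑ g : U → K, φ (g u) ^ 2 * hs (B u) := by simp only [h]; simp
    _ = _ := Finset.sum_comm

variable [DecidableEq K]

/-- The deviation of the indicator of `x = k` from the uniform distribution. -/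
noncomputable def keyDev (k x : K) : ℝ := (if x = k then 1 else 0) - 1 / Fintype.card K

/-- The deviation from a uniform key `g u`, independent of `f u` and the quantum system, of the
component with key `k` and hash `c`. -/
noncomputable def deviation (f : U → C) (g : U → K) (A : U → Matrix b b ℂ) (k : K) (c : C) :
    Matrix b b ℂ :=
  ∑ u, (keyDev k (g u) : ℂ) • (if f u = c then A u else 0)

theorem deviation_add (f : U → C) (g : U → K) (A B : U → Matrix b b ℂ) (k : K) (c : C) :
    deviation f g (fun u => A u + B u) k c = deviation f g A k c + deviation f g B k c := by
  simp only [deviation, ← Finset.sum_add_distrib, ← smul_add]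
  refine Finset.sum_congr rfl fun u _ => ?_
  split_ifs <;> simp

variable [Nonempty K] [Fintype C] [Fintype b]

theorem sum_keyDev (k : K) : ∑ x, keyDev k x = 0 := by
  simp [keyDev, Finset.sum_sub_distrib]

theorem sum_keyDev_sq_le (x : K) : ∑ k, keyDev k x ^ 2 ≤ 1 := by
  have hK : (0 : ℝ) < Fintype.card K := by exact_mod_cast Fintype.card_pos
  have h : ∀ k, keyDev k x ^ 2 = (if x = k then 1 else 0) * (1 - 2 / Fintype.card K) +
      1 / (Fintype.card K : ℝ) ^ 2 := fun k => by
    rw [keyDev]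
    split_ifs
    · field_simp
      ring
    · field_simp
      ring
  simp only [h]
  rw [Finset.sum_add_distrib, ← Finset.sum_mul]
  simp only [Finset.sum_ite_eq, Finset.mem_univ, if_true, Finset.sum_const, Finset.card_univ,
    nsmul_eq_mul]
  field_simp
  linarith

theorem sum_abs_keyDev_le (x : K) : ∑ k, |keyDev k x| ≤ 2 := by
  have hK : (0 : ℝ) < Fintype.card K := by exact_mod_cast Fintype.card_pos
  calc _ ≤ ∑ k, ((if x = k then 1 else 0) + 1 / (Fintype.card K : ℝ)) :=
        Finset.sum_le_sum fun k _ => by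
          rw [keyDev]
          refine (abs_sub _ _).trans (le_of_eq ?_)
          rw [abs_of_nonneg (by split_ifs <;> norm_num), abs_of_nonneg (by positivity)]
    _ = 2 := by
        rw [Finset.sum_add_distrib]
        simp only [Finset.sum_ite_eq, Finset.mem_univ, if_true, Finset.sum_const, Finset.card_univ,
          nsmul_eq_mul]
        field_simp
        norm_num

variable [DecidableEq b]

theorem traceNorm_smul_abs_le (c : ℝ) (A : Matrix b b ℂ) :
    traceNorm ((c : ℂ) • A) ≤ |c| * traceNorm A := by
  rcases le_total 0 c with h | h
  · rw [abs_of_nonneg h]; exact traceNorm_smul_le h A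
  · rw [abs_of_nonpos h, ← traceNorm_neg, ← neg_smul, ← Complex.ofReal_neg]
    exact traceNorm_smul_le (neg_nonneg.mpr h) A

/-- Hashing increases a trace-norm error of the ensemble by a factor of at most two. -/
theorem sum_traceNorm_deviation_le (f : U → C) (g : U → K) (A : U → Matrix b b ℂ) :
    ∑ k, ∑ c, traceNorm (deviation f g A k c) ≤ 2 * ∑ u, traceNorm (A u) := by
  calc _ ≤ ∑ k, ∑ c, ∑ u, |keyDev k (g u)| * (if f u = c then traceNorm (A u) else 0) := by
        refine Finset.sum_le_sum fun k _ => Finset.sum_le_sum fun c _ => ?_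
        refine (traceNorm_sum_le _ _).trans (Finset.sum_le_sum fun u _ => ?_)
        refine (traceNorm_smul_abs_le _ _).trans (le_of_eq ?_)
        split_ifs
        · rfl
        · rw [traceNorm_zero]
    _ = ∑ u, (∑ k, |keyDev k (g u)|) * traceNorm (A u) := by
        have : ∀ k, ∑ c, ∑ u, |keyDev k (g u)| * (if f u = c then traceNorm (A u) else 0) =
            ∑ u, |keyDev k (g u)| * traceNorm (A u) := fun k => by
          rw [Finset.sum_comm]
          refine Finset.sum_congr rfl fun u _ => ?_
          rw [← Finset.mul_sum]
          simp
        simp only [this]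
        rw [Finset.sum_comm]
        simp only [Finset.sum_mul]
    _ ≤ ∑ u, 2 * traceNorm (A u) :=
        Finset.sum_le_sum fun u _ =>
          mul_le_mul_of_nonneg_right (sum_abs_keyDev_le _) (traceNorm_nonneg _)
    _ = _ := (Finset.mul_sum _ _ _).symm

variable [DecidableEq U]

/-- The average over `g` of the second moment of the deviation. -/
theorem exists_sum_hs_deviation_le (f : U → C) (B : U → Matrix b b ℂ) :
    ∃ g : U → K, ∑ k, ∑ c, hs (deviation f g B k c) ≤ ∑ u, hs (B u) := by
  refine exists_le_of_sum_le_card_mul ?_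
  calc ∑ g : U → K, ∑ k, ∑ c, hs (deviation f g B k c)
      = ∑ k, ∑ c, ∑ g : U → K, ∑ u, keyDev k (g u) ^ 2 * (if f u = c then hs (B u) else 0) := by
        rw [Finset.sum_comm]
        refine Finset.sum_congr rfl fun k _ => ?_
        rw [Finset.sum_comm]
        refine Finset.sum_congr rfl fun c _ => ?_
        simp only [deviation]
        rw [sum_functions_hs (sum_keyDev k)]
        refine Finset.sum_congr rfl fun g _ => Finset.sum_congr rfl fun u _ => ?_
        split_ifs
        · rfl
        · simp [hs]
    _ = ∑ g : U → K, ∑ u, (∑ k, keyDev k (g u) ^ 2) * hs (B u) := by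
        have : ∀ k, ∑ c, ∑ g : U → K, ∑ u, keyDev k (g u) ^ 2 * (if f u = c then hs (B u) else 0) =
            ∑ g : U → K, ∑ u, keyDev k (g u) ^ 2 * hs (B u) := fun k => by
          rw [Finset.sum_comm]
          refine Finset.sum_congr rfl fun g _ => ?_
          rw [Finset.sum_comm]
          refine Finset.sum_congr rfl fun u _ => ?_
          rw [← Finset.mul_sum]
          simp
        simp only [this]
        rw [Finset.sum_comm]
        refine Finset.sum_congr rfl fun g _ => ?_
        rw [Finset.sum_comm]
        simp only [Finset.sum_mul]
    _ ≤ ∑ g : U → K, ∑ u, 1 * hs (B u) :=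
        Finset.sum_le_sum fun g _ => Finset.sum_le_sum fun u _ =>
          mul_le_mul_of_nonneg_right (sum_keyDev_sq_le _) (hs_nonneg _)
    _ = _ := by simp

/-- Privacy amplification. The ensemble `R u (R u)†` is compared with the operators
`F R u (S u)†`, where `F` is the overlap of `R` and `S`: the total trace norm of the difference is
at most `√(1 - F²)`, and their second moment relative to `σ` is controlled by `S u (S u)† ≤ t σ`.
The slack between `t` and `t'` pays for making `σ` invertible. -/
theorem exists_extractor {R S : U → Matrix b b ℂ} {σ : Matrix b b ℂ} {e t t' : ℝ} (he : 0 ≤ e)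
    (hR : ∑ u, hs (R u) = 1) (hS : ∑ u, hs (S u) ≤ 1)
    (hF : 1 - (∑ u, ((R u)ᴴ * S u).trace.re) ^ 2 ≤ e ^ 2)
    (ht : 0 < t) (htt' : t < t') (hσ : IsDensity σ)
    (hSσ : ∀ u, S u * (S u)ᴴ ≤ (t : ℂ) • σ) (f : U → C) :
    ∃ g : U → K, ∑ k, ∑ c, traceNorm (deviation f g (fun u => R u * (R u)ᴴ) k c) ≤
      2 * e + √(Fintype.card K * Fintype.card C * t') := by
  set F := ∑ u, ((R u)ᴴ * S u).trace.re with hFdef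
  have hF1 : F ^ 2 ≤ 1 := by
    have h1 : F ≤ √(∑ u, hs (R u)) * √(∑ u, hs (S u)) := sum_re_trace_mul_le_sqrt_hs _ R S
    have h2 : -F ≤ √(∑ u, hs (R u)) * √(∑ u, hs (S u)) := by
      have := sum_re_trace_mul_le_sqrt_hs Finset.univ (fun u => -R u) S
      simpa [hs, hFdef] using this
    have h3 : √(∑ u, hs (S u)) ≤ 1 := Real.sqrt_le_one.mpr hS
    rw [hR, Real.sqrt_one, one_mul] at h1 h2
    nlinarith
  -- regularize `σ` to make it invertible
  obtain ⟨η, hη, hηt⟩ : ∃ η : ℝ, 0 < η ∧ t * (1 + η * Fintype.card b) ≤ t' := by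
    refine ⟨(t' - t) / (t * (Fintype.card b + 1)), by have := sub_pos.mpr htt'; positivity, ?_⟩
    have h1 : (t' - t) / (t * (Fintype.card b + 1)) * Fintype.card b ≤ (t' - t) / t := by
      rw [div_mul_eq_mul_div, div_le_div_iff₀ (by positivity) ht]
      have := mul_nonneg (sub_pos.mpr htt').le ht.le
      nlinarith
    calc _ ≤ t * (1 + (t' - t) / t) := by gcongr
      _ = t' := by field_simp; ring
  have hηc : (0 : ℂ) < (η : ℂ) := by exact_mod_cast hη
  set σ' := σ + (η : ℂ) • (1 : Matrix b b ℂ) with hσ'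
  have hσ'pos : σ'.PosDef := (PosDef.one.smul hηc).posSemidef_add hσ.1
  have hσ'tr : σ'.trace.re = 1 + η * Fintype.card b := by
    rw [hσ', trace_add, hσ.2, trace_smul, trace_one, smul_eq_mul, Complex.add_re,
      Complex.re_ofReal_mul]
    simp
  obtain ⟨hZs, hYZ, hZσ, -⟩ := inv_sqrt_identities hσ'pos
  set Z := (CFC.sqrt σ')⁻¹ with hZ
  have hZY : Z * CFC.sqrt σ' = 1 := by
    rw [← sqrt_conjTranspose, ← hZs, ← conjTranspose_mul, hYZ, conjTranspose_one]
  set A : U → Matrix b b ℂ := fun u => (F : ℂ) • (R u * (S u)ᴴ) with hA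
  have hAZ : ∀ u, hs (A u * Z) ≤ t * hs (R u) := fun u => by
    have htc : (0 : ℂ) ≤ t := by exact_mod_cast ht.le
    have h1 : (Z * S u) * (Z * S u)ᴴ ≤ (t : ℂ) • 1 := by
      have h2 : S u * (S u)ᴴ ≤ (t : ℂ) • σ' := (hSσ u).trans (by
        rw [le_iff, hσ', smul_add, add_sub_cancel_left]
        exact (PosSemidef.one.smul hηc.le).smul htc)
      have h3 := conj_mono h2 Z
      rw [hZs, Matrix.mul_smul, Matrix.smul_mul, hZσ, hYZ] at h3
      rw [conjTranspose_mul, hZs]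
      simpa only [Matrix.mul_assoc] using h3
    have h2 := conj_mono (conjTranspose_mul_self_le_of_mul_conjTranspose_self_le ht h1) (R u)
    have h3 := re_trace_mono h2
    have h4 : A u * Z = (F : ℂ) • (R u * (Z * S u)ᴴ) := by
      rw [hA, conjTranspose_mul, hZs, Matrix.smul_mul, Matrix.mul_assoc]
    rw [h4, hs_smul, hs_eq_trace_mul_conjTranspose, conjTranspose_mul (R u),
      conjTranspose_conjTranspose]
    rw [Matrix.mul_smul, Matrix.smul_mul, Matrix.mul_one, trace_smul, smul_eq_mul,
      Complex.re_ofReal_mul, ← hs_eq_trace_mul_conjTranspose] at h3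
    have h5 : R u * (Z * S u)ᴴ * (Z * S u * (R u)ᴴ) =
        R u * ((Z * S u)ᴴ * (Z * S u)) * (R u)ᴴ := by simp only [Matrix.mul_assoc]
    rw [h5]
    have h6 := mul_nonneg ht.le (hs_nonneg (R u))
    have h7 := sq_nonneg F
    nlinarith
  obtain ⟨g, hg⟩ := exists_sum_hs_deviation_le (K := K) f fun u => A u * Z
  refine ⟨g, ?_⟩
  have hg' : ∑ k, ∑ c, hs (deviation f g (fun u => A u * Z) k c) ≤ t := by
    refine hg.trans ((Finset.sum_le_sum fun u _ => hAZ u).trans (le_of_eq ?_))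
    rw [← Finset.mul_sum, hR, mul_one]
  have hdev : ∀ k c, deviation f g A k c =
      deviation f g (fun u => A u * Z) k c * CFC.sqrt σ' := fun k c => by
    simp only [deviation, Matrix.sum_mul, Matrix.smul_mul]
    refine Finset.sum_congr rfl fun u _ => ?_
    split_ifs
    · rw [Matrix.mul_assoc, hZY, Matrix.mul_one]
    · simp
  have h1 : ∑ k, ∑ c, traceNorm (deviation f g A k c) ≤
      √(Fintype.card K * Fintype.card C * t') := by
    have h2 : ∀ p : K × C, traceNorm (deviation f g A p.1 p.2) ≤
        √(hs (deviation f g (fun u => A u * Z) p.1 p.2)) * √σ'.trace.re := fun p => by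
      rw [hdev, ← hs_sqrt hσ'pos.posSemidef]
      exact traceNorm_mul_le _ _
    rw [← Fintype.sum_prod_type']
    refine (Finset.sum_le_sum fun p _ => h2 p).trans
      ((Real.sum_sqrt_mul_sqrt_le _ (fun p => hs_nonneg _) (fun p => ?_)).trans ?_)
    · exact PosSemidef.trace_re_nonneg hσ'pos.posSemidef
    · rw [← Real.sqrt_mul (Finset.sum_nonneg fun p _ => hs_nonneg _)]
      refine Real.sqrt_le_sqrt ?_
      rw [Fintype.sum_prod_type, hσ'tr]
      simp only [Finset.sum_const, Finset.card_univ, Fintype.card_prod, nsmul_eq_mul, Nat.cast_mul]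
      have h3 : (0 : ℝ) ≤ Fintype.card K * Fintype.card C := by positivity
      calc _ ≤ t * (Fintype.card K * Fintype.card C * (1 + η * Fintype.card b)) := by gcongr
        _ = Fintype.card K * Fintype.card C * (t * (1 + η * Fintype.card b)) := by ring
        _ ≤ _ := by gcongr
  have h2 : ∑ u, traceNorm (R u * (R u)ᴴ - A u) ≤ e := by
    have h3 : ∀ u, R u * (R u)ᴴ - A u = R u * (R u - (F : ℂ) • S u)ᴴ := fun u => by
      rw [conjTranspose_sub, conjTranspose_smul, Complex.star_def, Complex.conj_ofReal,
        Matrix.mul_sub, Matrix.mul_smul]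
    calc _ ≤ ∑ u, √(hs (R u)) * √(hs (R u - (F : ℂ) • S u)) :=
          Finset.sum_le_sum fun u _ => by
            rw [h3, ← hs_conjTranspose (R u - _)]
            exact traceNorm_mul_le _ _
      _ ≤ _ := Real.sum_sqrt_mul_sqrt_le _ (fun _ => hs_nonneg _) fun _ => hs_nonneg _
      _ ≤ e := by
          rw [hR, Real.sqrt_one, one_mul]
          refine (Real.sqrt_le_left he).mpr ?_
          have h4 : ∀ c : ℝ, ∑ u, hs (R u - (c : ℂ) • S u) =
              1 - 2 * c * F + c ^ 2 * ∑ u, hs (S u) := fun c => by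
            rw [← hR, hFdef, Finset.mul_sum, Finset.mul_sum, ← Finset.sum_sub_distrib,
              ← Finset.sum_add_distrib]
            refine Finset.sum_congr rfl fun u _ => ?_
            rw [hs_sub, hs_smul, Matrix.mul_smul, trace_smul, smul_eq_mul, Complex.re_ofReal_mul]
            ring
          rw [h4]
          nlinarith [sq_nonneg F]
  calc _ = ∑ k, ∑ c, traceNorm (deviation f g (fun u => R u * (R u)ᴴ - A u) k c +
        deviation f g A k c) := by
        simp only [← deviation_add, sub_add_cancel]
    _ ≤ ∑ k, ∑ c, (traceNorm (deviation f g (fun u => R u * (R u)ᴴ - A u) k c) +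
        traceNorm (deviation f g A k c)) :=
        Finset.sum_le_sum fun k _ => Finset.sum_le_sum fun c _ => traceNorm_add_le _ _
    _ = ∑ k, ∑ c, traceNorm (deviation f g (fun u => R u * (R u)ᴴ - A u) k c) +
        ∑ k, ∑ c, traceNorm (deviation f g A k c) := by
        simp only [Finset.sum_add_distrib]
    _ ≤ 2 * e + _ := by
        refine add_le_add ((sum_traceNorm_deviation_le f g _).trans ?_) h1
        linarith

end Amplification

/-! ### Partial traces -/

section PartialTrace

theorem traceRight_posSemidef {a b : Type*} [Fintype b]
    {M : Matrix (a × b) (a × b) ℂ} (h : M.PosSemidef) :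
    (traceRight M).PosSemidef := by
  have : traceRight M = ∑ j, M.submatrix (fun i => (i, j)) (fun i => (i, j)) := by
    ext i i'
    simp [traceRight, Matrix.sum_apply]
  rw [this]
  exact posSemidef_sum _ fun j _ => h.submatrix _

variable {a b : Type*} [Fintype a]

theorem traceLeft_posSemidef {M : Matrix (a × b) (a × b) ℂ} (h : M.PosSemidef) :
    (traceLeft M).PosSemidef := by
  rw [traceLeft_eq_sum_diagBlock]
  exact posSemidef_sum _ fun i _ => diagBlock_posSemidef h i

theorem traceLeft_sum {ι : Type*} (s : Finset ι) (M : ι → Matrix (a × b) (a × b) ℂ) :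
    traceLeft (∑ i ∈ s, M i) = ∑ i ∈ s, traceLeft (M i) := by
  ext x y
  simp only [traceLeft, of_apply, Matrix.sum_apply]
  exact Finset.sum_comm

theorem traceLeft_blockDiag [DecidableEq a] (A : a → Matrix b b ℂ) :
    traceLeft (blockDiag A) = ∑ i, A i := by
  rw [traceLeft_eq_sum_diagBlock]
  simp only [diagBlock_blockDiag]

theorem sum_ketbra_kronecker [DecidableEq a] (A : a → Matrix b b ℂ) :
    ∑ i, ketbra i ⊗ₖ A i = blockDiag A := by
  ext p q
  simp only [Matrix.sum_apply, kroneckerMap_apply, ketbra, single_apply, blockDiag_apply]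
  by_cases h : p.1 = q.1
  · rw [if_pos h, Finset.sum_eq_single p.1]
    · simp [h]
    · intro j _ hj; simp [hj]
    · simp
  · rw [if_neg h]
    refine Finset.sum_eq_zero fun i _ => ?_
    rw [if_neg, zero_mul]
    rintro ⟨h1, h2⟩
    exact h (h1.symm.trans h2)

variable [Fintype b]

theorem trace_traceLeft (M : Matrix (a × b) (a × b) ℂ) : (traceLeft M).trace = M.trace := by
  simp only [trace, diag_apply, traceLeft, of_apply, Fintype.sum_prod_type]
  exact Finset.sum_comm

theorem trace_traceRight (M : Matrix (a × b) (a × b) ℂ) : (traceRight M).trace = M.trace := by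
  simp [trace, traceRight, Fintype.sum_prod_type]

variable [DecidableEq b]

theorem kronecker_one_mul_apply (A : Matrix a a ℂ) (M : Matrix (a × b) (a × b) ℂ) (i : a) (j : b)
    (q : a × b) : ((A ⊗ₖ (1 : Matrix b b ℂ)) * M) (i, j) q = ∑ i', A i i' * M (i', j) q := by
  simp [mul_apply, Fintype.sum_prod_type, one_apply]

theorem mul_kronecker_one_apply (A : Matrix a a ℂ) (M : Matrix (a × b) (a × b) ℂ) (i : a) (j : b)
    (p : a × b) : (M * (A ⊗ₖ (1 : Matrix b b ℂ))) p (i, j) = ∑ i', M p (i', j) * A i' i := by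
  simp [mul_apply, Fintype.sum_prod_type, one_apply]

/-- The partial trace is cyclic for operators on the system that is traced out. -/
theorem traceLeft_mul_comm (A : Matrix a a ℂ) (M : Matrix (a × b) (a × b) ℂ) :
    traceLeft ((A ⊗ₖ (1 : Matrix b b ℂ)) * M) = traceLeft (M * (A ⊗ₖ (1 : Matrix b b ℂ))) := by
  ext x y
  simp only [traceLeft, of_apply, kronecker_one_mul_apply, mul_kronecker_one_apply]
  rw [Finset.sum_comm]
  simp only [mul_comm]

theorem trace_kronecker_one_mul (A : Matrix a a ℂ) (M : Matrix (a × b) (a × b) ℂ) :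
    ((A ⊗ₖ (1 : Matrix b b ℂ)) * M).trace = (A * traceRight M).trace := by
  simp only [trace, diag_apply, Fintype.sum_prod_type, kronecker_one_mul_apply]
  simp only [mul_apply, traceRight, of_apply, Finset.mul_sum]
  exact Finset.sum_congr rfl fun i _ => Finset.sum_comm

variable [DecidableEq a]

theorem traceLeft_kronecker_one_mul_posSemidef {A : Matrix a a ℂ} (hA : A.PosSemidef)
    {M : Matrix (a × b) (a × b) ℂ} (hM : M.PosSemidef) :
    (traceLeft ((A ⊗ₖ (1 : Matrix b b ℂ)) * M)).PosSemidef := by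
  have h1 : A ⊗ₖ (1 : Matrix b b ℂ) =
      (CFC.sqrt A ⊗ₖ (1 : Matrix b b ℂ)) * (CFC.sqrt A ⊗ₖ (1 : Matrix b b ℂ)) := by
    rw [← mul_kronecker_mul, sqrt_mul_sqrt hA, Matrix.one_mul]
  rw [h1, Matrix.mul_assoc, traceLeft_mul_comm]
  refine traceLeft_posSemidef ?_
  have h2 := hM.mul_mul_conjTranspose_same (CFC.sqrt A ⊗ₖ (1 : Matrix b b ℂ))
  rwa [conjTranspose_kronecker, sqrt_conjTranspose, conjTranspose_one] at h2

theorem traceNorm_submatrix_equiv (e : b ≃ a) (M : Matrix a a ℂ) :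
    traceNorm (M.submatrix e e) = traceNorm M := by
  have h1 : (M.submatrix e e)ᴴ * M.submatrix e e = (Mᴴ * M).submatrix e e := by
    rw [conjTranspose_submatrix, submatrix_mul_equiv]
  have h2 : CFC.sqrt ((Mᴴ * M).submatrix e e) = (CFC.sqrt (Mᴴ * M)).submatrix e e := by
    refine CFC.sqrt_unique ?_ (nonneg_iff_posSemidef.mpr ((sqrt_posSemidef _).submatrix e))
    rw [submatrix_mul_equiv, sqrt_mul_sqrt (posSemidef_conjTranspose_mul_self M)]
  rw [traceNorm, traceNorm, h1, h2]
  simp only [trace, diag_apply, submatrix_apply]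
  rw [e.sum_comp (fun i => CFC.sqrt (Mᴴ * M) i i)]

end PartialTrace

/-! ### Classical processing and the output of a protocol -/

section Processing

variable {X Y Z : Type*} [Fintype Y] [DecidableEq Y] [Fintype Z] [DecidableEq Z]

theorem Processing.Allows.nonneg {r : Processing} {W : X → Y → ℝ} (h : r.Allows W) (x : X)
    (y : Y) : 0 ≤ W x y := by
  cases r with
  | deterministic =>
    obtain ⟨f, hf⟩ := h
    rw [hf]
    split_ifs <;> norm_num
  | randomized => exact h.1 x y

theorem Processing.Allows.sum_eq_one {r : Processing} {W : X → Y → ℝ} (h : r.Allows W) (x : X) :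
    ∑ y, W x y = 1 := by
  cases r with
  | deterministic =>
    obtain ⟨f, hf⟩ := h
    simp [hf]
  | randomized => exact h.2 x

/-- Both classes of maps are closed under applying a function to the output. -/
theorem Processing.Allows.map {r : Processing} {W : X → Y → ℝ} (h : r.Allows W) (g : Y → Z) :
    r.Allows fun x z => ∑ y, if g y = z then W x y else 0 := by
  cases r with
  | deterministic =>
    obtain ⟨f, hf⟩ := h
    refine ⟨fun x => g (f x), fun x z => ?_⟩
    simp only [hf]
    rw [Finset.sum_eq_single (f x)]
    · simp [eq_comm]
    · intro y _ hy
      simp [hy]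
    · simp
  | randomized =>
    refine ⟨fun x z => Finset.sum_nonneg fun y _ => ?_, fun x => ?_⟩
    · split_ifs
      · exact h.1 x y
      · exact le_rfl
    · rw [Finset.sum_comm]
      simp [h.2 x]

theorem Processing.Allows.const (r : Processing) (z : Z) :
    r.Allows fun (_ : X) z' => if z' = z then (1 : ℝ) else 0 := by
  cases r with
  | deterministic => exact ⟨fun _ => z, fun _ _ => rfl⟩
  | randomized =>
    refine ⟨fun x z => ?_, fun x => by simp⟩
    simp only
    split_ifs <;> norm_num

theorem Processing.Allows.comp_equiv {r : Processing} {W : X → Y → ℝ} (h : r.Allows W) (g : Z ≃ Y) :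
    r.Allows fun x z => W x (g z) := by
  cases r with
  | deterministic =>
    obtain ⟨f, hf⟩ := h
    exact ⟨fun x => g.symm (f x), fun x z => by simp only [hf, Equiv.eq_symm_apply]⟩
  | randomized => exact ⟨fun x z => h.1 x _, fun x => by rw [← h.2 x, ← g.sum_comp]⟩

theorem sum_prob_mul {d : Type*} [Fintype X] [Fintype d] {r : Processing} (ψ : CQState X d)
    {W : X → Y → ℝ} (hW : r.Allows W) : ∑ x, ∑ y, ψ.prob x * W x y = 1 := by
  simp only [← Finset.mul_sum, hW.sum_eq_one, mul_one, ψ.prob_sum]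

end Processing

section BlockAlgebra

variable {a b : Type*} [DecidableEq a]

theorem blockDiag_sum {ι : Type*} (s : Finset ι) (A : ι → a → Matrix b b ℂ) :
    ∑ i ∈ s, blockDiag (A i) = blockDiag fun j => ∑ i ∈ s, A i j := by
  ext p q
  simp only [Matrix.sum_apply, blockDiag_apply]
  split_ifs <;> simp

theorem smul_blockDiag (c : ℂ) (A : a → Matrix b b ℂ) :
    c • blockDiag A = blockDiag fun j => c • A j := by
  ext p q
  simp only [Matrix.smul_apply, blockDiag_apply]
  split_ifs <;> simp

theorem idealKey_kronecker {K : Type*} [Fintype K] [DecidableEq K] (A : Matrix b b ℂ) :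
    idealKey K ⊗ₖ A = blockDiag fun k : K × K =>
      (if k.1 = k.2 then ((Fintype.card K : ℂ)⁻¹) else 0) • A := by
  have h : idealKey K = diagonal fun k : K × K =>
      if k.1 = k.2 then ((Fintype.card K : ℂ)⁻¹) else 0 := by
    ext ⟨k, k'⟩ ⟨l, l'⟩
    simp only [idealKey, Matrix.smul_apply, Matrix.sum_apply, kroneckerMap_apply, ketbra,
      single_apply, diagonal_apply, Prod.mk.injEq, smul_eq_mul]
    rw [Finset.sum_eq_single k]
    · by_cases h1 : k = l <;> by_cases h2 : k = k' <;> by_cases h3 : k = l' <;> grind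
    · intro j _ hj
      simp [hj]
    · simp
  ext p q
  rw [h, kroneckerMap_apply, blockDiag_apply, diagonal_apply]
  split_ifs <;> simp

end BlockAlgebra

section Output

variable {X B E K C : Type*} [Fintype B] [DecidableEq B] [Fintype K] [DecidableEq K] [Fintype C]
  [DecidableEq C] {r : Processing}

/-- Relabelling the messages. -/
def Protocol.relabel {C' : Type*} [Fintype C'] [DecidableEq C'] (Q : Protocol r X B K C)
    (e : C ≃ C') : Protocol r X B K C' where
  alice x y := ∑ z, if (z.1, e z.2) = y then Q.alice x z else 0
  alice_allowed := Q.alice_allowed.map fun z : K × C => (z.1, e z.2)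
  bob c := Q.bob (e.symm c)
  bob_posSemidef _ := Q.bob_posSemidef _
  bob_sum _ := Q.bob_sum _

theorem Protocol.relabel_alice {C' : Type*} [Fintype C'] [DecidableEq C']
    (Q : Protocol r X B K C) (e : C ≃ C') (x : X) (k : K) (c : C) :
    (Q.relabel e).alice x (k, e c) = Q.alice x (k, c) := by
  simp only [Protocol.relabel, Prod.mk.injEq, EmbeddingLike.apply_eq_iff_eq]
  rw [Finset.sum_eq_single (k, c)]
  · simp
  · rintro ⟨k', c'⟩ _ h
    rw [if_neg]
    simpa using h
  · simp

variable [Fintype X] [Fintype E]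

/-- Eve's unnormalized state when Alice's key is `k` and the message is `c`. -/
noncomputable def Protocol.aliceBlock (Q : Protocol r X B K C) (ψ : CQState X (B × E)) (k : K)
    (c : C) : Matrix E E ℂ :=
  ∑ x, ((ψ.prob x * Q.alice x (k, c) : ℝ) : ℂ) • traceLeft (ψ.state x)

theorem Protocol.sum_trace_aliceBlock (Q : Protocol r X B K C) (ψ : CQState X (B × E)) :
    ∑ k, ∑ c, (Q.aliceBlock ψ k c).trace.re = 1 := by
  rw [← Fintype.sum_prod_type', ← sum_prob_mul ψ Q.alice_allowed, Finset.sum_comm]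
  refine Finset.sum_congr rfl fun y _ => ?_
  simp only [Protocol.aliceBlock, trace_sum, Complex.re_sum, trace_smul, trace_traceLeft,
    (ψ.state_isDensity _).2, smul_eq_mul, Complex.ofReal_re, mul_one]

variable [DecidableEq E]

/-- Eve's unnormalized state when Alice's key is `k`, Bob's key is `k'` and the message is `c`. -/
noncomputable def Protocol.block (Q : Protocol r X B K C) (ψ : CQState X (B × E)) (k k' : K)
    (c : C) : Matrix E E ℂ :=
  ∑ x, ((ψ.prob x * Q.alice x (k, c) : ℝ) : ℂ) •
    traceLeft ((Q.bob c k' ⊗ₖ (1 : Matrix E E ℂ)) * ψ.state x)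

/-- An upper bound on the distance from an ideal key: the probability that the two keys differ,
plus the distance of Alice's key from a uniform one. -/
noncomputable def Protocol.errorBound (Q : Protocol r X B K C) (ψ : CQState X (B × E)) : ℝ :=
  ∑ k, ∑ c, (Q.aliceBlock ψ k c - Q.block ψ k k c).trace.re +
    (∑ k, ∑ c, traceNorm (Q.aliceBlock ψ k c -
      ((Fintype.card K : ℂ)⁻¹) • ∑ k', Q.aliceBlock ψ k' c)) / 2

theorem Protocol.output_eq (Q : Protocol r X B K C) (ψ : CQState X (B × E)) :
    Q.output ψ = blockDiag fun kk : K × K => blockDiag fun c => Q.block ψ kk.1 kk.2 c := by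
  ext ⟨⟨k, k'⟩, ⟨c, e⟩⟩ ⟨⟨l, l'⟩, ⟨c', e'⟩⟩
  simp only [Protocol.output, Matrix.sum_apply, Matrix.smul_apply, kroneckerMap_apply, ketbra,
    single_apply, blockDiag_apply, Prod.mk.injEq, smul_eq_mul, Protocol.block]
  by_cases h : (k = l ∧ k' = l') ∧ c = c'
  · obtain ⟨⟨rfl, rfl⟩, rfl⟩ := h
    simp only [and_self, if_true]
    refine Finset.sum_congr rfl fun x _ => ?_
    rw [Finset.sum_eq_single k (fun j _ hj => by simp [hj]) (by simp),
      Finset.sum_eq_single c (fun j _ hj => by simp [hj]) (by simp),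
      Finset.sum_eq_single k' (fun j _ hj => by simp [hj]) (by simp)]
    simp
  · have h0 : ∀ i j m, (if i = k ∧ i = l then (1 : ℂ) else 0) * (if j = k' ∧ j = l' then 1 else 0) *
        ((if m = c ∧ m = c' then (1 : ℂ) else 0)) = 0 := fun i j m => by
      split_ifs <;> grind
    rw [Finset.sum_eq_zero]
    · by_cases h1 : k = l ∧ k' = l'
      · rw [if_pos h1, if_neg (fun h2 => h ⟨h1, h2⟩)]
      · rw [if_neg h1]
    · intro x _
      refine Finset.sum_eq_zero fun i _ => Finset.sum_eq_zero fun m _ =>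
        Finset.sum_eq_zero fun j _ => ?_
      rw [← mul_assoc (_ * _) _ _, h0, zero_mul, mul_zero]

theorem Protocol.block_posSemidef (Q : Protocol r X B K C) (ψ : CQState X (B × E)) (k k' : K)
    (c : C) : (Q.block ψ k k' c).PosSemidef :=
  posSemidef_sum _ fun x _ => (traceLeft_kronecker_one_mul_posSemidef (Q.bob_posSemidef c k')
    (ψ.state_isDensity x).1).smul (by
      exact_mod_cast mul_nonneg (ψ.prob_nonneg x) (Q.alice_allowed.nonneg x _))

theorem Protocol.sum_block (Q : Protocol r X B K C) (ψ : CQState X (B × E)) (k : K) (c : C) :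
    ∑ k', Q.block ψ k k' c = Q.aliceBlock ψ k c := by
  simp only [Protocol.block, Protocol.aliceBlock]
  rw [Finset.sum_comm]
  refine Finset.sum_congr rfl fun x _ => ?_
  rw [← Finset.smul_sum, ← traceLeft_sum, ← Matrix.sum_mul]
  congr 3
  have : ∑ k', Q.bob c k' ⊗ₖ (1 : Matrix E E ℂ) = (1 : Matrix (B × E) (B × E) ℂ) := by
    rw [← one_kronecker_one, ← Q.bob_sum c]
    ext p q
    simp [Matrix.sum_apply, kroneckerMap_apply, Finset.sum_mul]
  rw [this, Matrix.one_mul]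

theorem Protocol.traceLeft_output (Q : Protocol r X B K C) (ψ : CQState X (B × E)) :
    traceLeft (Q.output ψ) = blockDiag fun c => ∑ k, Q.aliceBlock ψ k c := by
  rw [Q.output_eq, traceLeft_blockDiag, blockDiag_sum]
  congr 1
  funext c
  rw [Fintype.sum_prod_type]
  simp only [Q.sum_block]

theorem Protocol.output_sub_idealKey (Q : Protocol r X B K C) (ψ : CQState X (B × E)) :
    Q.output ψ - idealKey K ⊗ₖ traceLeft (Q.output ψ) =
      blockDiag fun kk : K × K => blockDiag fun c => Q.block ψ kk.1 kk.2 c -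
        (if kk.1 = kk.2 then ((Fintype.card K : ℂ)⁻¹) else 0) • ∑ k, Q.aliceBlock ψ k c := by
  rw [idealKey_kronecker, Q.traceLeft_output, Q.output_eq, blockDiag_sub]
  simp only [smul_blockDiag, blockDiag_sub]

/-- The error of the key is at most the error of its agreement plus that of its secrecy. -/
theorem Protocol.traceDist_le (Q : Protocol r X B K C) (ψ : CQState X (B × E)) :
    traceDist (Q.output ψ) (idealKey K ⊗ₖ traceLeft (Q.output ψ)) ≤ Q.errorBound ψ := by
  have herr : ∀ k c, Q.aliceBlock ψ k c - Q.block ψ k k c =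
      ∑ k' ∈ Finset.univ.erase k, Q.block ψ k k' c := fun k c => by
    rw [← Q.sum_block, ← Finset.add_sum_erase _ _ (Finset.mem_univ k), add_sub_cancel_left]
  have hpos : ∀ k c, (Q.aliceBlock ψ k c - Q.block ψ k k c).PosSemidef := fun k c => by
    rw [herr]
    exact posSemidef_sum _ fun k' _ => Q.block_posSemidef ψ k k' c
  have h2 : ∀ k c, ∑ k', traceNorm (Q.block ψ k k' c -
      (if k = k' then ((Fintype.card K : ℂ)⁻¹) else 0) • ∑ k, Q.aliceBlock ψ k c) ≤
      2 * (Q.aliceBlock ψ k c - Q.block ψ k k c).trace.re + traceNorm (Q.aliceBlock ψ k c -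
      ((Fintype.card K : ℂ)⁻¹) • ∑ k', Q.aliceBlock ψ k' c) := fun k c => by
    rw [← Finset.add_sum_erase _ _ (Finset.mem_univ k), if_pos rfl]
    have h3 : ∑ k' ∈ Finset.univ.erase k, traceNorm (Q.block ψ k k' c -
        (if k = k' then ((Fintype.card K : ℂ)⁻¹) else 0) • ∑ k, Q.aliceBlock ψ k c) =
        (Q.aliceBlock ψ k c - Q.block ψ k k c).trace.re := by
      rw [herr, trace_sum, Complex.re_sum]
      refine Finset.sum_congr rfl fun k' hk' => ?_
      rw [if_neg (Finset.ne_of_mem_erase hk').symm, zero_smul, sub_zero,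
        traceNorm_posSemidef (Q.block_posSemidef ψ k k' c)]
    have h4 := traceNorm_sub_le (Q.aliceBlock ψ k c - ((Fintype.card K : ℂ)⁻¹) •
      ∑ k', Q.aliceBlock ψ k' c) (Q.aliceBlock ψ k c - Q.block ψ k k c)
    rw [traceNorm_posSemidef (hpos k c)] at h4
    have h5 : Q.aliceBlock ψ k c - ((Fintype.card K : ℂ)⁻¹) • ∑ k', Q.aliceBlock ψ k' c -
        (Q.aliceBlock ψ k c - Q.block ψ k k c) =
        Q.block ψ k k c - ((Fintype.card K : ℂ)⁻¹) • ∑ k', Q.aliceBlock ψ k' c := by abel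
    rw [h5] at h4
    rw [h3]
    linarith
  rw [traceDist, Q.output_sub_idealKey, Protocol.errorBound]
  have h5 : traceNorm (blockDiag fun kk : K × K => blockDiag fun c => Q.block ψ kk.1 kk.2 c -
        (if kk.1 = kk.2 then ((Fintype.card K : ℂ)⁻¹) else 0) • ∑ k, Q.aliceBlock ψ k c) ≤
      ∑ k, ∑ c, ∑ k', traceNorm (Q.block ψ k k' c -
        (if k = k' then ((Fintype.card K : ℂ)⁻¹) else 0) • ∑ k, Q.aliceBlock ψ k c) := by
    refine (traceNorm_blockDiag_le _).trans ?_
    rw [Fintype.sum_prod_type]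
    refine Finset.sum_le_sum fun k _ => ?_
    rw [Finset.sum_comm]
    exact Finset.sum_le_sum fun k' _ => traceNorm_blockDiag_le _
  have h6 := h5.trans (Finset.sum_le_sum fun k _ => Finset.sum_le_sum fun c _ => h2 k c)
  simp only [Finset.sum_add_distrib, ← Finset.mul_sum] at h6
  linarith

theorem Protocol.relabel_errorBound {C' : Type*} [Fintype C'] [DecidableEq C']
    (Q : Protocol r X B K C) (e : C ≃ C') (ψ : CQState X (B × E)) :
    (Q.relabel e).errorBound ψ = Q.errorBound ψ := by
  have h1 : ∀ k c, (Q.relabel e).aliceBlock ψ k (e c) = Q.aliceBlock ψ k c := fun k c => by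
    simp only [Protocol.aliceBlock, Q.relabel_alice]
  have h2 : ∀ k k' c, (Q.relabel e).block ψ k k' (e c) = Q.block ψ k k' c := fun k k' c => by
    simp only [Protocol.block, Q.relabel_alice]
    simp [Protocol.relabel]
  simp only [Protocol.errorBound, ← e.sum_comp, h1, h2]

/-- The alphabet of the messages may be any finite type. -/
theorem le_keyLength {n : ℕ} {ε : ℝ} (Q : Protocol r X B (Fin n → Bool) C)
    (ψ : CQState X (B × E)) (h : Q.errorBound ψ ≤ ε) : ((n : ℝ) : EReal) ≤ keyLength r ε ψ := by
  set e := Fintype.equivFin C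
  refine le_iSup_of_le n (le_iSup_of_le (Fintype.card C) (le_iSup_of_le (Q.relabel e)
    (le_iSup_of_le ?_ le_rfl)))
  exact ((Q.relabel e).traceDist_le ψ).trans (by rwa [Q.relabel_errorBound])

/-- The protocol without communication in which both parties output the fixed key `k`. -/
def Protocol.trivial (r : Processing) (X B : Type*) [Fintype B] [DecidableEq B] (k : K) :
    Protocol r X B K Unit where
  alice _ y := if y = (k, ()) then 1 else 0
  alice_allowed := Processing.Allows.const r (k, ())
  bob _ k' := if k' = k then 1 else 0
  bob_posSemidef _ k' := by
    split_ifs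
    · exact PosSemidef.one
    · exact PosSemidef.zero
  bob_sum _ := by simp

theorem Protocol.trivial_errorBound_le (k : K) (ψ : CQState X (B × E)) :
    (Protocol.trivial r X B k).errorBound ψ ≤ (∑ k', |keyDev k' k|) / 2 := by
  set τ : Matrix E E ℂ := ∑ x, (ψ.prob x : ℂ) • traceLeft (ψ.state x) with hτdef
  have hτ : τ.PosSemidef := posSemidef_sum _ fun x _ =>
    (traceLeft_posSemidef (ψ.state_isDensity x).1).smul (by exact_mod_cast ψ.prob_nonneg x)
  have hτtr : τ.trace = 1 := by
    rw [hτdef, trace_sum]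
    simp only [trace_smul, trace_traceLeft, (ψ.state_isDensity _).2, smul_eq_mul, mul_one]
    exact_mod_cast ψ.prob_sum
  have h1 : ∀ k' c, (Protocol.trivial r X B k).aliceBlock ψ k' c = if k' = k then τ else 0 :=
    fun k' c => by
      simp only [Protocol.aliceBlock, Protocol.trivial, Prod.mk.injEq]
      by_cases h : k' = k
      · simp [hτdef, h]
      · simp [h]
  have h2 : ∀ k' c, (Protocol.trivial r X B k).block ψ k' k' c = if k' = k then τ else 0 :=
    fun k' c => by
      simp only [Protocol.block, Protocol.trivial, Prod.mk.injEq]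
      by_cases h : k' = k
      · simp [hτdef, h]
      · simp [h]
  have h3 : ∀ k', (if k' = k then τ else 0) - ((Fintype.card K : ℂ)⁻¹) • τ =
      (keyDev k' k : ℂ) • τ := fun k' => by
    rw [keyDev]
    by_cases h : k' = k
    · simp [h, sub_smul]
    · simp [h, Ne.symm h]
  simp only [Protocol.errorBound, h1, h2, sub_self, trace_zero, Complex.zero_re,
    Finset.sum_const_zero, zero_add, Finset.sum_ite_eq', Finset.mem_univ, if_true, h3,
    Finset.univ_unique, Finset.sum_singleton]
  gcongr with k' _
  refine (traceNorm_smul_abs_le _ _).trans (le_of_eq ?_)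
  rw [traceNorm_posSemidef hτ, hτtr, Complex.one_re, mul_one]

end Output

/-! ### The states of Bob and Eve, and the distillation protocol -/

section LastBlock

variable {b V : Type*}

/-- The block `(1 ⊗ ⟨v|) M (1 ⊗ |v⟩)` of an operator on a tensor product. -/
def lastBlock (M : Matrix (b × V) (b × V) ℂ) (v : V) : Matrix b b ℂ :=
  M.submatrix (fun x => (x, v)) (fun x => (x, v))

theorem lastBlock_sum {ι : Type*} (s : Finset ι) (M : ι → Matrix (b × V) (b × V) ℂ) (v : V) :
    lastBlock (∑ i ∈ s, M i) v = ∑ i ∈ s, lastBlock (M i) v := by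
  ext x y
  simp [lastBlock, Matrix.sum_apply]

theorem lastBlock_one [DecidableEq b] [DecidableEq V] (v : V) :
    lastBlock (1 : Matrix (b × V) (b × V) ℂ) v = 1 := by
  ext x y
  simp [lastBlock, one_apply]

/-- Pinching in the second factor. -/
theorem sum_traceNorm_lastBlock_le [Fintype b] [DecidableEq b] [Fintype V] [DecidableEq V]
    (M : Matrix (b × V) (b × V) ℂ) : ∑ v, traceNorm (lastBlock M v) ≤ traceNorm M := by
  rw [← traceNorm_submatrix_equiv (Equiv.prodComm V b) M]
  exact sum_traceNorm_diagBlock_le (M.submatrix (Equiv.prodComm V b) (Equiv.prodComm V b))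

theorem trace_kronecker_ketbra_mul [Fintype b] [Fintype V] [DecidableEq V] (A : Matrix b b ℂ)
    (v : V) (M : Matrix (b × V) (b × V) ℂ) :
    ((A ⊗ₖ ketbra v) * M).trace = (A * lastBlock M v).trace := by
  simp only [trace, diag_apply, mul_apply, Fintype.sum_prod_type, kroneckerMap_apply, ketbra,
    single_apply, lastBlock, submatrix_apply]
  refine Finset.sum_congr rfl fun i _ => ?_
  rw [Finset.sum_eq_single v]
  · refine Finset.sum_congr rfl fun j _ => ?_
    rw [Finset.sum_eq_single v]
    · simp
    · intro w _ hw; simp [hw.symm]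
    · simp
  · intro w _ hw; simp [hw.symm]
  · simp

theorem lastBlock_kronecker_ketbra [DecidableEq V] (A : Matrix b b ℂ) (v w : V) :
    lastBlock (A ⊗ₖ ketbra w) v = if w = v then A else 0 := by
  ext x y
  simp only [lastBlock, submatrix_apply, kroneckerMap_apply, ketbra, single_apply]
  by_cases h : w = v <;> simp [h]

theorem ketbra_posSemidef [Fintype V] [DecidableEq V] (v : V) : (ketbra v).PosSemidef := by
  have : ketbra v = diagonal (Pi.single v (1 : ℂ)) := by
    ext i j
    simp only [ketbra, single_apply, diagonal_apply, Pi.single_apply]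
    by_cases h1 : v = i <;> by_cases h2 : i = j <;> grind
  rw [this]
  refine PosSemidef.diagonal fun i => ?_
  rw [Pi.single_apply]
  split_ifs <;> simp

theorem trace_ketbra [Fintype V] [DecidableEq V] (v : V) : (ketbra v).trace = 1 := by
  simp [ketbra]

end LastBlock

section Ensembles

variable {X B E U V : Type*} [Fintype X] [Fintype B] [Fintype E] [Fintype V]
  [DecidableEq V]

/-- Bob's unnormalized state of `B V` for the value `u` of `U`. -/
noncomputable def bobEnsemble (ψ : CQState X (B × E)) (W : X → U × V → ℝ) (u : U) :
    Matrix (B × V) (B × V) ℂ :=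
  ∑ x, ∑ v, ((ψ.prob x * W x (u, v) : ℝ) : ℂ) • (traceRight (ψ.state x) ⊗ₖ ketbra v)

/-- Eve's unnormalized state of `E V` for the value `u` of `U`. -/
noncomputable def eveEnsemble (ψ : CQState X (B × E)) (W : X → U × V → ℝ) (u : U) :
    Matrix (E × V) (E × V) ℂ :=
  ∑ x, ∑ v, ((ψ.prob x * W x (u, v) : ℝ) : ℂ) • (traceLeft (ψ.state x) ⊗ₖ ketbra v)

theorem re_trace_bobEnsemble_mul (ψ : CQState X (B × E)) (W : X → U × V → ℝ)
    (u : U) (M : Matrix (B × V) (B × V) ℂ) :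
    (bobEnsemble ψ W u * M).trace.re =
      ∑ x, ∑ v, ψ.prob x * W x (u, v) * (traceRight (ψ.state x) * lastBlock M v).trace.re := by
  simp only [bobEnsemble, Matrix.sum_mul, trace_sum, Complex.re_sum, Matrix.smul_mul, trace_smul,
    smul_eq_mul, Complex.re_ofReal_mul, trace_kronecker_ketbra_mul]

theorem lastBlock_eveEnsemble (ψ : CQState X (B × E)) (W : X → U × V → ℝ) (u : U)
    (v : V) :
    lastBlock (eveEnsemble ψ W u) v =
      ∑ x, ((ψ.prob x * W x (u, v) : ℝ) : ℂ) • traceLeft (ψ.state x) := by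
  have h : ∀ (c : ℂ) (M : Matrix (E × V) (E × V) ℂ), lastBlock (c • M) v = c • lastBlock M v :=
    fun _ _ => rfl
  simp only [eveEnsemble, lastBlock_sum, h, lastBlock_kronecker_ketbra, smul_ite, smul_zero,
    Finset.sum_ite_eq', Finset.mem_univ, if_true]

variable [Fintype U] [DecidableEq U]

theorem stateBob_eq (ψ : CQState X (B × E)) (W : X → U × V → ℝ) :
    stateBob ψ W = blockDiag (bobEnsemble ψ W) := by
  rw [← sum_ketbra_kronecker]
  ext p q
  simp only [stateBob, bobEnsemble, Matrix.sum_apply, Matrix.smul_apply, kroneckerMap_apply,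
    smul_eq_mul, Finset.mul_sum]
  rw [Finset.sum_comm]
  exact Finset.sum_congr rfl fun u _ => Finset.sum_congr rfl fun x _ =>
    Finset.sum_congr rfl fun v _ => by ring

theorem stateEve_eq (ψ : CQState X (B × E)) (W : X → U × V → ℝ) :
    stateEve ψ W = blockDiag (eveEnsemble ψ W) := by
  rw [← sum_ketbra_kronecker]
  ext p q
  simp only [stateEve, eveEnsemble, Matrix.sum_apply, Matrix.smul_apply, kroneckerMap_apply,
    smul_eq_mul, Finset.mul_sum]
  rw [Finset.sum_comm]
  exact Finset.sum_congr rfl fun u _ => Finset.sum_congr rfl fun x _ =>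
    Finset.sum_congr rfl fun v _ => by ring

variable {r : Processing} {W : X → U × V → ℝ} (ψ : CQState X (B × E))

theorem bobEnsemble_posSemidef (hW : r.Allows W) (u : U) : (bobEnsemble ψ W u).PosSemidef :=
  posSemidef_sum _ fun x _ => posSemidef_sum _ fun v _ =>
    ((traceRight_posSemidef (ψ.state_isDensity x).1).kronecker (ketbra_posSemidef v)).smul (by
      exact_mod_cast mul_nonneg (ψ.prob_nonneg x) (hW.nonneg x _))

theorem eveEnsemble_posSemidef (hW : r.Allows W) (u : U) : (eveEnsemble ψ W u).PosSemidef :=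
  posSemidef_sum _ fun x _ => posSemidef_sum _ fun v _ =>
    ((traceLeft_posSemidef (ψ.state_isDensity x).1).kronecker (ketbra_posSemidef v)).smul (by
      exact_mod_cast mul_nonneg (ψ.prob_nonneg x) (hW.nonneg x _))

theorem sum_re_trace_bobEnsemble (hW : r.Allows W) :
    ∑ u, (bobEnsemble ψ W u).trace.re = 1 := by
  rw [← sum_prob_mul ψ hW]
  simp only [bobEnsemble, trace_sum, Complex.re_sum, trace_smul, trace_kronecker, trace_ketbra,
    trace_traceRight, (ψ.state_isDensity _).2, smul_eq_mul, mul_one, Complex.ofReal_re,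
    Fintype.sum_prod_type]
  exact Finset.sum_comm

theorem sum_re_trace_eveEnsemble (hW : r.Allows W) :
    ∑ u, (eveEnsemble ψ W u).trace.re = 1 := by
  rw [← sum_prob_mul ψ hW]
  simp only [eveEnsemble, trace_sum, Complex.re_sum, trace_smul, trace_kronecker, trace_ketbra,
    trace_traceLeft, (ψ.state_isDensity _).2, smul_eq_mul, mul_one, Complex.ofReal_re,
    Fintype.sum_prod_type]
  exact Finset.sum_comm

end Ensembles

section Distillation

variable {X B E U V K C : Type*} [Fintype B] [DecidableEq B] [Fintype U] [Fintype V]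
  [DecidableEq U] [DecidableEq V] [Fintype K] [DecidableEq K] [Fintype C] [DecidableEq C]
  {r : Processing} {W : X → U × V → ℝ}

/-- The protocol in which Alice computes `(U, V)`, publishes `V` and the hash `f U`, and uses
`g U` as her key, while Bob recovers `U` by the measurement `D` of `B V` and applies `g`. -/
noncomputable def Protocol.distill (hW : r.Allows W) (f : U → C) (g : U → K)
    (D : C → U → Matrix (B × V) (B × V) ℂ) (hD0 : ∀ c u, (D c u).PosSemidef)
    (hD1 : ∀ c, ∑ u, D c u = 1) : Protocol r X B K (V × C) where
  alice x y := ∑ z : U × V, if (g z.1, (z.2, f z.1)) = y then W x z else 0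
  alice_allowed := hW.map fun z : U × V => (g z.1, (z.2, f z.1))
  bob c k := ∑ u, if g u = k then lastBlock (D c.2 u) c.1 else 0
  bob_posSemidef c k := posSemidef_sum _ fun u _ => by
    split_ifs
    · exact (hD0 c.2 u).submatrix _
    · exact PosSemidef.zero
  bob_sum c := by
    rw [Finset.sum_comm]
    simp only [Finset.sum_ite_eq, Finset.mem_univ, if_true]
    rw [← lastBlock_sum, hD1, lastBlock_one]

theorem sum_sum_ite_mul {Y Z : Type*} [Fintype Y] [DecidableEq Y] [Fintype Z] (h : Z → Y)
    (w : Z → ℝ) (G : Y → ℝ) :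
    ∑ y, (∑ z, if h z = y then w z else 0) * G y = ∑ z, w z * G (h z) := by
  simp only [Finset.sum_mul]
  rw [Finset.sum_comm]
  simp

variable [Fintype X] [Fintype E] [DecidableEq E]

/-- The keys agree whenever Bob recovers `U`, and `deviation` measures how far Alice's key is from
being uniform and independent of the hash and of `E V`. -/
theorem Protocol.distill_errorBound_le (hW : r.Allows W) (f : U → C) (g : U → K)
    {D : C → U → Matrix (B × V) (B × V) ℂ} (hD0 : ∀ c u, (D c u).PosSemidef)
    (hD1 : ∀ c, ∑ u, D c u = 1) (ψ : CQState X (B × E)) :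
    (Protocol.distill hW f g D hD0 hD1).errorBound ψ ≤
      ∑ u, (bobEnsemble ψ W u * (1 - D (f u) u)).trace.re +
      (∑ k, ∑ c, traceNorm (deviation f g (eveEnsemble ψ W) k c)) / 2 := by
  set Q := Protocol.distill hW f g D hD0 hD1 with hQ
  have halice : ∀ x y, Q.alice x y = ∑ z : U × V, if (g z.1, (z.2, f z.1)) = y then W x z else 0 :=
    fun _ _ => rfl
  refine add_le_add ?_ ?_
  · have h1 := Q.sum_trace_aliceBlock ψ
    have h2 : ∑ k, ∑ c, (Q.block ψ k k c).trace.re = ∑ x, ∑ z : U × V, ψ.prob x * (W x z *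
        (Q.bob (z.2, f z.1) (g z.1) * traceRight (ψ.state x)).trace.re) := by
      rw [← Fintype.sum_prod_type']
      simp only [Protocol.block, trace_sum, Complex.re_sum, trace_smul, trace_traceLeft,
        smul_eq_mul, Complex.re_ofReal_mul, trace_kronecker_one_mul]
      rw [Finset.sum_comm]
      refine Finset.sum_congr rfl fun x _ => ?_
      simp only [mul_assoc, ← Finset.mul_sum, halice]
      rw [sum_sum_ite_mul (fun z : U × V => (g z.1, (z.2, f z.1))) (W x)
        (fun y => (Q.bob y.2 y.1 * traceRight (ψ.state x)).trace.re)]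
    have h3 : ∑ u, (bobEnsemble ψ W u * D (f u) u).trace.re ≤
        ∑ k, ∑ c, (Q.block ψ k k c).trace.re := by
      rw [h2]
      simp only [re_trace_bobEnsemble_mul]
      rw [Finset.sum_comm]
      refine Finset.sum_le_sum fun x _ => ?_
      rw [Fintype.sum_prod_type]
      refine Finset.sum_le_sum fun u _ => Finset.sum_le_sum fun v _ => ?_
      rw [mul_assoc]
      refine mul_le_mul_of_nonneg_left (mul_le_mul_of_nonneg_left ?_ (hW.nonneg x _))
        (ψ.prob_nonneg x)
      rw [trace_mul_comm (Q.bob _ _)]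
      refine re_trace_mul_mono (traceRight_posSemidef (ψ.state_isDensity x).1) ?_
      have h4 : Q.bob (v, f u) (g u) =
          ∑ u', if g u' = g u then lastBlock (D (f u) u') v else 0 := rfl
      rw [h4, le_iff, ← Finset.add_sum_erase _ _ (Finset.mem_univ u), if_pos rfl,
        add_sub_cancel_left]
      refine posSemidef_sum _ fun u' _ => ?_
      split_ifs
      · exact (hD0 _ _).submatrix _
      · exact PosSemidef.zero
    have h5 := sum_re_trace_bobEnsemble ψ hW
    simp only [Matrix.mul_sub, trace_sub, Complex.sub_re, Finset.sum_sub_distrib, Matrix.mul_one]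
    linarith
  · have h1 : ∀ k v c, Q.aliceBlock ψ k (v, c) = lastBlock
        (∑ u, if g u = k then (if f u = c then eveEnsemble ψ W u else 0) else 0) v :=
      fun k v c => by
        have h0 : lastBlock (0 : Matrix (E × V) (E × V) ℂ) v = 0 := rfl
        rw [lastBlock_sum]
        simp only [apply_ite (fun M => lastBlock M v), lastBlock_eveEnsemble, h0]
        simp only [Protocol.aliceBlock, halice]
        have h2 : ∀ x, ((ψ.prob x * ∑ z : U × V, if (g z.1, (z.2, f z.1)) = (k, (v, c))
            then W x z else 0 : ℝ) : ℂ) = ∑ u, if g u = k then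
              (if f u = c then ((ψ.prob x * W x (u, v) : ℝ) : ℂ) else 0) else 0 := fun x => by
          rw [Finset.mul_sum, Complex.ofReal_sum, Fintype.sum_prod_type]
          refine Finset.sum_congr rfl fun u _ => ?_
          rw [Finset.sum_eq_single v]
          · by_cases hg : g u = k <;> by_cases hf : f u = c <;> simp [hg, hf]
          · intro w _ hw
            simp [hw]
          · simp
        simp only [h2, Finset.sum_smul]
        rw [Finset.sum_comm]
        refine Finset.sum_congr rfl fun u _ => ?_
        by_cases hg : g u = k <;> by_cases hf : f u = c <;> simp [hg, hf]
    have h2 : ∀ k v c, Q.aliceBlock ψ k (v, c) - ((Fintype.card K : ℂ)⁻¹) •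
        ∑ k', Q.aliceBlock ψ k' (v, c) = lastBlock (deviation f g (eveEnsemble ψ W) k c) v :=
      fun k v c => by
        have h3 : deviation f g (eveEnsemble ψ W) k c =
            (∑ u, if g u = k then (if f u = c then eveEnsemble ψ W u else 0) else 0) -
            ((Fintype.card K : ℂ)⁻¹) •
              ∑ k', ∑ u, if g u = k' then (if f u = c then eveEnsemble ψ W u else 0) else 0 := by
          rw [Finset.sum_comm]
          simp only [Finset.sum_ite_eq, Finset.mem_univ, if_true, Finset.smul_sum]
          rw [← Finset.sum_sub_distrib, deviation]
          refine Finset.sum_congr rfl fun u _ => ?_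
          rw [keyDev]
          by_cases hg : g u = k <;> by_cases hf : f u = c <;> simp [hg, hf, sub_smul]
        simp only [h1]
        rw [← lastBlock_sum, h3]
        rfl
    have h3 : ∑ k, ∑ c : V × C, traceNorm (Q.aliceBlock ψ k c - ((Fintype.card K : ℂ)⁻¹) •
        ∑ k', Q.aliceBlock ψ k' c) ≤ ∑ k, ∑ c, traceNorm (deviation f g (eveEnsemble ψ W) k c) := by
      refine Finset.sum_le_sum fun k _ => ?_
      rw [Fintype.sum_prod_type, Finset.sum_comm]
      refine Finset.sum_le_sum fun c _ => ?_
      simp only [h2]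
      exact sum_traceNorm_lastBlock_le _
    gcongr

end Distillation

/-! ### Existence of good protocols -/

section Achievability

/-- Distributing the missing weight of the measurement does not increase the error. -/
theorem exists_hash_decoder_complete {U b : Type*} [Fintype U] [DecidableEq U] [Nonempty U]
    [Fintype b] [DecidableEq b]
    {ρ : U → Matrix b b ℂ} (hρ : ∀ u, (ρ u).PosSemidef) (M : ℕ) [NeZero M] {δ : ℝ} (hδ : 0 < δ) :
    ∃ (f : U → Fin M) (D : Fin M → U → Matrix b b ℂ), (∀ c u, (D c u).PosSemidef) ∧
      (∀ c, ∑ u, D c u = 1) ∧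
      ∑ u, (ρ u * (1 - D (f u) u)).trace.re ≤
        2 * √(2 / M) * ∑ u, (CFC.sqrt (ρ u) * CFC.sqrt (∑ u', ρ u')).trace.re
          + 4 * δ * ∑ u, (ρ u).trace.re := by
  obtain ⟨f, D, h0, h1, h⟩ := exists_hash_decoder hρ M hδ
  set u₀ : U := Classical.arbitrary U
  have hle : ∀ c u, D c u ≤ D c u + if u = u₀ then 1 - ∑ u', D c u' else 0 := fun c u => by
    rw [le_iff, add_sub_cancel_left]
    split_ifs
    · exact h1 c
    · exact PosSemidef.zero
  refine ⟨f, fun c u => D c u + if u = u₀ then 1 - ∑ u', D c u' else 0, fun c u => ?_,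
    fun c => ?_, le_trans (Finset.sum_le_sum fun u _ => ?_) h⟩
  · refine (h0 c u).add ?_
    split_ifs
    · exact h1 c
    · exact PosSemidef.zero
  · rw [Finset.sum_add_distrib]
    simp
  · exact re_trace_mul_mono (hρ u) (sub_le_sub_left (hle (f u) u) 1)

/-- A bound on the max-entropy `fidelity² < h` allows decoding from a hash of `M` values, even
though it only holds for a state `ρ'` in the vicinity of the ensemble. -/
theorem exists_decoder_of_mem_ball {U b : Type*} [Fintype U] [DecidableEq U] [Nonempty U]
    [Fintype b] [DecidableEq b] {ρ : U → Matrix b b ℂ} (hρ : ∀ u, (ρ u).PosSemidef)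
    (hρ1 : ∑ u, (ρ u).trace.re = 1) {ε₁ ε₂ h : ℝ} (hε₁ : 0 ≤ ε₁) (hε₁' : ε₁ < 1) (hε₂ : 0 < ε₂)
    {ρ' : Matrix (U × b) (U × b) ℂ} (hρ' : ρ' ∈ ball ε₁ (blockDiag ρ))
    (hh : ∀ σ : Matrix b b ℂ, IsDensity σ → fidelity ρ' ((1 : Matrix U U ℂ) ⊗ₖ σ) ^ 2 < h) :
    1 - ε₁ ^ 2 < h ∧ ∀ M : ℕ, 8 * h / ε₂ ^ 2 ≤ M →
      ∃ (f : U → Fin M) (D : Fin M → U → Matrix b b ℂ), (∀ c u, (D c u).PosSemidef) ∧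
        (∀ c, ∑ u, D c u = 1) ∧ ∑ u, (ρ u * (1 - D (f u) u)).trace.re ≤ ε₁ + ε₂ := by
  obtain ⟨S, hS1, hS2, -, hS4⟩ := exists_blocks_of_fidelity hρ hρ'.1
  have hF := one_sub_fidelity_sq_le hρ'.2
  set F := fidelity (blockDiag ρ) ρ' with hFdef
  have hF0 : 0 ≤ F := traceNorm_nonneg _
  set ω : U → Matrix b b ℂ := fun u => S u * (S u)ᴴ with hω
  have hωpos : ∀ u, (ω u).PosSemidef := fun u => posSemidef_self_mul_conjTranspose _
  set τ := ∑ u, ω u with hτ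
  have hτpos : τ.PosSemidef := posSemidef_sum _ fun u _ => hωpos u
  have hτtr : τ.trace.re = ∑ u, hs (S u) := by
    rw [hτ, trace_sum, Complex.re_sum]
    exact Finset.sum_congr rfl fun u _ => (hs_eq_trace_mul_conjTranspose _).symm
  have hR : ∑ u, hs (CFC.sqrt (ρ u)) = 1 := by
    rw [← hρ1]
    exact Finset.sum_congr rfl fun u _ => hs_sqrt (hρ u)
  have hover : ∑ u, ((CFC.sqrt (ρ u))ᴴ * S u).trace.re = F := by
    simp only [sqrt_conjTranspose]
    exact hS1
  have hFτ : F ^ 2 ≤ τ.trace.re := by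
    have h1 := sum_re_trace_mul_le_sqrt_hs Finset.univ (fun u => CFC.sqrt (ρ u)) S
    rw [hover, hR, Real.sqrt_one, one_mul, ← hτtr] at h1
    calc F ^ 2 ≤ √τ.trace.re ^ 2 := pow_le_pow_left₀ hF0 h1 2
      _ = τ.trace.re := Real.sq_sqrt (PosSemidef.trace_re_nonneg hτpos)
  set s := τ.trace.re with hs'
  have hs0 : 0 < s := by nlinarith
  have hs1 : s ≤ 1 := hτtr.trans_le hS2
  -- the normalized marginal
  have hsc : (0 : ℂ) ≤ ((s⁻¹ : ℝ) : ℂ) := by exact_mod_cast (inv_pos.mpr hs0).le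
  have hσ : IsDensity (((s⁻¹ : ℝ) : ℂ) • τ) := by
    refine ⟨hτpos.smul hsc, ?_⟩
    rw [trace_smul, PosSemidef.trace_eq_re hτpos, smul_eq_mul, ← Complex.ofReal_mul,
      inv_mul_cancel₀ hs0.ne', Complex.ofReal_one]
  set G := fidelity ρ' ((1 : Matrix U U ℂ) ⊗ₖ (((s⁻¹ : ℝ) : ℂ) • τ)) with hG
  have hG0 : 0 ≤ G := traceNorm_nonneg _
  have hGh : G ^ 2 < h := hh _ hσ
  set T := ∑ u, (CFC.sqrt (ω u) * CFC.sqrt τ).trace.re with hT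
  have hTG : T ≤ √s * G := by
    have h1 := hS4 _ hσ.1
    rw [sqrt_smul hτpos (inv_pos.mpr hs0).le] at h1
    simp only [Matrix.mul_smul, trace_smul, smul_eq_mul, Complex.re_ofReal_mul,
      ← Finset.mul_sum] at h1
    rw [Real.sqrt_inv, inv_mul_le_iff₀ (Real.sqrt_pos.mpr hs0)] at h1
    exact h1
  have hsT : s ≤ T := by
    rw [hs', hτ, trace_sum, Complex.re_sum, hT]
    refine Finset.sum_le_sum fun u _ => ?_
    have h1 : ω u ≤ τ := by
      rw [le_iff, hτ, ← Finset.add_sum_erase _ _ (Finset.mem_univ u), add_sub_cancel_left]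
      exact posSemidef_sum _ fun u' _ => hωpos u'
    have h2 := re_trace_mul_mono (sqrt_posSemidef (ω u)) (sqrt_mono h1)
    rwa [sqrt_mul_sqrt (hωpos u)] at h2
  have hsG : s ≤ G ^ 2 := by
    have h1 := Real.sqrt_pos.mpr hs0
    have h2 := Real.sq_sqrt hs0.le
    have h3 : √s * √s ≤ √s * G := by rw [← sq, h2]; exact hsT.trans hTG
    have h4 := le_of_mul_le_mul_left h3 h1
    nlinarith
  have hh0 : 0 < h := by linarith
  refine ⟨by linarith, fun M hM => ?_⟩
  have hMpos : (0 : ℝ) < M := lt_of_lt_of_le (by positivity) hM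
  have : NeZero M := ⟨by rintro rfl; simp at hMpos⟩
  have hTh : T < √h := by
    have h1 : √s ≤ 1 := Real.sqrt_le_one.mpr hs1
    have h2 : G < √h := Real.lt_sqrt_of_sq_lt hGh
    nlinarith [Real.sqrt_nonneg s]
  have hMh : 2 * √(2 / M) ≤ ε₂ / √h := by
    have h1 : √(2 / M) ≤ √((ε₂ / (2 * √h)) ^ 2) := by
      refine Real.sqrt_le_sqrt ?_
      rw [div_pow, mul_pow, Real.sq_sqrt hh0.le]
      rw [div_le_iff₀ (by positivity)] at hM
      rw [div_le_div_iff₀ hMpos (by positivity)]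
      linarith
    rw [Real.sqrt_sq (by positivity)] at h1
    calc 2 * √(2 / M) ≤ 2 * (ε₂ / (2 * √h)) := by gcongr
      _ = ε₂ / √h := by field_simp
  have hlt : 2 * √(2 / M) * T < ε₂ := by
    have h1 := Real.sqrt_pos.mpr hh0
    have h2 : 0 < T := hs0.trans_le hsT
    calc 2 * √(2 / M) * T ≤ ε₂ / √h * T := by gcongr
      _ < ε₂ / √h * √h := by gcongr
      _ = ε₂ := by field_simp
  obtain ⟨f, D, hD0, hD1, hD⟩ := exists_hash_decoder_complete hωpos M
    (δ := (ε₂ - 2 * √(2 / M) * T) / 4) (by linarith)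
  refine ⟨f, D, hD0, hD1, ?_⟩
  have hDle : ∀ u, D (f u) u ≤ 1 := fun u => by
    rw [← hD1 (f u), le_iff, ← Finset.add_sum_erase _ _ (Finset.mem_univ u), add_sub_cancel_left]
    exact posSemidef_sum _ fun u' _ => hD0 _ u'
  have hts := sum_test_le_of_overlap (R := fun u => CFC.sqrt (ρ u)) (S := S)
    (P := fun u => 1 - D (f u) u) hε₁ hR hS2 (by rw [hover]; exact hF0) (by rw [hover]; exact hF)
    (fun u => hDle u) (fun u => by rw [le_iff, sub_sub_cancel]; exact hD0 _ u)
  simp only [sqrt_conjTranspose, sqrt_mul_sqrt (hρ _)] at hts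
  have h1 : ∑ u, (ω u).trace.re = s := by rw [hs', hτ, trace_sum, Complex.re_sum]
  rw [← hτ, ← hT, h1] at hD
  have h2 : 4 * ((ε₂ - 2 * √(2 / M) * T) / 4) * s ≤ ε₂ - 2 * √(2 / M) * T := by
    nlinarith
  linarith

variable {X B E U V : Type*} [Fintype X] [Fintype B] [DecidableEq B] [Fintype E] [DecidableEq E]
  [Fintype U] [Fintype V] [DecidableEq U] [DecidableEq V] {r : Processing} {W : X → U × V → ℝ}

/-- The direct part: entropy bounds for states close to those of Bob and Eve yield a protocol. -/
theorem exists_protocol_of_mem_ball [Nonempty U] (ψ : CQState X (B × E)) (hW : r.Allows W)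
    {ε₁ ε₁' ε₂ h t : ℝ} (hε₁ : 0 ≤ ε₁) (hε₁' : 0 ≤ ε₁') (hε₂ : 0 < ε₂)
    (hε : ε₁ + ε₁' + 2 * ε₂ < 1)
    {ρB : Matrix (U × (B × V)) (U × (B × V)) ℂ} (hρB : ρB ∈ ball ε₁ (stateBob ψ W))
    (hh : ∀ σ : Matrix (B × V) (B × V) ℂ, IsDensity σ →
      fidelity ρB ((1 : Matrix U U ℂ) ⊗ₖ σ) ^ 2 < h)
    {ρE : Matrix (U × (E × V)) (U × (E × V)) ℂ} (hρE : ρE ∈ ball ε₁' (stateEve ψ W))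
    {σ : Matrix (E × V) (E × V) ℂ} (hσ : IsDensity σ) (ht : 0 < t)
    (hρσ : ρE ≤ (t : ℂ) • ((1 : Matrix U U ℂ) ⊗ₖ σ)) {n : ℕ}
    (hn : 4 * 2 ^ n * t * h < ε₂ ^ 4) :
    ∃ (M : ℕ) (Q : Protocol r X B (Fin n → Bool) (V × Fin M)),
      Q.errorBound ψ ≤ ε₁ + ε₁' + 2 * ε₂ := by
  rw [stateBob_eq] at hρB
  rw [stateEve_eq] at hρE
  obtain ⟨hh1, hdec⟩ := exists_decoder_of_mem_ball (bobEnsemble_posSemidef ψ hW)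
    (sum_re_trace_bobEnsemble ψ hW) hε₁ (by linarith) hε₂ hρB hh
  have hh0 : 2 * ε₂ ≤ h := by nlinarith
  have hhpos : 0 < h := by linarith
  -- the least number of hash values that lets Bob decode; rounding up at most doubles it
  set M := ⌈8 * h / ε₂ ^ 2⌉₊ with hM
  have hM1 : 8 * h / ε₂ ^ 2 ≤ M := Nat.le_ceil _
  have hM2 : (M : ℝ) ≤ 16 * h / ε₂ ^ 2 := by
    have h1 : 1 ≤ 8 * h / ε₂ ^ 2 := by
      rw [le_div_iff₀ (by positivity)]
      nlinarith
    have h2 := (Nat.ceil_lt_add_one (zero_le_one.trans h1)).le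
    calc (M : ℝ) ≤ 8 * h / ε₂ ^ 2 + 1 := h2
      _ ≤ 8 * h / ε₂ ^ 2 + 8 * h / ε₂ ^ 2 := by linarith
      _ = 16 * h / ε₂ ^ 2 := by ring
  have hMpos : (0 : ℝ) < M := lt_of_lt_of_le (by positivity) hM1
  obtain ⟨f, D, hD0, hD1, hD⟩ := hdec M hM1
  have hρpos := eveEnsemble_posSemidef ψ hW
  obtain ⟨S, hS1, hS2, hS3, -⟩ := exists_blocks_of_fidelity hρpos hρE.1
  have hF := one_sub_fidelity_sq_le hρE.2
  have hR : ∑ u, hs (CFC.sqrt (eveEnsemble ψ W u)) = 1 := by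
    rw [← sum_re_trace_eveEnsemble ψ hW]
    exact Finset.sum_congr rfl fun u _ => hs_sqrt (hρpos u)
  have hover : ∑ u, ((CFC.sqrt (eveEnsemble ψ W u))ᴴ * S u).trace.re =
      fidelity (blockDiag (eveEnsemble ψ W)) ρE := by
    simp only [sqrt_conjTranspose]
    exact hS1
  have hSσ : ∀ u, S u * (S u)ᴴ ≤ (t : ℂ) • σ := fun u => by
    refine (hS3 u).trans ((diagBlock_mono hρσ u).trans (le_of_eq ?_))
    rw [one_kronecker_eq_blockDiag, smul_blockDiag, diagBlock_blockDiag]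
  have hK : (Fintype.card (Fin n → Bool) : ℝ) = 2 ^ n := by simp
  -- the room that `exists_extractor` needs between `t` and `t'`, for a deviation of `2 * ε₂`
  have htt : t < 4 * ε₂ ^ 2 / (2 ^ n * M) := by
    rw [lt_div_iff₀ (by positivity)]
    have h1 : 2 ^ n * t * M ≤ 2 ^ n * t * (16 * h / ε₂ ^ 2) := by gcongr
    have h2 : 2 ^ n * t * (16 * h / ε₂ ^ 2) < 4 * ε₂ ^ 2 := by
      rw [mul_div_assoc', div_lt_iff₀ (by positivity)]
      nlinarith
    linarith
  obtain ⟨g, hg⟩ := exists_extractor (K := Fin n → Bool) hε₁' hR hS2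
    (by rw [hover]; exact hF) ht htt hσ hSσ f
  refine ⟨M, Protocol.distill hW f g D hD0 hD1,
    (Protocol.distill_errorBound_le hW f g hD0 hD1 ψ).trans ?_⟩
  simp only [sqrt_conjTranspose, sqrt_mul_sqrt (hρpos _)] at hg
  have h1 : √(Fintype.card (Fin n → Bool) * Fintype.card (Fin M) *
      (4 * ε₂ ^ 2 / (2 ^ n * M))) = 2 * ε₂ := by
    rw [hK, Fintype.card_fin, mul_div_cancel₀ _ (by positivity),
      show 4 * ε₂ ^ 2 = (2 * ε₂) ^ 2 by ring, Real.sqrt_sq (by positivity)]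
  rw [h1] at hg
  linarith

end Achievability

/-! ### Logarithms and entropies in the extended reals -/

section Logarithm

theorem log2_mono {x y : ℝ≥0∞} (h : x ≤ y) : log2 x ≤ log2 y :=
  EReal.div_le_div_right_of_nonneg (by exact_mod_cast (Real.log_pos one_lt_two).le)
    (ENNReal.log_le_log h)

theorem log2_ofReal {x : ℝ} (hx : 0 < x) :
    log2 (ENNReal.ofReal x) = ((Real.logb 2 x : ℝ) : EReal) := by
  rw [log2, ENNReal.log_ofReal_of_pos hx, ← EReal.coe_div, Real.logb]

theorem log2_one : log2 1 = 0 := by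
  rw [log2, ENNReal.log_one, EReal.zero_div]

theorem log2_top : log2 ⊤ = ⊤ := by
  rw [log2, ENNReal.log_top]
  exact EReal.top_div_of_pos_ne_top (by exact_mod_cast Real.log_pos one_lt_two)
    (EReal.coe_ne_top _)

end Logarithm

section Entropies

variable {a b : Type*} [Fintype a] [DecidableEq a] [Fintype b]

theorem neg_logb_le_hMin {ρ : Matrix (a × b) (a × b) ℂ} {σ : Matrix b b ℂ} {t : ℝ}
    (hσ : IsDensity σ) (ht : 0 < t) (h : ρ ≤ (t : ℂ) • ((1 : Matrix a a ℂ) ⊗ₖ σ)) :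
    ((-Real.logb 2 t : ℝ) : EReal) ≤ hMin ρ := by
  refine le_iSup₂_of_le σ hσ ?_
  rw [EReal.coe_neg, ← log2_ofReal ht, EReal.neg_le_neg_iff]
  exact log2_mono (iInf₂_le_of_le ⟨t, ht.le⟩ h (ENNReal.ofReal_eq_coe_nnreal ht.le).ge)

theorem hMax_nonpos [DecidableEq b] {ρ : Matrix (a × b) (a × b) ℂ}
    (h : ∀ σ : Matrix b b ℂ, IsDensity σ → fidelity ρ ((1 : Matrix a a ℂ) ⊗ₖ σ) ≤ 1) :
    hMax ρ ≤ 0 := by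
  refine iSup₂_le fun σ hσ => ?_
  have h1 : log2 (ENNReal.ofReal (fidelity ρ ((1 : Matrix a a ℂ) ⊗ₖ σ))) ≤ 0 := by
    rw [← log2_one]
    exact log2_mono (by simpa using ENNReal.ofReal_le_ofReal (h σ hσ))
  exact mul_nonpos_of_nonneg_of_nonpos (by norm_num) h1

theorem exists_le_smul_of_lt_hMin {ρ : Matrix (a × b) (a × b) ℂ} {s : ℝ}
    (h : (s : EReal) < hMin ρ) : ∃ (σ : Matrix b b ℂ) (t : ℝ), IsDensity σ ∧ 0 < t ∧
      t < (2 : ℝ) ^ (-s) ∧ ρ ≤ (t : ℂ) • ((1 : Matrix a a ℂ) ⊗ₖ σ) := by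
  obtain ⟨σ, hσ, h1⟩ := by simpa only [hMin, lt_iSup_iff] using h
  have hs : (0 : ℝ) < 2 ^ (-s) := Real.rpow_pos_of_pos two_pos _
  have h2 : lambdaMin ρ σ < ENNReal.ofReal (2 ^ (-s)) := by
    by_contra! h3
    have h4 := log2_mono h3
    rw [log2_ofReal hs, Real.logb_rpow two_pos (by norm_num), EReal.coe_neg, EReal.neg_le] at h4
    exact absurd h1 h4.not_gt
  obtain ⟨t, ht, h3⟩ := by simpa only [lambdaMin, iInf_lt_iff] using h2
  rw [ENNReal.ofReal, ENNReal.coe_lt_coe, Real.lt_toNNReal_iff_coe_lt] at h3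
  -- the least constant may be zero, so it is enlarged slightly
  refine ⟨σ, ((t : ℝ) + 2 ^ (-s)) / 2, hσ, by positivity, by linarith, le_trans
    (show ρ ≤ _ from ht) ?_⟩
  rw [le_iff, ← sub_smul]
  refine (PosSemidef.one.kronecker hσ.1).smul ?_
  rw [← Complex.ofReal_sub]
  exact_mod_cast (by linarith : (0 : ℝ) ≤ ((t : ℝ) + 2 ^ (-s)) / 2 - t)

theorem fidelity_sq_lt_of_hMax_lt [DecidableEq b] {ρ : Matrix (a × b) (a × b) ℂ} {s : ℝ}
    (h : hMax ρ < (s : EReal)) {σ : Matrix b b ℂ} (hσ : IsDensity σ) :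
    fidelity ρ ((1 : Matrix a a ℂ) ⊗ₖ σ) ^ 2 < (2 : ℝ) ^ s := by
  by_contra! h1
  have h2 : (2 : ℝ) ^ (s / 2) ≤ fidelity ρ ((1 : Matrix a a ℂ) ⊗ₖ σ) := by
    refine (sq_le_sq₀ (Real.rpow_nonneg two_pos.le _) (traceNorm_nonneg _)).mp ?_
    rwa [← Real.rpow_natCast, ← Real.rpow_mul two_pos.le, Nat.cast_ofNat, div_mul_cancel₀ _
      two_ne_zero]
  have h3 := log2_mono (ENNReal.ofReal_le_ofReal h2)
  rw [log2_ofReal (Real.rpow_pos_of_pos two_pos _), Real.logb_rpow two_pos (by norm_num)] at h3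
  have h4 : (s : EReal) ≤
      2 * log2 (ENNReal.ofReal (fidelity ρ ((1 : Matrix a a ℂ) ⊗ₖ σ))) := by
    refine le_trans (le_of_eq ?_) (mul_le_mul_of_nonneg_left h3 (by norm_num))
    rw [show (2 : EReal) = ((2 : ℝ) : EReal) from rfl, ← EReal.coe_mul]
    congr 1
    ring
  exact absurd (h4.trans (le_iSup₂_of_le (f := fun σ _ => 2 * log2 (ENNReal.ofReal
    (fidelity ρ ((1 : Matrix a a ℂ) ⊗ₖ σ)))) σ hσ le_rfl)) h.not_ge

end Entropies

/-! ### The lower bound on the key length -/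


section DirectBound

variable {X B E : Type*} [Fintype X] [Fintype B] [DecidableEq B] [Fintype E] [DecidableEq E]
  {r : Processing}

theorem keyLength_nonneg (ψ : CQState X (B × E)) {ε : ℝ} (hε : 0 ≤ ε) : 0 ≤ keyLength r ε ψ := by
  have h1 := le_keyLength (n := 0) (ε := ε) (Protocol.trivial r X B (fun _ => true)) ψ (by
    refine (Protocol.trivial_errorBound_le _ ψ).trans (le_trans (le_of_eq ?_) hε)
    simp [keyDev, Subsingleton.elim _ (fun _ : Fin 0 => true)])
  simpa using h1

/-- Two constant keys are already `1`-good, whatever their length. -/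
theorem keyLength_eq_top (ψ : CQState X (B × E)) {ε : ℝ} (hε : 1 ≤ ε) : keyLength r ε ψ = ⊤ := by
  rw [EReal.eq_top_iff_forall_lt]
  intro y
  obtain ⟨n, hn⟩ := exists_nat_gt y
  refine lt_of_lt_of_le (EReal.coe_lt_coe_iff.mpr hn)
    (le_keyLength (Protocol.trivial r X B (fun _ => true)) ψ ?_)
  have h1 := Protocol.trivial_errorBound_le (r := r) (fun _ : Fin n => true) ψ
  have h2 := sum_abs_keyDev_le (fun _ : Fin n => true)
  linarith

/-- The lower bound on the key length for a fixed pair `(U, V)`, with reals below the min-entropy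
and above the max-entropy. -/
theorem le_keyLength_of_lt_hMinSmooth {k l : ℕ} {W : X → Fin k × Fin l → ℝ}
    (ψ : CQState X (B × E)) (hW : r.Allows W) {ε₁ ε₁' ε₂ s₁ s₂ : ℝ} (hε₁ : 0 ≤ ε₁)
    (hε₁' : 0 ≤ ε₁') (hε₂ : 0 < ε₂) (h₁ : (s₁ : EReal) < hMinSmooth ε₁' (stateEve ψ W))
    (h₂ : hMaxSmooth ε₁ (stateBob ψ W) < (s₂ : EReal)) :
    ((s₁ - s₂ - (4 * Real.logb 2 (1 / ε₂) + 3) : ℝ) : EReal) ≤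
      keyLength r (ε₁ + ε₂ + (ε₁' + ε₂)) ψ := by
  rcases le_or_gt 1 (ε₁ + ε₂ + (ε₁' + ε₂)) with hε | hε
  · rw [keyLength_eq_top ψ hε]
    exact le_top
  set q := s₁ - s₂ - (4 * Real.logb 2 (1 / ε₂) + 3) with hq
  rcases le_or_gt q 0 with hq0 | hq0
  · exact le_trans (by exact_mod_cast hq0) (keyLength_nonneg ψ (by positivity))
  have : Nonempty (Fin k) := by
    have h1 : Nonempty X := by
      by_contra h
      rw [not_nonempty_iff] at h
      simpa using ψ.prob_sum
    obtain ⟨x⟩ := h1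
    by_contra h
    rw [not_nonempty_iff] at h
    simpa using hW.sum_eq_one x
  -- the key has `⌈q⌉₊ < q + 1` bits
  obtain ⟨ρE, hρE, h3⟩ := by simpa only [hMinSmooth, lt_iSup_iff] using h₁
  obtain ⟨ρB, hρB, h4⟩ := by simpa only [hMaxSmooth, iInf_lt_iff] using h₂
  obtain ⟨σ, t, hσ, ht, hts, hρσ⟩ := exists_le_smul_of_lt_hMin h3
  have hn : 4 * 2 ^ ⌈q⌉₊ * t * 2 ^ s₂ < ε₂ ^ 4 := by
    have h5 : (2 : ℝ) ^ ⌈q⌉₊ ≤ 2 * 2 ^ q := by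
      rw [← Real.rpow_natCast, ← Real.rpow_one_add' two_pos.le (by linarith)]
      exact Real.rpow_le_rpow_of_exponent_le one_le_two
        (by linarith [Nat.ceil_lt_add_one hq0.le])
    have h6 : (2 : ℝ) ^ q = 2 ^ s₁ / 2 ^ s₂ * (ε₂ ^ 4 / 8) := by
      have h7 : (2 : ℝ) ^ (4 * Real.logb 2 (1 / ε₂) + 3) = 8 / ε₂ ^ 4 := by
        rw [Real.rpow_add two_pos, mul_comm (4 : ℝ), Real.rpow_mul two_pos.le,
          Real.rpow_logb two_pos (by norm_num) (by positivity), show (4 : ℝ) = (4 : ℕ) by norm_num,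
          show (3 : ℝ) = (3 : ℕ) by norm_num, Real.rpow_natCast, Real.rpow_natCast, one_div,
          inv_pow]
        ring
      rw [hq, Real.rpow_sub two_pos, Real.rpow_sub two_pos, h7]
      field_simp
    have hs1 : (0 : ℝ) < 2 ^ s₁ := Real.rpow_pos_of_pos two_pos _
    have hs2 : (0 : ℝ) < 2 ^ s₂ := Real.rpow_pos_of_pos two_pos _
    rw [Real.rpow_neg two_pos.le] at hts
    calc 4 * 2 ^ ⌈q⌉₊ * t * 2 ^ s₂ ≤ 4 * (2 * 2 ^ q) * t * 2 ^ s₂ := by gcongr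
      _ < 4 * (2 * 2 ^ q) * (2 ^ s₁)⁻¹ * 2 ^ s₂ := by
          have : (0 : ℝ) < 2 ^ q := Real.rpow_pos_of_pos two_pos _
          gcongr
      _ = ε₂ ^ 4 := by
          rw [h6]
          field_simp
          ring
  obtain ⟨M, Q, hQ⟩ := exists_protocol_of_mem_ball ψ hW hε₁ hε₁' hε₂ (by linarith) hρB
    (fun σ hσ => fidelity_sq_lt_of_hMax_lt h4 hσ) hρE hσ ht hρσ hn
  exact le_trans (EReal.coe_le_coe_iff.mpr (Nat.le_ceil q)) (le_keyLength Q ψ (by linarith))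

theorem entropyGap_sub_le_keyLength (ψ : CQState X (B × E)) {ε₁ ε₁' ε₂ : ℝ} (hε₁ : 0 ≤ ε₁)
    (hε₁' : 0 ≤ ε₁') (hε₂ : 0 ≤ ε₂) :
    entropyGap r ε₁' ε₁ ψ - 4 * log2 (1 / ENNReal.ofReal ε₂) - 3 ≤
      keyLength r (ε₁ + ε₂ + (ε₁' + ε₂)) ψ := by
  rcases hε₂.eq_or_lt with rfl | hε₂
  · rw [ENNReal.ofReal_zero, ENNReal.div_zero one_ne_zero, log2_top,
      show (4 : EReal) = ((4 : ℝ) : EReal) from rfl, EReal.coe_mul_top_of_pos (by norm_num),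
      EReal.sub_top, EReal.bot_sub]
    exact bot_le
  have h1 : 4 * log2 (1 / ENNReal.ofReal ε₂) = ((4 * Real.logb 2 (1 / ε₂) : ℝ) : EReal) := by
    rw [← ENNReal.ofReal_one, ← ENNReal.ofReal_div_of_pos hε₂, log2_ofReal (by positivity),
      EReal.coe_mul]
    rfl
  have hsub : ∀ (s : ℝ) (x y : EReal), x - s ≤ y ↔ x ≤ y + s := fun s x y =>
    EReal.sub_le_iff_le_add (.inl (EReal.coe_ne_bot s)) (.inl (EReal.coe_ne_top s))
  rw [h1, show (3 : EReal) = ((3 : ℝ) : EReal) from rfl, hsub, hsub]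
  refine iSup_le fun k => iSup_le fun l => iSup_le fun W => iSup_le fun hW => ?_
  rw [sub_eq_add_neg]
  refine EReal.add_le_of_forall_lt fun x hx y hy => ?_
  induction x with
  | bot => simp
  | top => exact absurd hx not_top_lt
  | coe x =>
    induction y with
    | bot => simp
    | top => exact absurd hy not_top_lt
    | coe y =>
      have h2 := le_keyLength_of_lt_hMinSmooth ψ hW hε₁ hε₁' hε₂ (s₂ := -y) hx
        (by rw [EReal.coe_neg]; exact EReal.lt_neg_comm.mp hy)
      rw [← hsub, ← hsub, ← EReal.coe_add, ← EReal.coe_sub, ← EReal.coe_sub]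
      refine le_trans (le_of_eq ?_) h2
      congr 1
      ring

end DirectBound

/-! ### Gentle measurement and the blocks of a good key -/

section GentleMeasurement

variable {d : Type*} [Fintype d] [DecidableEq d]

theorem traceNorm_conjTranspose (A : Matrix d d ℂ) : traceNorm Aᴴ = traceNorm A := by
  have key : ∀ A : Matrix d d ℂ, traceNorm A ≤ traceNorm Aᴴ := fun A =>
    traceNorm_le_of_forall fun T hT => by
      have h := re_trace_mul_le_traceNorm Aᴴ (S := Tᴴ) (by
        rw [conjTranspose_conjTranspose]; exact conjTranspose_mul_self_le_one hT)
      rw [trace_mul_comm, ← conjTranspose_mul, trace_conjTranspose] at h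
      simpa using h
  exact le_antisymm (by simpa using key Aᴴ) (key A)

theorem fidelity_comm (ρ σ : Matrix d d ℂ) : fidelity ρ σ = fidelity σ ρ := by
  rw [fidelity, ← traceNorm_conjTranspose, conjTranspose_mul, sqrt_conjTranspose,
    sqrt_conjTranspose]
  rfl

theorem sqrt_mul_sqrt_mul_conjTranspose (L : Matrix d d ℂ) {ρ : Matrix d d ℂ}
    (hρ : ρ.PosSemidef) : (CFC.sqrt L * CFC.sqrt ρ) * (CFC.sqrt L * CFC.sqrt ρ)ᴴ =
      CFC.sqrt L * ρ * CFC.sqrt L := by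
  rw [conjTranspose_mul, sqrt_conjTranspose, sqrt_conjTranspose]
  conv_rhs => rw [← sqrt_mul_sqrt hρ]
  simp only [Matrix.mul_assoc]

/-- The state after a measurement outcome of probability `tr (L ρ)` close to one is close to the
state before the measurement. -/
theorem re_trace_mul_le_fidelity {ρ L : Matrix d d ℂ} (hρ : ρ.PosSemidef) (hL0 : L.PosSemidef)
    (hL1 : L ≤ 1) : (ρ * L).trace.re ≤ fidelity ρ (CFC.sqrt L * ρ * CFC.sqrt L) := by
  set X := CFC.sqrt L * CFC.sqrt ρ with hX
  have h1 : X * Xᴴ = CFC.sqrt L * ρ * CFC.sqrt L := sqrt_mul_sqrt_mul_conjTranspose L hρ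
  have hLs : L ≤ CFC.sqrt L := by
    have h2 := sqrt_mono (mul_self_le_self hL0 hL1)
    rwa [CFC.sqrt_mul_self L (nonneg_iff_posSemidef.mpr hL0)] at h2
  rw [fidelity_comm, ← h1, ← traceNorm_conjTranspose_mul_sqrt]
  refine (re_trace_mul_mono hρ hLs).trans (le_trans (le_of_eq ?_) (re_trace_le_traceNorm _))
  rw [hX, conjTranspose_mul, sqrt_conjTranspose, sqrt_conjTranspose, trace_mul_comm,
    Matrix.mul_assoc, trace_mul_comm (CFC.sqrt ρ), Matrix.mul_assoc, sqrt_mul_sqrt hρ]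

/-- Cauchy–Schwarz for `√ρ √L` and `√L √τ`. -/
theorem fidelity_conj_le {ρ L τ : Matrix d d ℂ} (hρ : ρ.PosSemidef) (hL : L.PosSemidef)
    (hτ : τ.PosSemidef) : fidelity (CFC.sqrt L * ρ * CFC.sqrt L) τ ≤
      √ρ.trace.re * √(L * τ).trace.re := by
  set X := CFC.sqrt L * CFC.sqrt ρ with hX
  have h1 : X * Xᴴ = CFC.sqrt L * ρ * CFC.sqrt L := sqrt_mul_sqrt_mul_conjTranspose L hρ
  have h2 : hs (CFC.sqrt L * CFC.sqrt τ) = (L * τ).trace.re := by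
    rw [hs, conjTranspose_mul, sqrt_conjTranspose, sqrt_conjTranspose, Matrix.mul_assoc,
      trace_mul_comm, ← Matrix.mul_assoc (CFC.sqrt L), sqrt_mul_sqrt hL, Matrix.mul_assoc,
      sqrt_mul_sqrt hτ]
  rw [← h1, ← traceNorm_conjTranspose_mul_sqrt, hX, conjTranspose_mul, sqrt_conjTranspose,
    sqrt_conjTranspose, Matrix.mul_assoc, ← hs_sqrt hρ, ← h2]
  exact traceNorm_mul_le _ _

end GentleMeasurement

section Converse

variable {X B E K C : Type*} [Fintype X] [Fintype B] [DecidableEq B] [Fintype E]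
  [Fintype K] [DecidableEq K] [Fintype C] [DecidableEq C] {r : Processing}

variable [DecidableEq E]

/-- The distance from an ideal key controls the distances of the blocks. -/
theorem Protocol.sum_traceNorm_block_le (Q : Protocol r X B K C) (ψ : CQState X (B × E)) :
    ∑ k, ∑ k', ∑ c, traceNorm (Q.block ψ k k' c -
      (if k = k' then ((Fintype.card K : ℂ)⁻¹) else 0) • ∑ k, Q.aliceBlock ψ k c) ≤
    2 * traceDist (Q.output ψ) (idealKey K ⊗ₖ traceLeft (Q.output ψ)) := by
  rw [traceDist, mul_div_cancel₀ _ two_ne_zero, Q.output_sub_idealKey]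
  refine le_trans ?_ (sum_traceNorm_diagBlock_le _)
  rw [Fintype.sum_prod_type]
  refine Finset.sum_le_sum fun k _ => Finset.sum_le_sum fun k' _ => ?_
  rw [diagBlock_blockDiag]
  refine le_trans (le_of_eq ?_) (sum_traceNorm_diagBlock_le _)
  simp only [diagBlock_blockDiag]

/-- Summing over Bob's key does not increase the trace norms. -/
theorem Protocol.sum_traceNorm_aliceBlock_le (Q : Protocol r X B K C) (ψ : CQState X (B × E)) :
    ∑ k, ∑ c, traceNorm (Q.aliceBlock ψ k c -
      ((Fintype.card K : ℂ)⁻¹) • ∑ k, Q.aliceBlock ψ k c) ≤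
    2 * traceDist (Q.output ψ) (idealKey K ⊗ₖ traceLeft (Q.output ψ)) := by
  refine le_trans (Finset.sum_le_sum fun k _ => ?_) (Q.sum_traceNorm_block_le ψ)
  rw [Finset.sum_comm]
  refine Finset.sum_le_sum fun c _ => le_trans (le_of_eq ?_) (traceNorm_sum_le _ _)
  rw [Finset.sum_sub_distrib, Q.sum_block, ← Finset.sum_smul]
  simp

/-- The right-hand side is the probability that the two keys agree. -/
theorem Protocol.one_sub_traceDist_le (Q : Protocol r X B K C) [Nonempty K]
    (ψ : CQState X (B × E)) :
    1 - traceDist (Q.output ψ) (idealKey K ⊗ₖ traceLeft (Q.output ψ)) ≤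
      ∑ k, ∑ c, (Q.block ψ k k c).trace.re := by
  have h := Q.sum_traceNorm_block_le ψ
  set T : ℝ := ∑ k, ∑ c, (Q.aliceBlock ψ k c).trace.re with hT
  have hT1 : T = 1 := Q.sum_trace_aliceBlock ψ
  have hK : (Fintype.card K : ℝ) ≠ 0 := by exact_mod_cast Fintype.card_ne_zero
  -- test each block with the sign `-1` on the diagonal and `1` off the diagonal
  have h1 : ∀ k k' c, (if k = k' then -1 else 1) * ((Q.block ψ k k' c).trace.re -
      (if k = k' then ((Fintype.card K : ℝ)⁻¹) else 0) * ∑ k, (Q.aliceBlock ψ k c).trace.re) ≤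
      traceNorm (Q.block ψ k k' c -
      (if k = k' then ((Fintype.card K : ℂ)⁻¹) else 0) • ∑ k, Q.aliceBlock ψ k c) :=
    fun k k' c => by
      have h2 : (Q.block ψ k k' c - (if k = k' then ((Fintype.card K : ℂ)⁻¹) else 0) •
          ∑ k, Q.aliceBlock ψ k c).trace.re = (Q.block ψ k k' c).trace.re -
          (if k = k' then ((Fintype.card K : ℝ)⁻¹) else 0) *
            ∑ k, (Q.aliceBlock ψ k c).trace.re := by
        rw [trace_sub, Complex.sub_re, trace_smul, trace_sum, smul_eq_mul, ← Complex.re_sum,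
          ← Complex.re_ofReal_mul]
        split_ifs <;> simp
      rw [← h2]
      split_ifs
      · rw [neg_one_mul, ← traceNorm_neg, ← Complex.neg_re, ← trace_neg]
        exact re_trace_le_traceNorm _
      · rw [one_mul]
        exact re_trace_le_traceNorm _
  have h2 := (Finset.sum_le_sum fun k _ => Finset.sum_le_sum fun k' _ =>
    Finset.sum_le_sum fun c _ => h1 k k' c).trans h
  have h3 : ∀ k, ∑ k', ∑ c, (if k = k' then -1 else 1) * ((Q.block ψ k k' c).trace.re -
      (if k = k' then ((Fintype.card K : ℝ)⁻¹) else 0) * ∑ k, (Q.aliceBlock ψ k c).trace.re) =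
      ∑ c, (Q.aliceBlock ψ k c).trace.re - 2 * ∑ c, (Q.block ψ k k c).trace.re +
        (Fintype.card K : ℝ)⁻¹ * T := fun k => by
    have hT' : T = ∑ c, ∑ k, (Q.aliceBlock ψ k c).trace.re := Finset.sum_comm
    rw [Finset.sum_comm, hT', Finset.mul_sum, Finset.mul_sum, ← Finset.sum_sub_distrib,
      ← Finset.sum_add_distrib]
    refine Finset.sum_congr rfl fun c _ => ?_
    rw [← Q.sum_block ψ k c, trace_sum, Complex.re_sum, ← Finset.add_sum_erase _ _
      (Finset.mem_univ k), ← Finset.add_sum_erase _ (fun k' => (Q.block ψ k k' c).trace.re)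
      (Finset.mem_univ k), if_pos rfl, if_pos rfl]
    have h4 : ∑ k' ∈ Finset.univ.erase k, (if k = k' then -1 else 1) *
        ((Q.block ψ k k' c).trace.re - (if k = k' then ((Fintype.card K : ℝ)⁻¹) else 0) *
          ∑ k, (Q.aliceBlock ψ k c).trace.re) =
        ∑ k' ∈ Finset.univ.erase k, (Q.block ψ k k' c).trace.re :=
      Finset.sum_congr rfl fun k' hk' => by
        rw [if_neg (Finset.ne_of_mem_erase hk').symm, if_neg (Finset.ne_of_mem_erase hk').symm]
        ring
    rw [h4]
    ring
  rw [Finset.sum_congr rfl fun k _ => h3 k, Finset.sum_add_distrib, Finset.sum_sub_distrib,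
    ← Finset.mul_sum, ← hT, Finset.sum_const, Finset.card_univ, nsmul_eq_mul, ← mul_assoc,
    mul_inv_cancel₀ hK, hT1] at h2
  linarith

end Converse

/-! ### The upper bound on the key length -/




section ConverseBound

variable {X B E K C U : Type*} [Fintype B] [DecidableEq B] [Fintype K] [DecidableEq K]
  [Fintype C] [DecidableEq C] {r : Processing}

/-- Alice's computation of the key and the message, with the keys labelled by `U`. -/
def Protocol.aliceMap (Q : Protocol r X B K C) (e : U ≃ K) (x : X) (y : U × C) : ℝ :=
  Q.alice x (e y.1, y.2)

theorem Protocol.aliceMap_allowed [Fintype U] [DecidableEq U] (Q : Protocol r X B K C) (e : U ≃ K) :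
    r.Allows (Q.aliceMap e) :=
  Q.alice_allowed.comp_equiv (e.prodCongr (Equiv.refl C))

variable [Fintype X] [Fintype E]

theorem Protocol.eveEnsemble_aliceMap (Q : Protocol r X B K C) (e : U ≃ K)
    (ψ : CQState X (B × E)) (u : U) : eveEnsemble ψ (Q.aliceMap e) u =
      (blockDiag fun c => Q.aliceBlock ψ (e u) c).submatrix (Equiv.prodComm E C)
        (Equiv.prodComm E C) := by
  rw [← sum_ketbra_kronecker]
  ext p q
  simp only [eveEnsemble, Protocol.aliceBlock, Protocol.aliceMap, submatrix_apply,
    Matrix.sum_apply, Matrix.smul_apply, kroneckerMap_apply, smul_eq_mul, Finset.mul_sum,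
    Equiv.prodComm_apply, Prod.fst_swap, Prod.snd_swap]
  rw [Finset.sum_comm]
  exact Finset.sum_congr rfl fun c _ => Finset.sum_congr rfl fun x _ => by ring

variable [DecidableEq E] [Fintype U]

theorem Protocol.sum_traceNorm_eveEnsemble_le (Q : Protocol r X B K C) (e : U ≃ K)
    (ψ : CQState X (B × E)) :
    ∑ u, traceNorm (eveEnsemble ψ (Q.aliceMap e) u -
      ((Fintype.card K : ℂ)⁻¹) • ∑ u, eveEnsemble ψ (Q.aliceMap e) u) ≤
    2 * traceDist (Q.output ψ) (idealKey K ⊗ₖ traceLeft (Q.output ψ)) := by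
  refine le_trans ?_ (Q.sum_traceNorm_aliceBlock_le ψ)
  rw [← e.sum_comp]
  refine Finset.sum_le_sum fun u _ => ?_
  have h1 : eveEnsemble ψ (Q.aliceMap e) u -
      ((Fintype.card K : ℂ)⁻¹) • ∑ u, eveEnsemble ψ (Q.aliceMap e) u =
      (blockDiag fun c => Q.aliceBlock ψ (e u) c -
        ((Fintype.card K : ℂ)⁻¹) • ∑ k, Q.aliceBlock ψ k c).submatrix (Equiv.prodComm E C)
        (Equiv.prodComm E C) := by
    have h2 : ∑ u, eveEnsemble ψ (Q.aliceMap e) u =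
        (blockDiag fun c => ∑ k, Q.aliceBlock ψ k c).submatrix (Equiv.prodComm E C)
          (Equiv.prodComm E C) := by
      rw [← blockDiag_sum, ← e.sum_comp]
      ext p q
      simp only [Q.eveEnsemble_aliceMap, Matrix.sum_apply, submatrix_apply]
    rw [h2, Q.eveEnsemble_aliceMap, ← blockDiag_sub, ← smul_blockDiag]
    rfl
  rw [h1, traceNorm_submatrix_equiv]
  exact traceNorm_blockDiag_le _

variable [DecidableEq U]

/-- The nearby state is `1 / |K| ⊗ τ`, where `τ` is the state of `E` and the message. -/
theorem Protocol.logb_card_le_hMinSmooth (Q : Protocol r X B K C) [Nonempty K] (e : U ≃ K)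
    (ψ : CQState X (B × E)) {ε : ℝ} (h : IsGoodKey ε (Q.output ψ)) :
    ((Real.logb 2 (Fintype.card K) : ℝ) : EReal) ≤
      hMinSmooth √(2 * ε) (stateEve ψ (Q.aliceMap e)) := by
  have hW := Q.aliceMap_allowed e
  set τ := ∑ u, eveEnsemble ψ (Q.aliceMap e) u with hτdef
  have hK : (0 : ℝ) < Fintype.card K := by exact_mod_cast Fintype.card_pos
  have hτ : IsDensity τ := by
    have h1 : τ.PosSemidef := posSemidef_sum _ fun u _ => eveEnsemble_posSemidef ψ hW u
    refine ⟨h1, ?_⟩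
    rw [PosSemidef.trace_eq_re h1, hτdef, trace_sum, Complex.re_sum,
      sum_re_trace_eveEnsemble ψ hW, Complex.ofReal_one]
  have hU : Fintype.card U = Fintype.card K := Fintype.card_congr e
  set ρ' : Matrix (U × (E × C)) (U × (E × C)) ℂ :=
    ((Fintype.card K : ℂ)⁻¹) • ((1 : Matrix U U ℂ) ⊗ₖ τ) with hρ'def
  have hρ'eq : ρ' = blockDiag fun _ => ((Fintype.card K : ℂ)⁻¹) • τ := by
    rw [hρ'def, one_kronecker_eq_blockDiag, smul_blockDiag]
  have hρ' : IsDensity ρ' := by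
    refine ⟨(PosSemidef.one.kronecker hτ.1).smul (by positivity), ?_⟩
    rw [hρ'def, trace_smul, trace_kronecker, hτ.2, trace_one, hU, smul_eq_mul, mul_one,
      inv_mul_cancel₀ (by exact_mod_cast hK.ne')]
  have hρ : IsDensity (stateEve ψ (Q.aliceMap e)) := by
    have h1 : (stateEve ψ (Q.aliceMap e)).PosSemidef := by
      rw [stateEve_eq]
      exact blockDiag_posSemidef fun u => eveEnsemble_posSemidef ψ hW u
    refine ⟨h1, ?_⟩
    rw [PosSemidef.trace_eq_re h1, stateEve_eq, trace_eq_sum_diagBlock, Complex.re_sum]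
    simp only [diagBlock_blockDiag]
    rw [sum_re_trace_eveEnsemble ψ hW, Complex.ofReal_one]
  have hdist : traceDist (stateEve ψ (Q.aliceMap e)) ρ' ≤ ε := by
    refine le_trans ?_ h
    rw [traceDist, div_le_iff₀ two_pos, mul_comm, stateEve_eq, hρ'eq, blockDiag_sub]
    exact (traceNorm_blockDiag_le _).trans (Q.sum_traceNorm_eveEnsemble_le e ψ)
  have hball : ρ' ∈ ball √(2 * ε) (stateEve ψ (Q.aliceMap e)) :=
    ⟨⟨hρ'.1, by rw [hρ'.2, Complex.one_re]⟩, purifDist_le_sqrt_two_mul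
      (by linarith [one_sub_traceDist_le_fidelity hρ hρ'])⟩
  refine le_trans ?_ (le_iSup₂_of_le (f := fun ρ' _ => hMin ρ') ρ' hball le_rfl)
  have h1 := neg_logb_le_hMin hτ (inv_pos.mpr hK)
    (show ρ' ≤ (((Fintype.card K : ℝ)⁻¹ : ℝ) : ℂ) • ((1 : Matrix U U ℂ) ⊗ₖ τ) by
      rw [hρ'def]; push_cast; exact le_rfl)
  rwa [Real.logb_inv, neg_neg] at h1

/-- The nearby state is the one in which Bob's measurement has confirmed Alice's key. -/
theorem Protocol.hMaxSmooth_nonpos (Q : Protocol r X B K C) [Nonempty K] (e : U ≃ K)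
    (ψ : CQState X (B × E)) {ε : ℝ} (h : IsGoodKey ε (Q.output ψ)) :
    hMaxSmooth √(2 * ε) (stateBob ψ (Q.aliceMap e)) ≤ 0 := by
  have hW := Q.aliceMap_allowed e
  -- the measurement of `B C`: read the message, then apply Bob's measurement
  set Λ : U → Matrix (B × C) (B × C) ℂ := fun u => ∑ c, Q.bob c (e u) ⊗ₖ ketbra c with hΛdef
  have hΛ0 : ∀ u, (Λ u).PosSemidef := fun u => posSemidef_sum _ fun c _ =>
    (Q.bob_posSemidef c (e u)).kronecker (ketbra_posSemidef c)
  have hΛsum : ∑ u, Λ u = 1 := by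
    ext p q
    have h1 : ∀ c, ∑ u, Q.bob c (e u) p.1 q.1 = (1 : Matrix B B ℂ) p.1 q.1 := fun c => by
      rw [← Q.bob_sum c, Matrix.sum_apply, ← e.sum_comp]
    simp only [hΛdef, Matrix.sum_apply, kroneckerMap_apply]
    rw [Finset.sum_comm]
    simp only [← Finset.sum_mul, h1, ketbra, single_apply, one_apply]
    rw [← Finset.mul_sum]
    obtain ⟨p1, p2⟩ := p
    obtain ⟨q1, q2⟩ := q
    by_cases h2 : p2 = q2
    · subst h2
      simp
    · have h3 : ∀ c, ¬ (c = p2 ∧ c = q2) := fun c h => h2 (h.1.symm.trans h.2)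
      simp [h2, h3]
  have hΛ1 : ∀ u, Λ u ≤ 1 := fun u => by
    rw [le_iff, ← hΛsum, ← Finset.add_sum_erase _ _ (Finset.mem_univ u), add_sub_cancel_left]
    exact posSemidef_sum _ fun u' _ => hΛ0 u'
  set L := blockDiag Λ with hLdef
  have hL0 : L.PosSemidef := blockDiag_posSemidef hΛ0
  have hL1 : L ≤ 1 := by
    rw [← blockDiag_one]
    exact blockDiag_mono hΛ1
  set ρ := stateBob ψ (Q.aliceMap e) with hρdef
  have hρeq : ρ = blockDiag (bobEnsemble ψ (Q.aliceMap e)) := stateBob_eq _ _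
  have hρ0 : ρ.PosSemidef := by
    rw [hρeq]
    exact blockDiag_posSemidef fun u => bobEnsemble_posSemidef ψ hW u
  have hρ1 : ρ.trace.re = 1 := by
    rw [hρeq, trace_eq_sum_diagBlock, Complex.re_sum]
    simp only [diagBlock_blockDiag]
    exact sum_re_trace_bobEnsemble ψ hW
  have hlast : ∀ u c, lastBlock (Λ u) c = Q.bob c (e u) := fun u c => by
    rw [hΛdef, lastBlock_sum]
    simp [lastBlock_kronecker_ketbra]
  have hprob : (ρ * L).trace.re = ∑ k, ∑ c, (Q.block ψ k k c).trace.re := by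
    rw [hρeq, hLdef, blockDiag_mul, trace_eq_sum_diagBlock, Complex.re_sum, ← e.sum_comp]
    refine Finset.sum_congr rfl fun u _ => ?_
    rw [diagBlock_blockDiag, re_trace_bobEnsemble_mul, Finset.sum_comm]
    refine Finset.sum_congr rfl fun c _ => ?_
    simp only [hlast, Protocol.block, trace_sum, Complex.re_sum, trace_smul, trace_traceLeft,
      smul_eq_mul, Complex.re_ofReal_mul, trace_kronecker_one_mul, Protocol.aliceMap]
    exact Finset.sum_congr rfl fun x _ => by rw [trace_mul_comm]
  have hfid : 1 - ε ≤ fidelity ρ (CFC.sqrt L * ρ * CFC.sqrt L) := by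
    refine le_trans ?_ (re_trace_mul_le_fidelity hρ0 hL0 hL1)
    rw [hprob]
    exact le_trans (sub_le_sub_left h 1) (Q.one_sub_traceDist_le ψ)
  set ρ' := CFC.sqrt L * ρ * CFC.sqrt L with hρ'def
  have hρ'0 : ρ'.PosSemidef := by
    have h1 := hρ0.mul_mul_conjTranspose_same (CFC.sqrt L)
    rwa [sqrt_conjTranspose] at h1
  have hρ'1 : ρ'.trace.re ≤ 1 := by
    rw [hρ'def, trace_mul_comm, ← Matrix.mul_assoc, sqrt_mul_sqrt hL0, trace_mul_comm, ← hρ1]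
    have h1 := re_trace_mul_mono hρ0 hL1
    rwa [Matrix.mul_one] at h1
  refine iInf₂_le_of_le ρ' ⟨⟨hρ'0, hρ'1⟩, purifDist_le_sqrt_two_mul hfid⟩
    (hMax_nonpos fun σ hσ => ?_)
  refine (fidelity_conj_le hρ0 hL0 (PosSemidef.one.kronecker hσ.1)).trans (le_of_eq ?_)
  have h1 : (L * ((1 : Matrix U U ℂ) ⊗ₖ σ)).trace = 1 := by
    rw [hLdef, one_kronecker_eq_blockDiag, blockDiag_mul, trace_eq_sum_diagBlock]
    simp only [diagBlock_blockDiag]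
    rw [← trace_sum, ← Matrix.sum_mul, hΛsum, Matrix.one_mul, hσ.2]
  rw [h1, hρ1]
  simp

theorem keyLength_le_entropyGap (ψ : CQState X (B × E)) (ε : ℝ) :
    keyLength r ε ψ ≤ entropyGap r √(2 * ε) √(2 * ε) ψ := by
  refine iSup_le fun n => iSup_le fun m => iSup_le fun Q => iSup_le fun h => ?_
  have e : Fin (Fintype.card (Fin n → Bool)) ≃ (Fin n → Bool) := (Fintype.equivFin _).symm
  refine le_iSup_of_le _ (le_iSup_of_le m (le_iSup_of_le (Q.aliceMap e)
    (le_iSup_of_le (Q.aliceMap_allowed e) ?_)))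
  have h1 := EReal.sub_le_sub (Q.logb_card_le_hMinSmooth e ψ h) (Q.hMaxSmooth_nonpos e ψ h)
  have h2 : Real.logb 2 (Fintype.card (Fin n → Bool)) = n := by
    rw [Fintype.card_fun, Fintype.card_bool, Fintype.card_fin, Nat.cast_pow, Nat.cast_ofNat,
      ← Real.rpow_natCast, Real.logb_rpow two_pos (by norm_num)]
  rwa [h2, sub_zero] at h1

end ConverseBound

end SKD

theorem theorem2 {X B E : Type*} [Fintype X] [Fintype B] [DecidableEq B] [Fintype E]
    [DecidableEq E] (ψ : SKD.CQState X (B × E)) (r : SKD.Processing) :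
    (∀ ε ε' ε₁ ε₁' ε₂ : ℝ, 0 ≤ ε₁ → 0 ≤ ε₁' → 0 ≤ ε₂ → ε = ε₁ + ε₂ → ε' = ε₁' + ε₂ →
      SKD.entropyGap r ε₁' ε₁ ψ - 4 * SKD.log2 (1 / ENNReal.ofReal ε₂) - 3
        ≤ SKD.keyLength r (ε + ε') ψ) ∧
    (∀ ε : ℝ, 0 ≤ ε →
      SKD.keyLength r ε ψ ≤ SKD.entropyGap r (Real.sqrt (2 * ε)) (Real.sqrt (2 * ε)) ψ) := by
  refine ⟨fun ε ε' ε₁ ε₁' ε₂ hε₁ hε₁' hε₂ hε hε' => ?_, fun ε _ =>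
    SKD.keyLength_le_entropyGap ψ ε⟩
  subst hε hε'
  exact SKD.entropyGap_sub_le_keyLength ψ hε₁ hε₁' hε₂
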